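/- **Lemma 3.9 (Global approximation property).** *Setting.* Let $d\in\{2,3\}$, let $\mathcal T_h$ be a finite, non-empty, conforming simplicial mesh in $\mathbb R^d$ with $h=\max_T h_T$, $h_T=\operatorname{diam}T$, and let $\Omega$ be the interior of the union of its (closed) cells. The mesh is shape regular: $\rho_T\ge C_{\mathsf{SR}}h_T$ for all $T\in\mathcal T_h$, where $C_{\mathsf{SR}}>0$ and $\rho_T$ is the diameter of the largest ball contained in $T$. Let $k>0$, and let $A$ (symmetric $d\times d$) and $n$ (scalar) be measurable with $$|\xi|^2\le A(x)\xi\cdot\xi\le a_{\max}|\xi|^2\quad(\xi\in\mathbb R^d),\qquad n_{\min}\le n(x)\le 1\qquad\text{for a.e. }x\in\Omega,\qquad n_{\min}>0 .$$ For open $D\subseteq\Omega$ put $a_D(u,v)=\int_D A\nabla u\cdot\nabla v$, $b_D(u,v)=a_D(u,v)-k^2\int_D nuv$, $(u,v)_{1,k,D}=a_D(u,v)+k^2\int_D nuv$ and $\|u\|_{1,k,D}^2=(u,u)_{1,k,D}$; the subscript $D$ is dropped if $D=\Omega$. Let $V^h\subseteq H^1_0(\Omega)$ be the conforming Lagrange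 finite element space of degree $r\ge1$ on $\mathcal T_h$, with nodal basis functions $\phi_l$, $l$ running through the Lagrange nodes in $\Omega$ (the degrees of freedom), and assume, with some $C_{\mathsf{inv}}\ge1$, that $\|\nabla v\|_{L^2(\tau)}\le C_{\mathsf{inv}}k\|v\|_{L^2(\tau)}$ for all $\tau\in\mathcal T_h$, $v\in V^h$. Let $\Omega=\bigcup_{i=1}^N\Omega_i^c$, each $\Omega_i^c$ being the interior of a union of cells, and let $\Lambda_c$ be the maximum over $T\in\mathcal T_h$ of the number of indices $i$ such that $T$ is one of the cells forming $\Omega_i^c$. Let $\widetilde V_i=\{v|_{\Omega_i^c}:v\in V^h\}$, let $\mathrm{dof}(\Omega_i^c)$ be the set of $l$ with $\operatorname{supp}\phi_l\subseteq\overline{\Omega_i^c}$, and let $\mu_l=\#\{i:l\in\mathrm{dof}(\Omega_i^c)\}$. For $v\in\widetilde V_i$ with nodal values $v_l$ put $$\Xi_i^c v=\sum_{l\in\mathrm{dof}(\Omega_i^c)}\mu_l^{-1}v_l\,\phi_l|_{\Omega_i^c},$$ and let $E_i^c$ denote extension by zero to $\Omega$. Assume that for some $M\in\mathbb N$ each cell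 of each $\Omega_i^c$ can be joined, through cells of $\Omega_i^c$, by at most $M$ steps between cells sharing an edge, to a cell of $\Omega_i^c$ that contains a node in $\mathrm{dof}(\Omega_i^c)$. Write $b_i=b_{\Omega_i^c}$ and $c_i(w,v)=(\Xi_i^cw,\Xi_i^cv)_{1,k,\Omega_i^c}$ on $\widetilde V_i$, and $\ker c_i=\{v\in\widetilde V_i: c_i(v,w)=0\ \forall w\in\widetilde V_i\}$. Let $\lambda_1^i\le\dots\le\lambda_{K_i}^i$, $K_i=\dim\widetilde V_i-\dim\ker c_i$, be the finite eigenvalues of $$b_i(p,v)=\lambda\,c_i(p,v)\quad\text{for all }v\in\widetilde V_i,$$ with $c_i$-orthonormal eigenvectors $p_1^i,\dots,p_{K_i}^i\in\widetilde V_i$, and let $1\le m_i<K_i$ be such that $\lambda^i_{m_i+1}>0$. Put $$\Pi_{m_i}v=\sum_{m=1}^{m_i}c_i(v,p^i_m)p^i_m,\qquad V_0=\operatorname{span}\{E_i^c\Xi_i^cp_m^i:1\le m\le m_i,\ 1\le i\le N\},$$ $$\Theta=\frac1{\min_i\lambda^i_{m_i+1}},\qquad C_*=\Lambda_c^2n_{\min}^{-1}(a_{\max}C_{\mathsf{inv}}^2+2)^2\,C_{\mathsf{inv}}^2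 .$$ *Claim.* There are constants $C_1,C_2>0$ depending only on $d,r,C_{\mathsf{SR}}$ and $M$ such that, whenever $(kh)^2\le C_1$, the following holds. (a) (Choice of $C_1$.) $b_i(v,v)\ge C_1h^{-2}\|v\|^2_{L^2(\Omega_i^c)}$ for all $i$ and all $v\in\ker c_i$. (b) (Choice of $C_2$.) For all $i$ and all $v\in\widetilde V_i$, with $w=v-\Pi_{m_i}v$: $\;0\le b_i(w,w)\le C_2^2a_{\max}n_{\min}^{-1}C_*\|v\|^2_{1,k,\Omega_i^c}$. (c) (Global approximation.) For every $v\in V^h$ the function $z_0=\sum_{i=1}^NE_i^c\Xi_i^c(\Pi_{m_i}v|_{\Omega_i^c})$ lies in $V_0$, and $$\inf_{z\in V_0}\|v-z\|_{1,k}^2\le\|v-z_0\|_{1,k}^2\le C_2^2\,\Lambda_c^2\,a_{\max}n_{\min}^{-1}C_*\,\Theta\,\|v\|_{1,k}^2 .$$ -/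

import Mathlib

open MeasureTheory Set

noncomputable section

/-- `ℝᵈ` with the Euclidean norm. -/
abbrev Pt (d : ℕ) : Type := EuclideanSpace ℝ (Fin d)

/-- The closed simplex spanned by a finite set of vertices. -/
def simplexHull {d : ℕ} (T : Finset (Pt d)) : Set (Pt d) := convexHull ℝ (T : Set (Pt d))

/-- A finite conforming simplicial mesh; a cell is given by its `d + 1` vertices. -/
structure SimplicialMesh (d : ℕ) where
  cells : Finset (Finset (Pt d))
  nonempty : cells.Nonempty
  card_eq : ∀ T ∈ cells, T.card = d + 1
  indep : ∀ T ∈ cells, AffineIndependent ℝ ((↑) : T → Pt d)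
  conforming : ∀ S ∈ cells, ∀ T ∈ cells,
    simplexHull S ∩ simplexHull T ⊆ convexHull ℝ ((S : Set (Pt d)) ∩ (T : Set (Pt d)))

/-- The open polyhedral set resolved by a set of cells: the interior of their union. -/
def openUnion {d : ℕ} (S : Finset (Finset (Pt d))) : Set (Pt d) :=
  interior (⋃ T ∈ S, simplexHull T)

/-- `h_T`, the diameter of a cell. -/
def cellDiam {d : ℕ} (T : Finset (Pt d)) : ℝ := Metric.diam (simplexHull T)

/-- `ρ_T`, the diameter of the largest ball inscribed in a cell. -/
def cellInDiam {d : ℕ} (T : Finset (Pt d)) : ℝ :=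
  sSup {t : ℝ | ∃ (x : Pt d) (ρ : ℝ), 0 ≤ ρ ∧ t = 2 * ρ ∧ Metric.closedBall x ρ ⊆ simplexHull T}

/-- The mesh diameter `h = max_T h_T`. -/
def SimplicialMesh.size {d : ℕ} (M : SimplicialMesh d) : ℝ :=
  M.cells.sup' M.nonempty cellDiam

/-- Restriction of a function on `ℝᵈ` to `D`, as a linear map. -/
def restrictTo {d : ℕ} (D : Set (Pt d)) : (Pt d → ℝ) →ₗ[ℝ] (D → ℝ) where
  toFun v := fun x => v x
  map_add' _ _ := rfl
  map_smul' _ _ := rfl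

/-- Extension by zero of a function on `D`. -/
def zeroExt {d : ℕ} {D : Set (Pt d)} (u : D → ℝ) : Pt d → ℝ :=
  Function.extend Subtype.val u 0

/-- `∫_D |v|²`. -/
def l2Sq {d : ℕ} (D : Set (Pt d)) (v : Pt d → ℝ) : ℝ := ∫ x in D, v x ^ 2

/-- `∫_D |∇v|²`.  All functions to which this and the forms below are applied are continuous and
piecewise polynomial on the open set in question (with respect to the mesh), so that their weak
gradient is the classical one, which exists almost everywhere. -/
def gradSq {d : ℕ} (D : Set (Pt d)) (v : Pt d → ℝ) : ℝ := ∫ x in D, ‖gradient v x‖ ^ 2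

/-- The data of the method: mesh, polynomial degree, coefficients `A` and `n`, wave number `k`, and
the coarse cover `Ω_1, …, Ω_N`, each `Ω_i` being given by the set of cells that form it. -/
structure HkGenEO (d : ℕ) where
  mesh : SimplicialMesh d
  r : ℕ
  A : Pt d → Matrix (Fin d) (Fin d) ℝ
  n : Pt d → ℝ
  k : ℝ
  N : ℕ
  sub : Fin N → Finset (Finset (Pt d))

namespace HkGenEO

variable {d : ℕ}

/-- The domain `Ω`. -/
def Om (P : HkGenEO d) : Set (Pt d) := openUnion P.mesh.cells

/-- The coarse subdomain `Ω_i`. -/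
def Omc (P : HkGenEO d) (i : Fin P.N) : Set (Pt d) := openUnion (P.sub i)

/-- `a_D(u, v) = ∫_D A ∇u · ∇v`. -/
def aForm (P : HkGenEO d) (D : Set (Pt d)) (u v : Pt d → ℝ) : ℝ :=
  ∫ x in D, Matrix.mulVec (P.A x) (fun j => gradient u x j) ⬝ᵥ (fun j => gradient v x j)

/-- `(u, v)_{n, D} = ∫_D n u v`. -/
def nForm (P : HkGenEO d) (D : Set (Pt d)) (u v : Pt d → ℝ) : ℝ :=
  ∫ x in D, P.n x * u x * v x

/-- `b_D(u, v) = a_D(u, v) - k² (u, v)_{n, D}`. -/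
def bForm (P : HkGenEO d) (D : Set (Pt d)) (u v : Pt d → ℝ) : ℝ :=
  P.aForm D u v - P.k ^ 2 * P.nForm D u v

/-- `(u, v)_{1, k, D} = a_D(u, v) + k² (u, v)_{n, D}`. -/
def energyForm (P : HkGenEO d) (D : Set (Pt d)) (u v : Pt d → ℝ) : ℝ :=
  P.aForm D u v + P.k ^ 2 * P.nForm D u v

/-- The norm `‖u‖_{1, k, D}`. -/
def energyNorm (P : HkGenEO d) (D : Set (Pt d)) (u : Pt d → ℝ) : ℝ :=
  √(P.energyForm D u u)

/-- The Lagrange finite element space `V^h ⊆ H¹₀(Ω)`: continuous functions that are polynomials of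
degree at most `r` on each cell and vanish on `∂Ω`, extended by zero to `ℝᵈ`. -/
def Vh (P : HkGenEO d) : Submodule ℝ (Pt d → ℝ) where
  carrier := {v | Continuous v ∧ (∀ x, x ∉ P.Om → v x = 0) ∧
    ∀ T ∈ P.mesh.cells, ∃ q : MvPolynomial (Fin d) ℝ, q.totalDegree ≤ P.r ∧
      ∀ x ∈ simplexHull T, v x = MvPolynomial.eval (fun j => x j) q}
  zero_mem' := ⟨continuous_const, fun _ _ => rfl, fun _ _ => ⟨0, by simp, by simp⟩⟩
  add_mem' := by
    rintro u v ⟨hu, hu', hu''⟩ ⟨hv, hv', hv''⟩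
    refine ⟨hu.add hv, fun x hx => by simp [hu' x hx, hv' x hx], fun T hT => ?_⟩
    obtain ⟨p, hp, hp'⟩ := hu'' T hT
    obtain ⟨q, hq, hq'⟩ := hv'' T hT
    exact ⟨p + q, (MvPolynomial.totalDegree_add p q).trans (max_le hp hq),
      fun x hx => by simp [hp' x hx, hq' x hx]⟩
  smul_mem' := by
    rintro c v ⟨hv, hv', hv''⟩
    refine ⟨hv.const_smul c, fun x hx => by simp [hv' x hx], fun T hT => ?_⟩
    obtain ⟨q, hq, hq'⟩ := hv'' T hT
    exact ⟨c • q, (MvPolynomial.totalDegree_smul_le c q).trans hq,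
      fun x hx => by simp [hq' x hx, MvPolynomial.smul_eval]⟩

open Classical in
/-- The Lagrange nodes of a cell: points with barycentric coordinates in `(1/r) ℕ`. -/
def cellNodes (P : HkGenEO d) (T : Finset (Pt d)) : Finset (Pt d) :=
  (T.piAntidiag P.r).image fun α => ∑ p ∈ T, ((α p : ℝ) / (P.r : ℝ)) • p

open Classical in
/-- The degrees of freedom of `V^h`: the Lagrange nodes in `Ω`. -/
def nodes (P : HkGenEO d) : Finset (Pt d) :=
  (P.mesh.cells.biUnion P.cellNodes).filter fun x => x ∈ P.Om

open Classical in
/-- The nodal basis function `φ_l`: the element of `V^h` with `φ_l(l) = 1` that vanishes at all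
other nodes. -/
def nodalBasis (P : HkGenEO d) (l : Pt d) : Pt d → ℝ :=
  if h : ∃ φ ∈ P.Vh, ∀ m ∈ P.nodes, φ m = if m = l then 1 else 0 then h.choose else 0

open Classical in
/-- `dof(D)`: the degrees of freedom interior to `D`, i.e. with `supp φ_l ⊆ closure D`. -/
def dof (P : HkGenEO d) (D : Set (Pt d)) : Finset (Pt d) :=
  P.nodes.filter fun l => tsupport (P.nodalBasis l) ⊆ closure D

open Classical in
/-- `μ_l`: the number of coarse subdomains to which `l` is interior. -/
def mult (P : HkGenEO d) (l : Pt d) : ℕ :=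
  (Finset.univ.filter fun i : Fin P.N => l ∈ P.dof (P.Omc i)).card

open Classical in
/-- `Λ_c`: the maximal number of coarse subdomains that share a cell. -/
def overlapC (P : HkGenEO d) : ℕ :=
  P.mesh.cells.sup fun T => (Finset.univ.filter fun i : Fin P.N => T ∈ P.sub i).card

/-- `Ṽ_i`: the restrictions to `Ω_i` of the elements of `V^h`. -/
def Vt (P : HkGenEO d) (i : Fin P.N) : Submodule ℝ (P.Omc i → ℝ) :=
  P.Vh.map (restrictTo (P.Omc i))

/-- The partition of unity operator
`Ξ_i v = ∑_{l ∈ dof(Ω_i)} μ_l⁻¹ v_l φ_l|_{Ω_i}`, where `v_l` is the value of `v` at the node `l`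
(which lies in `Ω_i`). -/
def Xi (P : HkGenEO d) (i : Fin P.N) (v : P.Omc i → ℝ) : P.Omc i → ℝ :=
  ∑ l ∈ P.dof (P.Omc i),
    ((1 / (P.mult l : ℝ)) * zeroExt v l) • restrictTo (P.Omc i) (P.nodalBasis l)

/-- `b_i`, the form `b` on `Ω_i`. -/
def bi (P : HkGenEO d) (i : Fin P.N) (u v : P.Omc i → ℝ) : ℝ :=
  P.bForm (P.Omc i) (zeroExt u) (zeroExt v)

/-- `c_i(u, v) = (Ξ_i u, Ξ_i v)_{1, k, Ω_i}`. -/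
def ci (P : HkGenEO d) (i : Fin P.N) (u v : P.Omc i → ℝ) : ℝ :=
  P.energyForm (P.Omc i) (zeroExt (P.Xi i u)) (zeroExt (P.Xi i v))

/-- `ker c_i`. -/
def kerC (P : HkGenEO d) (i : Fin P.N) : Set (P.Omc i → ℝ) :=
  {v | v ∈ P.Vt i ∧ ∀ w ∈ P.Vt i, P.ci i v w = 0}

/-- `lam 0 ≤ lam 1 ≤ …` are all the finite eigenvalues, with multiplicity, of the local generalised
eigenvalue problem `b_i(p, v) = λ c_i(p, v)` for all `v ∈ Ṽ_i`, and the `p j` are corresponding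
`c_i`-orthonormal eigenvectors; their number is `dim Ṽ_i - dim ker c_i`. -/
structure IsEigensystem (P : HkGenEO d) (i : Fin P.N) {K : ℕ} (lam : Fin K → ℝ)
    (p : Fin K → P.Omc i → ℝ) : Prop where
  number : K + Set.finrank ℝ (P.kerC i) = Module.finrank ℝ (P.Vt i)
  mem : ∀ j, p j ∈ P.Vt i
  eigen : ∀ j, ∀ v ∈ P.Vt i, P.bi i (p j) v = lam j * P.ci i (p j) v
  orthonormal : ∀ j j', P.ci i (p j) (p j') = if j = j' then 1 else 0
  mono : Monotone lam

/-- The local projector `Π_m v = ∑_{j ≤ m} c_i(v, p_j) p_j` (the first `m` eigenvectors). -/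
def proj (P : HkGenEO d) (i : Fin P.N) {K : ℕ} (p : Fin K → P.Omc i → ℝ) (m : ℕ)
    (v : P.Omc i → ℝ) : P.Omc i → ℝ :=
  ∑ j : Fin K with j.val < m, P.ci i v (p j) • p j

/-- The coarse space `V_0 = span {E_i Ξ_i p^i_j : j = 1, …, m_i, i = 1, …, N}`. -/
def V0 (P : HkGenEO d) {K : Fin P.N → ℕ} (p : ∀ i, Fin (K i) → P.Omc i → ℝ) (m : Fin P.N → ℕ) :
    Submodule ℝ (Pt d → ℝ) :=
  Submodule.span ℝ {u | ∃ (i : Fin P.N) (j : Fin (K i)), j.val < m i ∧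
    u = zeroExt (P.Xi i (p i j))}

/-- `z_0 = ∑_i E_i Ξ_i (Π_{m_i} v|_{Ω_i})`. -/
def z0 (P : HkGenEO d) {K : Fin P.N → ℕ} (p : ∀ i, Fin (K i) → P.Omc i → ℝ) (m : Fin P.N → ℕ)
    (v : Pt d → ℝ) : Pt d → ℝ :=
  ∑ i, zeroExt (P.Xi i (P.proj i (p i) (m i) (restrictTo (P.Omc i) v)))

/-- `Θ = 1 / min_i λ^i_{m_i + 1}` (in the 0-based numbering of `lam i` this is entry `m i`). -/
def Theta (P : HkGenEO d) {K : Fin P.N → ℕ} (lam : ∀ i, Fin (K i) → ℝ) (m : Fin P.N → ℕ)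
    (hm : ∀ i, m i < K i) : ℝ :=
  1 / ⨅ i, lam i ⟨m i, hm i⟩

/-- `C_* = Λ_c² n_min⁻¹ (a_max C_inv² + 2)² C_inv²`. -/
def Cstar (P : HkGenEO d) (amax nmin Cinv : ℝ) : ℝ :=
  ((P.overlapC : ℝ) ^ 2 * nmin⁻¹ * (amax * Cinv ^ 2 + 2) ^ 2) * Cinv ^ 2

/-- The assumptions on the coefficients, scaled so that `a_min = 1 = n_max`. -/
structure CoeffBounds (P : HkGenEO d) (amax nmin : ℝ) : Prop where
  meas_A : ∀ i j, AEMeasurable (fun x => P.A x i j) (volume.restrict P.Om)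
  meas_n : AEMeasurable P.n (volume.restrict P.Om)
  symm : ∀ᵐ x ∂(volume.restrict P.Om), (P.A x).IsSymm
  bounds_A : ∀ᵐ x ∂(volume.restrict P.Om), ∀ ξ : Fin d → ℝ,
    ξ ⬝ᵥ ξ ≤ Matrix.mulVec (P.A x) ξ ⬝ᵥ ξ ∧ Matrix.mulVec (P.A x) ξ ⬝ᵥ ξ ≤ amax * (ξ ⬝ᵥ ξ)
  nmin_pos : 0 < nmin
  bounds_n : ∀ᵐ x ∂(volume.restrict P.Om), nmin ≤ P.n x ∧ P.n x ≤ 1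

/-- Shape regularity, `ρ_T ≥ C_SR h_T`. -/
def ShapeRegular (P : HkGenEO d) (CSR : ℝ) : Prop :=
  ∀ T ∈ P.mesh.cells, CSR * cellDiam T ≤ cellInDiam T

/-- The inverse estimate `‖∇v‖_τ ≤ C_inv k ‖v‖_τ` on all cells `τ`. -/
def InverseEstimate (P : HkGenEO d) (Cinv : ℝ) : Prop :=
  1 ≤ Cinv ∧ ∀ τ ∈ P.mesh.cells, ∀ v ∈ P.Vh,
    √(gradSq (simplexHull τ) v) ≤ Cinv * P.k * √(l2Sq (simplexHull τ) v)

/-- The subdomains are unions of cells and their open sets cover `Ω`. -/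
def IsCover (P : HkGenEO d) : Prop :=
  (∀ i, P.sub i ⊆ P.mesh.cells) ∧ P.Om = ⋃ i, P.Omc i

/-- Each cell of each coarse subdomain can be joined, inside the subdomain, by at most `M` steps
between cells that share an edge (or are equal), to a cell containing a degree of freedom that is
interior to the subdomain. -/
def InteriorReach (P : HkGenEO d) (M : ℕ) : Prop :=
  ∀ i, ∀ T ∈ P.sub i, ∃ c : ℕ → Finset (Pt d), c 0 = T ∧ (∀ j ≤ M, c j ∈ P.sub i) ∧
    (∀ j < M, ∃ x y : Pt d, x ≠ y ∧ x ∈ c j ∧ x ∈ c (j + 1) ∧ y ∈ c j ∧ y ∈ c (j + 1)) ∧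
    ∃ l ∈ P.dof (P.Omc i), l ∈ simplexHull (c M)

end HkGenEO

end

/-! Put w_i = v − Π_{m_i} v on Ω_i. The operators E_i Ξ_i sum to the identity on V^h (`sum_xiExt`),
so v − z_0 = ∑ E_i Ξ_i w_i. At most Λ_c of these terms meet a given cell, so the energy of the sum
is at most Λ_c ∑ c_i(w_i, w_i) (`energyForm_sum_le`). As w_i has no component along the first m_i
eigenvectors, c_i(w_i, w_i) is at most b_i(w_i, w_i) divided by the next eigenvalue. Finally
b_i(w_i, w_i) is bounded by the local energy of v, and the local energies add up to at most Λ_c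
times the global one (`sum_energyForm_le`).

Since b_i is indefinite, the local step (`projection_error`) needs two further facts. First, b_i
must be nonnegative on ker c_i. Elements of this kernel vanish at the interior nodes
(`exists_of_mem_kerC`), and every cell is linked to such a node by a short chain of cells; this
gives a Poincaré inequality with a factor h (`exists_poincare`), so b_i is coercive on the kernel
when kh is small (`coercive_kerC`).

Second, subtracting Π v may remove negative terms λ_j c_i(v, p_j)², so the λ_j must be bounded below
(`neg_eigenvalue_le`). Split an eigenvector as p = q + z, where q carries the interior nodal values
and z lies in ker c_i. Then b_i(p, z) = 0, and coercivity at z yields that −b_i(p, p) is at most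
four times the energy of q (`neg_form_le`). The inverse estimate and a comparison of nodal values
bound that energy in terms of c_i(p, p) = 1. With −λ_j ≤ X one gets b_i(w, w) ≤ b_i(v, v) + X c_i(v,
v), and Ξ_i is stable in energy (`ci_le`).

Nodal comparison (`exists_l2Sq_le`) and oscillation bounds (`exists_oscillation_Vh_le`) rest on an
affine map from one reference cell, so their constants depend on d and r only. Shape regularity and
M enter through the Poincaré constant alone. The nodal basis is given by its nodal values only, so
its existence has to be proved too (`exists_nodalBasis`). -/

noncomputable section

/-! ### Barycentric coordinates on a cell -/

/-- A finite set of points which spans a nondegenerate `d`-simplex. -/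
def IsCell {d : ℕ} (T : Finset (Pt d)) : Prop :=
  T.card = d + 1 ∧ AffineIndependent ℝ ((↑) : T → Pt d)

namespace IsCell

variable {d : ℕ} {S T : Finset (Pt d)}

/-- The affine basis formed by the vertices of a cell. -/
def basis (h : IsCell T) : AffineBasis T ℝ (Pt d) where
  toFun := (↑)
  ind' := h.2
  tot' := by
    rw [h.2.affineSpan_eq_top_iff_card_eq_finrank_add_one]
    simp [h.1]

lemma range_basis (h : IsCell T) : range h.basis = (T : Set (Pt d)) := by
  change range ((↑) : T → Pt d) = _
  simp

end IsCell

open Classical in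
/-- Barycentric coordinates on a cell, extended by zero to indices which are no vertices. -/
def bary {d : ℕ} (T : Finset (Pt d)) (p : Pt d) : Pt d →ᵃ[ℝ] ℝ :=
  if h : IsCell T ∧ p ∈ T then h.1.basis.coord ⟨p, h.2⟩ else 0

namespace IsCell

variable {d : ℕ} {S T : Finset (Pt d)}

lemma bary_of_mem (h : IsCell T) {p : Pt d} (hp : p ∈ T) :
    bary T p = h.basis.coord ⟨p, hp⟩ := dif_pos ⟨h, hp⟩

lemma bary_of_notMem {p : Pt d} (hp : p ∉ T) : bary T p = 0 := dif_neg fun h => hp h.2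

lemma sum_bary (h : IsCell T) (x : Pt d) : ∑ p ∈ T, bary T p x = 1 := by
  rw [← h.basis.sum_coord_apply_eq_one x, ← Finset.sum_coe_sort]
  exact Finset.sum_congr rfl fun p _ => by rw [h.bary_of_mem p.2]

lemma sum_bary_smul (h : IsCell T) (x : Pt d) : ∑ p ∈ T, bary T p x • p = x := by
  conv_rhs => rw [← h.basis.linear_combination_coord_eq_self x]
  rw [← Finset.sum_coe_sort]
  exact Finset.sum_congr rfl fun p _ => by rw [h.bary_of_mem p.2]; rfl

lemma bary_combination (h : IsCell T) {w : Pt d → ℝ} (hw : ∑ p ∈ T, w p = 1) {p : Pt d}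
    (hp : p ∈ T) : bary T p (∑ q ∈ T, w q • q) = w p := by
  rw [h.bary_of_mem hp, ← Finset.sum_coe_sort T fun q => w q • q]
  have hw' : ∑ q : T, w q = 1 := by rw [Finset.sum_coe_sort]; exact hw
  have := h.basis.coord_apply_combination_of_mem (Finset.mem_univ ⟨p, hp⟩)
    (w := fun q : T => w q) hw'
  rw [← this, Finset.affineCombination_eq_linear_combination _ _ _ hw']
  rfl

lemma bary_vertex (h : IsCell T) {p q : Pt d} (hq : q ∈ T) :
    bary T p q = if p = q then 1 else 0 := by
  by_cases hp : p ∈ T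
  · rw [h.bary_of_mem hp]
    change h.basis.coord ⟨p, hp⟩ (h.basis ⟨q, hq⟩) = _
    rw [AffineBasis.coord_apply]
    simp
  · rw [bary_of_notMem hp, if_neg (by rintro rfl; exact hp hq)]
    rfl

lemma hull_eq (h : IsCell T) : simplexHull T = {x | ∀ p, 0 ≤ bary T p x} := by
  rw [simplexHull, ← h.range_basis, h.basis.convexHull_eq_nonneg_coord]
  ext x
  refine ⟨fun hx p => ?_, fun hx p => ?_⟩
  · by_cases hp : p ∈ T
    · rw [h.bary_of_mem hp]; exact hx _
    · rw [bary_of_notMem hp]; exact le_rfl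
  · have := hx p
    rwa [h.bary_of_mem p.2] at this

lemma mem_hull (h : IsCell T) {x : Pt d} : x ∈ simplexHull T ↔ ∀ p, 0 ≤ bary T p x := by
  rw [h.hull_eq]; rfl

lemma interior_eq (h : IsCell T) :
    interior (simplexHull T) = {x | ∀ p ∈ T, 0 < bary T p x} := by
  rw [simplexHull, ← h.range_basis, h.basis.interior_convexHull]
  ext x
  refine ⟨fun hx p hp => ?_, fun hx p => ?_⟩
  · rw [h.bary_of_mem hp]; exact hx _
  · have := hx p p.2
    rwa [h.bary_of_mem p.2] at this

lemma bary_le_one (h : IsCell T) {x : Pt d} (hx : x ∈ simplexHull T) (p : Pt d) :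
    bary T p x ≤ 1 := by
  by_cases hp : p ∈ T
  · rw [← h.sum_bary x]
    exact Finset.single_le_sum (f := fun p => bary T p x) (fun q _ => h.mem_hull.1 hx q) hp
  · rw [bary_of_notMem hp]; exact zero_le_one

lemma nonempty (h : IsCell T) : T.Nonempty := by
  rw [← Finset.card_pos, h.1]; omega

lemma interior_nonempty (h : IsCell T) : (interior (simplexHull T)).Nonempty := by
  have := h.basis.centroid_mem_interior_convexHull
  rw [h.range_basis] at this
  exact ⟨_, this⟩

end IsCell

/-! ### Closed simplices: size, volume, null boundary -/

section Hull

variable {d : ℕ} (T : Finset (Pt d))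

lemma convex_simplexHull : Convex ℝ (simplexHull T) := convex_convexHull ℝ _

lemma isCompact_simplexHull : IsCompact (simplexHull T) := T.finite_toSet.isCompact_convexHull ℝ

lemma isClosed_simplexHull : IsClosed (simplexHull T) := (isCompact_simplexHull T).isClosed

lemma measurableSet_simplexHull : MeasurableSet (simplexHull T) :=
  (isClosed_simplexHull T).measurableSet

lemma volume_simplexHull_lt_top : volume (simplexHull T) < ⊤ :=
  (isCompact_simplexHull T).measure_lt_top

lemma ae_mem_interior_simplexHull :
    ∀ᵐ x ∂(volume.restrict (simplexHull T)), x ∈ interior (simplexHull T) := by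
  rw [ae_restrict_iff' (measurableSet_simplexHull T)]
  have : volume (frontier (simplexHull T)) = 0 := (convex_simplexHull T).addHaar_frontier volume
  filter_upwards [measure_eq_zero_iff_ae_notMem.1 this] with x hx hxT
  by_contra h
  exact hx ⟨subset_closure hxT, h⟩

lemma subset_simplexHull : (T : Set (Pt d)) ⊆ simplexHull T := subset_convexHull ℝ (T : Set (Pt d))

lemma dist_le_cellDiam {x y : Pt d} (hx : x ∈ simplexHull T) (hy : y ∈ simplexHull T) :
    dist x y ≤ cellDiam T :=
  Metric.dist_le_diam_of_mem (isCompact_simplexHull T).isBounded hx hy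

lemma cellDiam_nonneg : 0 ≤ cellDiam T := Metric.diam_nonneg

end Hull

namespace IsCell

variable {d : ℕ} {S T : Finset (Pt d)}

lemma closure_interior (h : IsCell T) : closure (interior (simplexHull T)) = simplexHull T := by
  rw [(convex_simplexHull T).closure_interior_eq_closure_of_nonempty_interior h.interior_nonempty,
    (isClosed_simplexHull T).closure_eq]

lemma volume_pos (h : IsCell T) : 0 < volume (simplexHull T) :=
  Measure.measure_pos_of_nonempty_interior _ h.interior_nonempty

lemma volume_real_pos (h : IsCell T) : 0 < volume.real (simplexHull T) :=
  ENNReal.toReal_pos h.volume_pos.ne' (volume_simplexHull_lt_top T).ne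

/-- An edge is at least as long as the diameter of any inscribed ball. -/
lemma cellInDiam_le_dist (h : IsCell T) {x y : Pt d} (hxy : x ≠ y) (hx : x ∈ T) (hy : y ∈ T) :
    cellInDiam T ≤ dist x y := by
  refine csSup_le ?_ ?_
  · exact ⟨0, x, 0, le_rfl, by simp, by simpa using subset_simplexHull T hx⟩
  rintro t ⟨z, ρ, hρ, rfl, hz⟩
  set L := (bary T x).linear with hL
  have hd : 0 < dist x y := dist_pos.2 hxy
  have hne : dist x y ≠ 0 := hd.ne'
  set u : Pt d := (ρ / dist x y) • (x - y) with hu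
  have hnu : ‖u‖ = ρ := by
    rw [hu, norm_smul, ← dist_eq_norm, Real.norm_of_nonneg (by positivity)]
    field_simp
  have hLu : L u = ρ / dist x y := by
    have h1 := (bary T x).linearMap_vsub x y
    rw [h.bary_vertex hx, h.bary_vertex hy] at h1
    simp only [hxy, if_true, if_false, vsub_eq_sub, sub_zero] at h1
    rw [hu, map_smul, h1, smul_eq_mul, mul_one]
  have hp : z + u ∈ simplexHull T := hz (by simp [hnu])
  have hm : z - u ∈ simplexHull T := hz (by simp [hnu])
  have e1 : bary T x (z + u) - bary T x (z - u) = 2 * L u := by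
    have h1 := (bary T x).linearMap_vsub (z + u) (z - u)
    simp only [vsub_eq_sub] at h1
    rw [← h1, show z + u - (z - u) = (2 : ℝ) • u by rw [two_smul]; abel, map_smul, smul_eq_mul]
  -- The coordinate of `x` grows by 1 along the edge from `y` to `x`, hence by `2ρ / dist x y` along
  -- the parallel diameter of the ball; but it stays in `[0, 1]` on the cell.
  have h2 : 2 * (ρ / dist x y) ≤ 1 := by
    rw [← hLu, ← e1]
    linarith [h.bary_le_one hp x, h.mem_hull.1 hm x]
  rw [← mul_div_assoc, div_le_one hd] at h2
  exact h2

lemma cellDiam_pos (h : IsCell T) (hd : d ≠ 0) : 0 < cellDiam T := by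
  have hc : 1 < T.card := by rw [h.1]; omega
  obtain ⟨x, hx, y, hy, hxy⟩ := Finset.one_lt_card.1 hc
  exact (dist_pos.2 hxy).trans_le
    (dist_le_cellDiam T (subset_simplexHull T hx) (subset_simplexHull T hy))

/-- Lower volume bound by an inscribed ball. -/
lemma volume_ge (h : IsCell T) (hd : d ≠ 0) {c : ℝ} (hc : 0 < c)
    (hT : c * cellDiam T ≤ cellInDiam T) :
    (c * cellDiam T / 4) ^ d * volume.real (Metric.ball (0 : Pt d) 1) ≤
      volume.real (simplexHull T) := by
  have h0 := h.cellDiam_pos hd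
  -- Halving makes the inequality strict, so that an actual ball exists although the supremum is not
  -- known to be attained; its radius exceeds a quarter of `c * cellDiam T`.
  have : c * cellDiam T / 2 < cellInDiam T := by
    have : 0 < c * cellDiam T := by positivity
    linarith
  obtain ⟨t, ⟨z, ρ, hρ, rfl, hz⟩, ht⟩ := exists_lt_of_lt_csSup (by
    obtain ⟨x, hx⟩ := h.nonempty
    exact ⟨0, x, 0, le_rfl, by simp, by simpa using subset_simplexHull T hx⟩) this
  have hsub : Metric.ball z (c * cellDiam T / 4) ⊆ simplexHull T :=
    (Metric.ball_subset_closedBall.trans (Metric.closedBall_subset_closedBall (by linarith))).trans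
      hz
  have h3 := measureReal_mono hsub (volume_simplexHull_lt_top T).ne
  refine le_trans (le_of_eq ?_) h3
  rw [measureReal_def, measureReal_def, Measure.addHaar_ball_of_pos volume z (r := c * cellDiam T / 4) (by positivity)]
  simp only [finrank_euclideanSpace, Fintype.card_fin, ENNReal.toReal_mul]
  rw [ENNReal.toReal_ofReal (by positivity)]

/-- A set with few points has a null convex hull. -/
lemma volume_convexHull_eq_zero {s : Finset (Pt d)} (hs : s.card ≤ d) :
    volume (convexHull ℝ (s : Set (Pt d))) = 0 := by
  refine measure_mono_null (convexHull_subset_affineSpan _) (Measure.addHaar_affineSubspace _ _ ?_)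
  intro htop
  rcases s.eq_empty_or_nonempty with rfl | hne
  · simp at htop
  have : Fintype.card s = (s.card - 1) + 1 := by
    have := hne.card_pos
    simp; omega
  have h2 := finrank_vectorSpan_range_le ℝ ((↑) : s → Pt d) this
  have h3 : vectorSpan ℝ (range ((↑) : s → Pt d)) = ⊤ := by
    rw [← direction_affineSpan, Subtype.range_coe_subtype]
    have : affineSpan ℝ {x | x ∈ s} = ⊤ := htop
    rw [this, AffineSubspace.direction_top]
  rw [h3, finrank_top, finrank_euclideanSpace, Fintype.card_fin] at h2
  have := hne.card_pos
  omega

end IsCell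

/-! ### Polynomials as functions on ℝᵈ -/

section PolyFun

variable {d : ℕ}

/-- The function on `ℝᵈ` defined by a polynomial. -/
def polyFun (q : MvPolynomial (Fin d) ℝ) (x : Pt d) : ℝ := MvPolynomial.eval (fun j => x j) q

lemma polyFun_add (p q : MvPolynomial (Fin d) ℝ) (x : Pt d) :
    polyFun (p + q) x = polyFun p x + polyFun q x := by simp [polyFun]

lemma polyFun_smul (c : ℝ) (q : MvPolynomial (Fin d) ℝ) (x : Pt d) :
    polyFun (c • q) x = c * polyFun q x := by simp [polyFun, MvPolynomial.smul_eval]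

lemma polyFun_sum {ι : Type*} (s : Finset ι) (q : ι → MvPolynomial (Fin d) ℝ) (x : Pt d) :
    polyFun (∑ i ∈ s, q i) x = ∑ i ∈ s, polyFun (q i) x := by simp [polyFun]

@[fun_prop]
lemma continuous_polyFun (q : MvPolynomial (Fin d) ℝ) : Continuous (polyFun q) := by
  have : Continuous fun x : Pt d => (fun j => x j) := by fun_prop
  exact (MvPolynomial.continuous_eval q).comp this

/-- The gradient field of a polynomial. -/
def polyGrad (q : MvPolynomial (Fin d) ℝ) (x : Pt d) : Pt d :=
  WithLp.toLp 2 fun j => polyFun (MvPolynomial.pderiv j q) x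

lemma norm_polyGrad_sq (q : MvPolynomial (Fin d) ℝ) (x : Pt d) :
    ‖polyGrad q x‖ ^ 2 = ∑ j, polyFun (MvPolynomial.pderiv j q) x ^ 2 := by
  rw [EuclideanSpace.norm_sq_eq]
  simp [polyGrad]

lemma hasGradientAt_polyFun (q : MvPolynomial (Fin d) ℝ) (x : Pt d) :
    HasGradientAt (polyFun q) (polyGrad q x) x := by
  rw [hasGradientAt_iff_hasFDerivAt]
  induction q using MvPolynomial.induction_on with
  | C a =>
    have h1 : polyFun (MvPolynomial.C a : MvPolynomial (Fin d) ℝ) = fun _ => a := by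
      ext y; simp [polyFun]
    have h2 : polyGrad (MvPolynomial.C a : MvPolynomial (Fin d) ℝ) x = 0 := by
      ext j; simp [polyGrad, polyFun]
    rw [h1, h2, map_zero]
    exact hasFDerivAt_const a x
  | add p q hp hq =>
    have h1 : polyFun (p + q) = polyFun p + polyFun q := by ext y; simp [polyFun]
    have h2 : polyGrad (p + q) x = polyGrad p x + polyGrad q x := by
      ext j; simp [polyGrad, polyFun]
    rw [h1, h2, map_add]
    exact hp.add hq
  | mul_X p n hp =>
    have h1 : polyFun (p * MvPolynomial.X n) = fun y => polyFun p y * y n := by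
      ext y; simp [polyFun]
    have h3 : HasFDerivAt (fun y : Pt d => y n)
        (EuclideanSpace.proj n : Pt d →L[ℝ] ℝ) x :=
      (EuclideanSpace.proj n : Pt d →L[ℝ] ℝ).hasFDerivAt
    rw [h1]
    convert! hp.mul h3 using 1
    ext y
    simp only [InnerProductSpace.toDual_apply_apply, polyGrad, polyFun,
      add_apply, smul_apply, smul_eq_mul,
      EuclideanSpace.inner_eq_star_dotProduct]
    simp [dotProduct, MvPolynomial.pderiv_X, Pi.single_apply, Finset.sum_add_distrib,
      Finset.mul_sum, mul_add]
    congr 1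
    · rw [Finset.sum_eq_single n (fun j _ hj => by simp [hj.symm]) (by simp)]
      simp [mul_comm]
    · exact Finset.sum_congr rfl fun j _ => by ring

lemma continuous_polyGrad (q : MvPolynomial (Fin d) ℝ) : Continuous (polyGrad q) := by
  unfold polyGrad
  fun_prop

lemma totalDegree_pderiv_le (q : MvPolynomial (Fin d) ℝ) (j : Fin d) :
    (MvPolynomial.pderiv j q).totalDegree ≤ q.totalDegree := by
  conv_lhs => rw [q.as_sum, map_sum]
  refine MvPolynomial.totalDegree_finsetSum_le fun s hs => ?_
  rw [MvPolynomial.pderiv_monomial]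
  refine (MvPolynomial.totalDegree_monomial_le _ _).trans (le_trans ?_ (MvPolynomial.le_totalDegree hs))
  exact Finsupp.degree_mono tsub_le_self

/-- The polynomial of an affine function. -/
def affinePoly (g : Pt d →ᵃ[ℝ] ℝ) : MvPolynomial (Fin d) ℝ :=
  MvPolynomial.C (g 0) +
    ∑ j, MvPolynomial.C (g.linear (EuclideanSpace.single j 1)) * MvPolynomial.X j

lemma polyFun_affinePoly (g : Pt d →ᵃ[ℝ] ℝ) (x : Pt d) : polyFun (affinePoly g) x = g x := by
  have h1 : g x = g.linear x + g 0 := by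
    have := g.linearMap_vsub x 0
    simp only [vsub_eq_sub, sub_zero] at this
    rw [this]; ring
  have h2 : x = ∑ j, x j • EuclideanSpace.single j (1 : ℝ) := by
    ext i; simp [Finset.sum_apply, Pi.single_apply]
  rw [h1]
  conv_rhs => rw [h2, map_sum]
  simp [polyFun, affinePoly, mul_comm, add_comm]

lemma totalDegree_affinePoly_le (g : Pt d →ᵃ[ℝ] ℝ) : (affinePoly g).totalDegree ≤ 1 := by
  refine (MvPolynomial.totalDegree_add _ _).trans (max_le (by simp) ?_)
  refine MvPolynomial.totalDegree_finsetSum_le fun j _ => ?_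
  refine (MvPolynomial.totalDegree_mul _ _).trans ?_
  simp

/-- Composition with an affine map does not raise the degree. -/
lemma exists_polyFun_comp_affine (q : MvPolynomial (Fin d) ℝ) (F : Pt d →ᵃ[ℝ] Pt d) :
    ∃ q' : MvPolynomial (Fin d) ℝ, q'.totalDegree ≤ q.totalDegree ∧
      ∀ x, polyFun q' x = polyFun q (F x) := by
  let c : Fin d → (Pt d →ᵃ[ℝ] ℝ) := fun j =>
    ((EuclideanSpace.proj j : Pt d →L[ℝ] ℝ) : Pt d →ₗ[ℝ] ℝ).toAffineMap.comp F
  refine ⟨MvPolynomial.bind₁ (fun j => affinePoly (c j)) q, ?_, fun x => ?_⟩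
  · conv_lhs => rw [q.as_sum, map_sum]
    refine MvPolynomial.totalDegree_finsetSum_le fun s hs => ?_
    rw [MvPolynomial.bind₁_monomial]
    refine (MvPolynomial.totalDegree_mul _ _).trans ?_
    rw [MvPolynomial.totalDegree_C, zero_add]
    refine (MvPolynomial.totalDegree_finsetProd _ _).trans
      (le_trans ?_ (MvPolynomial.le_totalDegree hs))
    refine Finset.sum_le_sum fun j _ => ?_
    refine (MvPolynomial.totalDegree_pow _ _).trans ?_
    exact (Nat.mul_le_mul_left _ (totalDegree_affinePoly_le _)).trans (by simp)
  · unfold polyFun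
    rw [← MvPolynomial.coe_aeval_eq_eval, ← MvPolynomial.coe_aeval_eq_eval]
    simp only [RingHom.coe_coe]
    rw [MvPolynomial.aeval_bind₁]
    congr 2
    ext j
    exact polyFun_affinePoly (c j) x

end PolyFun

/-! ### Lagrange nodes and unisolvence -/

section Lattice

variable {d : ℕ} {T : Finset (Pt d)} {r : ℕ}

open Classical in
/-- The multi-indices of the Lagrange nodes of degree `r` on `T`. -/
def latIdx (T : Finset (Pt d)) (r : ℕ) : Finset (Pt d → ℕ) := T.piAntidiag r

lemma mem_latIdx {α : Pt d → ℕ} :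
    α ∈ latIdx T r ↔ ∑ p ∈ T, α p = r ∧ ∀ p, α p ≠ 0 → p ∈ T := Finset.mem_piAntidiag

/-- The Lagrange node with a given multi-index. -/
def latPoint (T : Finset (Pt d)) (r : ℕ) (α : Pt d → ℕ) : Pt d :=
  ∑ p ∈ T, ((α p : ℝ) / (r : ℝ)) • p

lemma latIdx_le {α : Pt d → ℕ} (hα : α ∈ latIdx T r) (p : Pt d) : α p ≤ r := by
  rw [mem_latIdx] at hα
  by_cases hp : p ∈ T
  · rw [← hα.1]; exact Finset.single_le_sum (fun _ _ => Nat.zero_le _) hp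
  · have : α p = 0 := by by_contra h; exact hp (hα.2 p h)
    omega

lemma card_latIdx_le (hT : T.card = d + 1) : (latIdx T r).card ≤ (r + 1) ^ (d + 1) := by
  classical
  have : (Finset.univ : Finset (T → Fin (r + 1))).card = (r + 1) ^ (d + 1) := by
    simp [hT]
  rw [← this]
  refine Finset.card_le_card_of_injOn (fun α p => Fin.ofNat (r + 1) (α p)) (by simp) ?_
  intro α hα β hβ h
  ext p
  by_cases hp : p ∈ T
  · have h1 := congrArg Fin.val (congrFun h ⟨p, hp⟩)
    simp only [Fin.ofNat] at h1
    rwa [Nat.mod_eq_of_lt (Nat.lt_succ_of_le (latIdx_le hα p)),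
      Nat.mod_eq_of_lt (Nat.lt_succ_of_le (latIdx_le hβ p))] at h1
  · have h1 : α p = 0 := by by_contra h; exact hp ((mem_latIdx.1 hα).2 p h)
    have h2 : β p = 0 := by by_contra h; exact hp ((mem_latIdx.1 hβ).2 p h)
    rw [h1, h2]

lemma bary_latPoint (h : IsCell T) (hr : r ≠ 0) {α : Pt d → ℕ} (hα : α ∈ latIdx T r) (p : Pt d) :
    bary T p (latPoint T r α) = (α p : ℝ) / r := by
  have hr' : (r : ℝ) ≠ 0 := by exact_mod_cast hr
  by_cases hp : p ∈ T
  · refine h.bary_combination (w := fun p => (α p : ℝ) / r) ?_ hp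
    rw [← Finset.sum_div, ← Nat.cast_sum, (mem_latIdx.1 hα).1, div_self hr']
  · have h1 : α p = 0 := by by_contra h; exact hp ((mem_latIdx.1 hα).2 p h)
    rw [IsCell.bary_of_notMem hp, h1]
    simp

lemma latPoint_mem_hull (h : IsCell T) (hr : r ≠ 0) {α : Pt d → ℕ} (hα : α ∈ latIdx T r) :
    latPoint T r α ∈ simplexHull T := by
  rw [h.mem_hull]
  intro p
  rw [bary_latPoint h hr hα]
  positivity

/-- The Lagrange basis function on barycentric coordinates `b`. -/
def lagrangeProd (T : Finset (Pt d)) (r : ℕ) (α : Pt d → ℕ) (b : Pt d → ℝ) : ℝ :=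
  ∏ p ∈ T, ∏ j ∈ Finset.range (α p), ((r : ℝ) * b p - j) * (1 / ((j : ℝ) + 1))

/-- The Lagrange basis polynomial of the node with multi-index `α`. -/
def lagrangePoly (S T : Finset (Pt d)) (r : ℕ) (α : Pt d → ℕ) : MvPolynomial (Fin d) ℝ :=
  ∏ p ∈ T, ∏ j ∈ Finset.range (α p), (MvPolynomial.C (r : ℝ) * affinePoly (bary S p) -
    MvPolynomial.C (j : ℝ)) * MvPolynomial.C (1 / ((j : ℝ) + 1))

lemma polyFun_lagrangePoly (S : Finset (Pt d)) (α : Pt d → ℕ) (x : Pt d) :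
    polyFun (lagrangePoly S T r α) x = lagrangeProd T r α fun p => bary S p x := by
  have (p : Pt d) : MvPolynomial.eval (fun j => x j) (affinePoly (bary S p)) = bary S p x :=
    polyFun_affinePoly _ _
  simp [polyFun, lagrangePoly, lagrangeProd, this, map_prod]

lemma totalDegree_lagrangePoly_le (S : Finset (Pt d)) {α : Pt d → ℕ} (hα : α ∈ latIdx T r) :
    (lagrangePoly S T r α).totalDegree ≤ r := by
  rw [← (mem_latIdx.1 hα).1]
  refine (MvPolynomial.totalDegree_finsetProd _ _).trans (Finset.sum_le_sum fun p _ => ?_)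
  refine (MvPolynomial.totalDegree_finsetProd _ _).trans ?_
  refine (Finset.sum_le_card_nsmul _ _ 1 fun j _ => ?_).trans (by simp)
  refine (MvPolynomial.totalDegree_mul _ _).trans ?_
  rw [MvPolynomial.totalDegree_C, add_zero]
  refine (MvPolynomial.totalDegree_sub _ _).trans (max_le ?_
    (by rw [MvPolynomial.totalDegree_C]; exact zero_le_one))
  refine (MvPolynomial.totalDegree_mul _ _).trans ?_
  rw [MvPolynomial.totalDegree_C, zero_add]
  exact totalDegree_affinePoly_le _

/-- Reversing the order of the factors turns the numerators `n - j` into `j + 1`, which cancel the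
denominators. -/
lemma lagrangeProd_self (hr : r ≠ 0) (α : Pt d → ℕ) :
    lagrangeProd T r α (fun p => (α p : ℝ) / r) = 1 := by
  have hr' : (r : ℝ) ≠ 0 := by exact_mod_cast hr
  refine Finset.prod_eq_one fun p _ => ?_
  have : ∀ n : ℕ, ∏ j ∈ Finset.range n, ((n : ℝ) - j) * (1 / ((j : ℝ) + 1)) = 1 := by
    intro n
    rw [Finset.prod_mul_distrib, ← Finset.prod_range_reflect, ← Finset.prod_mul_distrib]
    refine Finset.prod_eq_one fun j hj => ?_
    have hj' := Finset.mem_range.1 hj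
    have : (n : ℝ) - ((n - 1 - j : ℕ) : ℝ) = j + 1 := by
      rw [Nat.sub_sub, Nat.cast_sub (by omega)]; push_cast; ring
    rw [this]
    field_simp
  refine (Finset.prod_congr rfl fun j _ => ?_).trans (this (α p))
  rw [mul_div_cancel₀ _ hr']

/-- Distinct multi-indices of equal sum satisfy `β p < α p` at some vertex, and the factor with `j =
β p` vanishes there. -/
lemma lagrangeProd_of_ne (hr : r ≠ 0) {α β : Pt d → ℕ} (hα : α ∈ latIdx T r)
    (hβ : β ∈ latIdx T r) (hab : β ≠ α) :
    lagrangeProd T r α (fun p => (β p : ℝ) / r) = 0 := by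
  have hr' : (r : ℝ) ≠ 0 := by exact_mod_cast hr
  obtain ⟨p, hp, hlt⟩ : ∃ p ∈ T, β p < α p := by
    by_contra! hcon
    apply hab
    have h1 := (Finset.sum_eq_sum_iff_of_le hcon).1
      ((mem_latIdx.1 hα).1.trans (mem_latIdx.1 hβ).1.symm)
    ext p
    by_cases hp : p ∈ T
    · exact (h1 p hp).symm
    · have h1 : α p = 0 := by by_contra h; exact hp ((mem_latIdx.1 hα).2 p h)
      have h2 : β p = 0 := by by_contra h; exact hp ((mem_latIdx.1 hβ).2 p h)
      rw [h1, h2]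
  refine Finset.prod_eq_zero hp (Finset.prod_eq_zero (Finset.mem_range.2 hlt) ?_)
  rw [mul_div_cancel₀ _ hr', sub_self, zero_mul]

/-- There are `r` factors in all, each of modulus at most `r`. -/
lemma abs_lagrangeProd_le {α : Pt d → ℕ} (hα : α ∈ latIdx T r) {b : Pt d → ℝ}
    (hb : ∀ p, 0 ≤ b p ∧ b p ≤ 1) : |lagrangeProd T r α b| ≤ (r : ℝ) ^ r := by
  have h1 : ((r : ℝ)) ^ r = ∏ p ∈ T, (r : ℝ) ^ α p := by
    rw [Finset.prod_pow_eq_pow_sum, (mem_latIdx.1 hα).1]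
  rw [lagrangeProd, Finset.abs_prod, h1]
  refine Finset.prod_le_prod (fun _ _ => abs_nonneg _) fun p _ => ?_
  rw [Finset.abs_prod]
  refine (Finset.prod_le_prod (fun _ _ => abs_nonneg _) (g := fun _ => (r : ℝ)) fun j hj => ?_).trans
    (by simp)
  have hj' : (j : ℝ) ≤ r := by
    exact_mod_cast ((Finset.mem_range.1 hj).le.trans (latIdx_le hα p))
  have hr0 : (0 : ℝ) ≤ r := Nat.cast_nonneg r
  have hj0 : (0 : ℝ) ≤ j := Nat.cast_nonneg j
  rw [abs_mul, abs_of_nonneg (a := 1 / ((j : ℝ) + 1)) (by positivity)]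
  have h2 : |(r : ℝ) * b p - j| ≤ r := by
    rw [abs_le]
    have := mul_le_mul_of_nonneg_left (hb p).2 hr0
    have := mul_nonneg hr0 (hb p).1
    constructor <;> linarith
  calc _ ≤ (r : ℝ) * 1 := by
        refine mul_le_mul h2 ?_ (by positivity) hr0
        rw [div_le_one (by positivity)]; linarith
    _ = r := mul_one _

/-- Homogenisation: a monomial of degree at most `r` becomes a multi-index on `d + 1` vertices, the
missing degree going to the extra vertex. -/
lemma finrank_restrictTotalDegree_le (h : IsCell T) :
    Module.finrank ℝ (MvPolynomial.restrictTotalDegree (Fin d) ℝ r) ≤ (latIdx T r).card := by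
  classical
  have e : T ≃ Option (Fin d) := Fintype.equivOfCardEq (by simp [h.1])
  let f : {n : Fin d →₀ ℕ | (n.sum fun _ e => e) ≤ r} → latIdx T r := fun s =>
    ⟨fun p => if hp : p ∈ T then (e ⟨p, hp⟩).elim (r - s.1.sum fun _ e => e) s.1 else 0, by
      rw [mem_latIdx]
      refine ⟨?_, fun p hp => by by_contra hpT; simp [hpT] at hp⟩
      rw [← Finset.sum_coe_sort]
      have : ∀ p : T, (if hp : (p : Pt d) ∈ T then
          (e ⟨p, hp⟩).elim (r - s.1.sum fun _ e => e) s.1 else 0) =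
          (e p).elim (r - s.1.sum fun _ e => e) s.1 := fun p => by simp
      rw [Finset.sum_congr rfl fun p _ => this p,
        Equiv.sum_comp e fun o => o.elim (r - s.1.sum fun _ e => e) s.1, Fintype.sum_option]
      simp only [Option.elim_none, Option.elim_some]
      have h2 : (s.1.sum fun _ e => e) = ∑ j, s.1 j := Finsupp.sum_fintype _ _ (by simp)
      have h3 := s.2
      simp only [mem_ofPred_eq] at h3
      rw [← h2]
      omega⟩
  have hf : Function.Injective f := by
    intro s t hst
    ext j
    have h1 := congrFun (congrArg Subtype.val hst) (e.symm (some j))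
    simpa [f] using h1
  have : Finite {n : Fin d →₀ ℕ | (n.sum fun _ e => e) ≤ r} := Finite.of_injective f hf
  have := Fintype.ofFinite {n : Fin d →₀ ℕ | (n.sum fun _ e => e) ≤ r}
  have h4 : Module.finrank ℝ (MvPolynomial.restrictTotalDegree (Fin d) ℝ r) = _ :=
    Module.finrank_eq_card_basis (MvPolynomial.basisRestrictSupport ℝ _)
  rw [h4, ← Fintype.card_coe]
  exact Fintype.card_le_of_injective f hf

/-- Unisolvence of the Lagrange nodes. -/
lemma eq_zero_of_latPoint (h : IsCell T) (hr : r ≠ 0) {q : MvPolynomial (Fin d) ℝ}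
    (hq : q.totalDegree ≤ r) (h0 : ∀ α ∈ latIdx T r, polyFun q (latPoint T r α) = 0) : q = 0 := by
  classical
  let W := MvPolynomial.restrictTotalDegree (Fin d) ℝ r
  let ev : W →ₗ[ℝ] (latIdx T r → ℝ) :=
    { toFun := fun q α => polyFun q.1 (latPoint T r α)
      map_add' := fun p q => by ext α; simp [polyFun]
      map_smul' := fun c q => by ext α; simp [polyFun, MvPolynomial.smul_eval] }
  -- The Lagrange polynomials realise all nodal values; by the dimension count, a surjective
  -- evaluation map is injective.
  have hsurj : Function.Surjective ev := by
    intro c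
    refine ⟨∑ α : latIdx T r, c α • ⟨lagrangePoly T T r α,
      (MvPolynomial.mem_restrictTotalDegree _ _ _).2 (totalDegree_lagrangePoly_le T α.2)⟩, ?_⟩
    ext β
    rw [map_sum, Finset.sum_apply, Finset.sum_eq_single β]
    · rw [map_smul, Pi.smul_apply]
      change c β • polyFun (lagrangePoly T T r β) (latPoint T r β) = _
      rw [polyFun_lagrangePoly]
      simp only [bary_latPoint h hr β.2]
      rw [lagrangeProd_self hr, smul_eq_mul, mul_one]
    · intro α _ hαβ
      rw [map_smul, Pi.smul_apply]
      change c α • polyFun (lagrangePoly T T r α) (latPoint T r β) = _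
      rw [polyFun_lagrangePoly]
      simp only [bary_latPoint h hr β.2]
      rw [lagrangeProd_of_ne hr α.2 β.2 fun he => hαβ (Subtype.ext he.symm), smul_zero]
    · simp
  have hfin : Module.finrank ℝ W = Module.finrank ℝ (latIdx T r → ℝ) := by
    refine le_antisymm ?_ (LinearMap.finrank_le_finrank_of_surjective hsurj)
    rw [Module.finrank_fintype_fun_eq_card, Fintype.card_coe]
    exact finrank_restrictTotalDegree_le h
  have hinj := (LinearMap.injective_iff_surjective_of_finrank_eq_finrank hfin).2 hsurj
  have : (⟨q, (MvPolynomial.mem_restrictTotalDegree _ _ _).2 hq⟩ : W) = 0 := by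
    apply hinj
    rw [map_zero]
    ext α
    exact h0 α α.2
  exact congrArg Subtype.val this

lemma lagrange_expansion (h : IsCell T) (hr : r ≠ 0) {q : MvPolynomial (Fin d) ℝ}
    (hq : q.totalDegree ≤ r) :
    q = ∑ α ∈ latIdx T r, polyFun q (latPoint T r α) • lagrangePoly T T r α := by
  classical
  rw [← sub_eq_zero]
  refine eq_zero_of_latPoint h hr ((MvPolynomial.totalDegree_sub _ _).trans (max_le hq ?_)) ?_
  · exact MvPolynomial.totalDegree_finsetSum_le fun α hα =>
      (MvPolynomial.totalDegree_smul_le _ _).trans (totalDegree_lagrangePoly_le T hα)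
  · intro β hβ
    rw [sub_eq_add_neg, polyFun_add, ← neg_one_smul ℝ, polyFun_smul, polyFun_sum,
      Finset.sum_eq_single β]
    · rw [polyFun_smul, polyFun_lagrangePoly]
      simp only [bary_latPoint h hr hβ]
      rw [lagrangeProd_self hr]
      ring
    · intro α hα hαβ
      rw [polyFun_smul, polyFun_lagrangePoly]
      simp only [bary_latPoint h hr hβ]
      rw [lagrangeProd_of_ne hr hα hβ hαβ.symm, mul_zero]
    · exact fun h => absurd hβ h

/-- A polynomial is bounded on a cell by its nodal values. -/
lemma polyFun_sq_le_sum (h : IsCell T) (hr : r ≠ 0) {q : MvPolynomial (Fin d) ℝ}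
    (hq : q.totalDegree ≤ r) {x : Pt d} (hx : x ∈ simplexHull T) :
    polyFun q x ^ 2 ≤ ((r : ℝ) ^ r) ^ 2 * ((r : ℝ) + 1) ^ (d + 1) *
      ∑ α ∈ latIdx T r, polyFun q (latPoint T r α) ^ 2 := by
  have h1 : polyFun q x =
      ∑ α ∈ latIdx T r, polyFun q (latPoint T r α) * polyFun (lagrangePoly T T r α) x := by
    conv_lhs => rw [lagrange_expansion h hr hq, polyFun_sum]
    simp only [polyFun_smul]
  have h2 : ∀ α ∈ latIdx T r, |polyFun (lagrangePoly T T r α) x| ≤ (r : ℝ) ^ r := fun α hα => by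
    rw [polyFun_lagrangePoly]
    exact abs_lagrangeProd_le hα fun p => ⟨h.mem_hull.1 hx p, h.bary_le_one hx p⟩
  have h3 : ∑ α ∈ latIdx T r, polyFun (lagrangePoly T T r α) x ^ 2 ≤
      ((r : ℝ) ^ r) ^ 2 * ((r : ℝ) + 1) ^ (d + 1) := by
    refine (Finset.sum_le_card_nsmul _ _ (((r : ℝ) ^ r) ^ 2) fun α hα => ?_).trans ?_
    · rw [← sq_abs]
      exact pow_le_pow_left₀ (abs_nonneg _) (h2 α hα) 2
    · rw [nsmul_eq_mul, mul_comm]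
      refine mul_le_mul_of_nonneg_left ?_ (by positivity)
      exact_mod_cast card_latIdx_le h.1
  rw [h1]
  refine (Finset.sum_mul_sq_le_sq_mul_sq _ _ _).trans ?_
  rw [mul_comm]
  exact mul_le_mul_of_nonneg_right h3 (Finset.sum_nonneg fun _ _ => sq_nonneg _)

end Lattice

/-! ### Uniform polynomial estimates by affine pull-back -/

section PullBack

variable {d : ℕ}

/-- On a finite-dimensional space every linear functional is controlled by every positive definite
quadratic form. -/
lemma exists_sq_le_of_posDef {V : Type*} [AddCommGroup V] [Module ℝ V] [FiniteDimensional ℝ V]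
    (B : V →ₗ[ℝ] V →ₗ[ℝ] ℝ) (hsymm : ∀ x y, B x y = B y x) (hnonneg : ∀ x, 0 ≤ B x x)
    (hdef : ∀ x, B x x = 0 → x = 0) (f : V →ₗ[ℝ] ℝ) :
    ∃ C : ℝ, 0 ≤ C ∧ ∀ x, f x ^ 2 ≤ C * B x x := by
  -- With `B` as inner product, `f` is continuous by finite dimensionality, and its squared operator
  -- norm is the constant.
  let core : InnerProductSpace.Core ℝ V :=
    { inner := fun x y => B x y
      conj_inner_symm := fun x y => hsymm y x
      re_inner_nonneg := fun x => hnonneg x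
      add_left := fun x y z => by rw [map_add]; rfl
      smul_left := fun x y r => by rw [map_smul]; rfl
      definite := hdef }
  let _ : NormedAddCommGroup V := core.toNormedAddCommGroup
  let _ : InnerProductSpace ℝ V := InnerProductSpace.ofCore core.toCore
  let g : V →L[ℝ] ℝ := LinearMap.toContinuousLinearMap f
  refine ⟨‖g‖ ^ 2, by positivity, fun x => ?_⟩
  have h1 : ‖x‖ ^ 2 = B x x := by
    rw [← real_inner_self_eq_norm_sq]; rfl
  rw [← h1, ← mul_pow, ← sq_abs]
  exact pow_le_pow_left₀ (abs_nonneg _) (g.le_opNorm x) 2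

lemma integrableOn_hull {E : Type*} [NormedAddCommGroup E] (T : Finset (Pt d)) {f : Pt d → E}
    (hf : Continuous f) : IntegrableOn f (simplexHull T) :=
  hf.continuousOn.integrableOn_compact (isCompact_simplexHull T)

lemma polyFun_eq_zero_of_integral (T : Finset (Pt d)) (h : IsCell T) {q : MvPolynomial (Fin d) ℝ}
    (h0 : ∫ x in simplexHull T, polyFun q x ^ 2 = 0) {x : Pt d} (hx : x ∈ simplexHull T) :
    polyFun q x = 0 := by
  have hc : Continuous (fun x => polyFun q x ^ 2) := by fun_prop
  have h1 := (setIntegral_eq_zero_iff_of_nonneg_ae (ae_of_all _ fun x => sq_nonneg _)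
    (integrableOn_hull T hc)).1 h0
  have h2 : (fun x => polyFun q x ^ 2) =ᵐ[volume.restrict (interior (simplexHull T))] 0 :=
    ae_restrict_of_ae_restrict_of_subset interior_subset h1
  have h3 := Measure.eqOn_open_of_ae_eq h2 isOpen_interior hc.continuousOn continuousOn_const
  have h4 := h3.closure hc continuous_const
  rw [h.closure_interior] at h4
  simpa using h4 hx

/-- The `L²` form on polynomials. -/
def l2Poly (T : Finset (Pt d)) (r : ℕ) :
    MvPolynomial.restrictTotalDegree (Fin d) ℝ r →ₗ[ℝ]
      MvPolynomial.restrictTotalDegree (Fin d) ℝ r →ₗ[ℝ] ℝ :=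
  LinearMap.mk₂ ℝ (fun p q => ∫ x in simplexHull T, polyFun p.1 x * polyFun q.1 x)
    (fun p p' q => by
      rw [← integral_add (integrableOn_hull T (by fun_prop)) (integrableOn_hull T (by fun_prop))]
      congr 1; ext x
      simp only [Submodule.coe_add, polyFun_add]; ring)
    (fun c p q => by
      rw [smul_eq_mul, ← integral_const_mul]
      congr 1; ext x
      simp only [Submodule.coe_smul, polyFun_smul]; ring)
    (fun p q q' => by
      rw [← integral_add (integrableOn_hull T (by fun_prop)) (integrableOn_hull T (by fun_prop))]
      congr 1; ext x
      simp only [Submodule.coe_add, polyFun_add]; ring)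
    (fun c p q => by
      rw [smul_eq_mul, ← integral_const_mul]
      congr 1; ext x
      simp only [Submodule.coe_smul, polyFun_smul]; ring)

/-- Unisolvence makes the `L²` form definite on polynomials of degree at most `r`, so it controls
each of the finitely many nodal evaluations. The constant still depends on the cell. -/
lemma exists_node_sq_le {T : Finset (Pt d)} (h : IsCell T) {r : ℕ} (hr : r ≠ 0) :
    ∃ C : ℝ, 0 ≤ C ∧ ∀ q : MvPolynomial (Fin d) ℝ, q.totalDegree ≤ r → ∀ α ∈ latIdx T r,
      polyFun q (latPoint T r α) ^ 2 ≤ C * ∫ x in simplexHull T, polyFun q x ^ 2 := by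
  have key : ∀ α ∈ latIdx T r, ∃ C : ℝ, 0 ≤ C ∧ ∀ q : MvPolynomial (Fin d) ℝ,
      q.totalDegree ≤ r →
        polyFun q (latPoint T r α) ^ 2 ≤ C * ∫ x in simplexHull T, polyFun q x ^ 2 := by
    intro α _
    obtain ⟨C, hC, hC'⟩ := exists_sq_le_of_posDef (l2Poly T r)
      (fun p q => by simp only [l2Poly, LinearMap.mk₂_apply, mul_comm])
      (fun p => by
        simp only [l2Poly, LinearMap.mk₂_apply]
        exact integral_nonneg fun x => mul_self_nonneg _)
      (fun p hp => by
        simp only [l2Poly, LinearMap.mk₂_apply, ← sq] at hp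
        have := eq_zero_of_latPoint h hr ((MvPolynomial.mem_restrictTotalDegree _ _ _).1 p.2)
          fun β hβ => polyFun_eq_zero_of_integral T h hp (latPoint_mem_hull h hr hβ)
        exact Subtype.ext this)
      { toFun := fun q => polyFun q.1 (latPoint T r α)
        map_add' := fun p q => polyFun_add _ _ _
        map_smul' := fun c q => polyFun_smul _ _ _ }
    refine ⟨C, hC, fun q hq => ?_⟩
    have := hC' ⟨q, (MvPolynomial.mem_restrictTotalDegree _ _ _).2 hq⟩
    simpa only [l2Poly, LinearMap.mk₂_apply, LinearMap.coe_mk, AddHom.coe_mk, ← sq] using this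
  choose! C hC hC' using key
  refine ⟨∑ α ∈ latIdx T r, C α, Finset.sum_nonneg hC, fun q hq α hα => ?_⟩
  refine (hC' α hα q hq).trans ?_
  refine mul_le_mul_of_nonneg_right ?_ (integral_nonneg fun x => sq_nonneg _)
  exact Finset.single_le_sum (f := C) hC hα

/-- The affine map which sends the vertices `p` of `S` to `σ p`. -/
def vertexMap (S : Finset (Pt d)) (σ : Pt d → Pt d) : Pt d →ᵃ[ℝ] Pt d :=
  ∑ p ∈ S, (LinearMap.toSpanSingleton ℝ (Pt d) (σ p)).toAffineMap.comp (bary S p)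

lemma vertexMap_apply (S : Finset (Pt d)) (σ : Pt d → Pt d) (x : Pt d) :
    vertexMap S σ x = ∑ p ∈ S, bary S p x • σ p := by
  classical
  have : ∀ S' : Finset (Pt d), (∑ p ∈ S', (LinearMap.toSpanSingleton ℝ (Pt d) (σ p)).toAffineMap.comp
      (bary S p)) x = ∑ p ∈ S', bary S p x • σ p := by
    intro S'
    induction S' using Finset.induction_on with
    | empty => simp
    | insert a s ha ih =>
      rw [Finset.sum_insert ha, Finset.sum_insert ha, ← ih]
      simp
  exact this S

lemma hasFDerivAt_affineMap (F : Pt d →ᵃ[ℝ] Pt d) (x : Pt d) :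
    HasFDerivAt F (LinearMap.toContinuousLinearMap F.linear) x := by
  have h1 : (F : Pt d → Pt d) = fun y => LinearMap.toContinuousLinearMap F.linear y + F 0 := by
    ext1 y
    have := F.linearMap_vsub y 0
    simp only [vsub_eq_sub, sub_zero] at this
    simp [this]
  rw [h1]
  exact (LinearMap.toContinuousLinearMap F.linear).hasFDerivAt.add_const _

/-- Polynomials are bounded on a cell by their mean square. -/
lemma exists_polyFun_sq_le (d r : ℕ) (hr : r ≠ 0) : ∃ C : ℝ, 0 ≤ C ∧
    ∀ T : Finset (Pt d), IsCell T → ∀ q : MvPolynomial (Fin d) ℝ, q.totalDegree ≤ r →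
      (∑ α ∈ latIdx T r, polyFun q (latPoint T r α) ^ 2) * volume.real (simplexHull T) ≤
        C * ∫ x in simplexHull T, polyFun q x ^ 2 := by
  classical
  by_cases hex : ∃ S : Finset (Pt d), IsCell S
  swap
  · exact ⟨0, le_rfl, fun T hT => absurd ⟨T, hT⟩ hex⟩
  obtain ⟨S, hS⟩ := hex
  -- `S` serves as reference cell for all `T`. The affine map `F` below preserves barycentric
  -- coordinates, hence nodes, and does not raise degrees.
  obtain ⟨C, hC, hCS⟩ := exists_node_sq_le hS hr
  refine ⟨((r : ℝ) + 1) ^ (d + 1) * (C * volume.real (simplexHull S)), by positivity,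
    fun T hT q hq => ?_⟩
  obtain ⟨σ, hσ⟩ : ∃ σ : Pt d → Pt d, BijOn σ (S : Set (Pt d)) T :=
    S.finite_toSet.exists_bijOn_of_encard_eq (by simp [Set.encard_coe_eq_coe_finsetCard, hS.1, hT.1])
  have himg : T = S.image σ := by
    apply Finset.coe_injective
    rw [Finset.coe_image, hσ.image_eq]
  have hinj : Set.InjOn σ (S : Set (Pt d)) := hσ.injOn
  set F := vertexMap S σ with hF
  have hbary : ∀ x, ∀ p ∈ S, bary T (σ p) (F x) = bary S p x := by
    intro x p hp
    have hτ : ∀ p ∈ S, Function.invFunOn σ (S : Set (Pt d)) (σ p) = p := fun p hp =>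
      hinj.leftInvOn_invFunOn hp
    have hw : ∑ q ∈ T, bary S (Function.invFunOn σ (S : Set (Pt d)) q) x = 1 := by
      rw [himg, Finset.sum_image hinj, ← hS.sum_bary x]
      exact Finset.sum_congr rfl fun p hp => by rw [hτ p hp]
    have := hT.bary_combination hw (hσ.mapsTo hp)
    rw [hτ p hp] at this
    rw [← this, hF, vertexMap_apply]
    congr 1
    conv_rhs => rw [himg, Finset.sum_image hinj]
    exact Finset.sum_congr rfl fun p hp => by rw [hτ p hp]
  have hFinj : Function.Injective F := by
    intro x y hxy
    rw [← hS.sum_bary_smul x, ← hS.sum_bary_smul y]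
    refine Finset.sum_congr rfl fun p hp => ?_
    rw [← hbary x p hp, ← hbary y p hp, hxy]
  have hFimg : F '' simplexHull S = simplexHull T := by
    ext y
    constructor
    · rintro ⟨x, hx, rfl⟩
      rw [hT.mem_hull]
      intro p
      by_cases hp : p ∈ T
      · rw [himg, Finset.mem_image] at hp
        obtain ⟨p', hp', rfl⟩ := hp
        rw [hbary x p' hp']
        exact hS.mem_hull.1 hx p'
      · rw [IsCell.bary_of_notMem hp]; exact le_rfl
    · intro hy
      have hw : ∑ p ∈ S, bary T (σ p) y = 1 := by
        rw [← hT.sum_bary y]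
        conv_rhs => rw [himg, Finset.sum_image hinj]
        rw [himg]
      refine ⟨∑ p ∈ S, bary T (σ p) y • p, ?_, ?_⟩
      · rw [hS.mem_hull]
        intro p
        by_cases hp : p ∈ S
        · rw [hS.bary_combination (w := fun p => bary T (σ p) y) hw hp]
          exact hT.mem_hull.1 hy _
        · rw [IsCell.bary_of_notMem hp]; exact le_rfl
      · rw [hF, vertexMap_apply]
        conv_rhs => rw [← hT.sum_bary_smul y]
        conv_rhs => enter [1]; rw [himg]
        rw [Finset.sum_image hinj]
        exact Finset.sum_congr rfl fun p hp => by
          rw [hS.bary_combination (w := fun p => bary T (σ p) y) hw hp]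
  set D := |(LinearMap.toContinuousLinearMap F.linear).det| with hD
  -- The same Jacobian `D` scales the integral and the volume, so the final constant does not depend
  -- on `T`.
  have hcv : ∀ g : Pt d → ℝ, ∫ x in simplexHull T, g x = D * ∫ x in simplexHull S, g (F x) := by
    intro g
    rw [← hFimg, integral_image_eq_integral_abs_det_fderiv_smul volume
      (measurableSet_simplexHull S) (fun x _ => (hasFDerivAt_affineMap F x).hasFDerivWithinAt)
      hFinj.injOn, ← integral_const_mul]
    rfl
  obtain ⟨q', hq', hqF⟩ := exists_polyFun_comp_affine q F
  have hvol : volume.real (simplexHull T) = D * volume.real (simplexHull S) := by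
    have := hcv fun _ => 1
    simpa using this
  have hnode : ∀ α ∈ latIdx T r, polyFun q (latPoint T r α) ^ 2 ≤
      C * ∫ x in simplexHull S, polyFun q' x ^ 2 := by
    intro α hα
    set β : Pt d → ℕ := fun p => if p ∈ S then α (σ p) else 0 with hβ
    have hβ' : β ∈ latIdx S r := by
      rw [mem_latIdx]
      refine ⟨?_, fun p hp => by by_contra hpS; simp [hβ, hpS] at hp⟩
      rw [← (mem_latIdx.1 hα).1, himg, Finset.sum_image hinj]
      exact Finset.sum_congr rfl fun p hp => by simp [hβ, hp]
    have : F (latPoint S r β) = latPoint T r α := by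
      rw [hF, vertexMap_apply]
      conv_rhs => rw [himg, latPoint, Finset.sum_image hinj]
      refine Finset.sum_congr rfl fun p hp => ?_
      rw [bary_latPoint hS hr hβ']
      simp [hβ, hp]
    rw [← this, ← hqF]
    exact hCS q' (hq'.trans hq) β hβ'
  have hsum : ∑ α ∈ latIdx T r, polyFun q (latPoint T r α) ^ 2 ≤
      ((r : ℝ) + 1) ^ (d + 1) * (C * ∫ x in simplexHull S, polyFun q' x ^ 2) := by
    refine (Finset.sum_le_card_nsmul _ _ _ hnode).trans ?_
    rw [nsmul_eq_mul]
    refine mul_le_mul_of_nonneg_right ?_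
      (mul_nonneg hC (integral_nonneg fun x => sq_nonneg _))
    exact_mod_cast card_latIdx_le hT.1
  rw [hcv, hvol]
  calc _ ≤ ((r : ℝ) + 1) ^ (d + 1) * (C * ∫ x in simplexHull S, polyFun q' x ^ 2) *
        (D * volume.real (simplexHull S)) :=
        mul_le_mul_of_nonneg_right hsum (by positivity)
    _ = _ := by simp only [hqF]; ring

/-- Domination at the Lagrange nodes of a cell implies domination in `L²`. -/
lemma exists_nodal_domination (d r : ℕ) (hr : r ≠ 0) : ∃ C : ℝ, 1 ≤ C ∧
    ∀ T : Finset (Pt d), IsCell T → ∀ p q : MvPolynomial (Fin d) ℝ, p.totalDegree ≤ r →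
      q.totalDegree ≤ r → ∀ t : ℝ, 0 ≤ t →
      (∀ α ∈ latIdx T r, |polyFun p (latPoint T r α)| ≤ t * |polyFun q (latPoint T r α)|) →
      ∫ x in simplexHull T, polyFun p x ^ 2 ≤ C * t ^ 2 * ∫ x in simplexHull T, polyFun q x ^ 2 := by
  obtain ⟨C, hC, h⟩ := exists_polyFun_sq_le d r hr
  set K := ((r : ℝ) ^ r) ^ 2 * ((r : ℝ) + 1) ^ (d + 1) with hK
  have hK0 : 0 ≤ K := by positivity
  -- `K` bounds point values by nodal values, and `C` bounds nodal values by the mean square. The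
  -- maximum with 1 lets the constant be absorbed later.
  refine ⟨max 1 (K * C), le_max_left _ _, fun T hT p q hp hq t ht hdom => ?_⟩
  have hI : 0 ≤ ∫ x in simplexHull T, polyFun q x ^ 2 := integral_nonneg fun x => sq_nonneg _
  have h1 : ∀ x ∈ simplexHull T, polyFun p x ^ 2 ≤
      K * (t ^ 2 * ∑ α ∈ latIdx T r, polyFun q (latPoint T r α) ^ 2) := by
    intro x hx
    refine (polyFun_sq_le_sum hT hr hp hx).trans (mul_le_mul_of_nonneg_left ?_ hK0)
    rw [Finset.mul_sum]
    refine Finset.sum_le_sum fun α hα => ?_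
    rw [← sq_abs, ← sq_abs (polyFun q _), ← mul_pow]
    exact pow_le_pow_left₀ (abs_nonneg _) (hdom α hα) 2
  calc _ ≤ ∫ x in simplexHull T, K * (t ^ 2 * ∑ α ∈ latIdx T r, polyFun q (latPoint T r α) ^ 2) :=
        setIntegral_mono_on (integrableOn_hull T (by fun_prop))
          (integrableOn_hull T continuous_const) (measurableSet_simplexHull T) h1
    _ = K * t ^ 2 * ((∑ α ∈ latIdx T r, polyFun q (latPoint T r α) ^ 2) *
          volume.real (simplexHull T)) := by
        rw [setIntegral_const, smul_eq_mul]; ring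
    _ ≤ K * t ^ 2 * (C * ∫ x in simplexHull T, polyFun q x ^ 2) :=
        mul_le_mul_of_nonneg_left (h T hT q hq) (by positivity)
    _ = (K * C) * t ^ 2 * ∫ x in simplexHull T, polyFun q x ^ 2 := by ring
    _ ≤ _ := by
        refine mul_le_mul_of_nonneg_right (mul_le_mul_of_nonneg_right (le_max_right _ _) ?_) hI
        positivity

/-- The oscillation of a polynomial on a cell is bounded by the `L²` norm of its gradient. -/
lemma exists_oscillation_le (d r : ℕ) (hr : r ≠ 0) : ∃ C : ℝ, 0 ≤ C ∧
    ∀ T : Finset (Pt d), IsCell T → ∀ q : MvPolynomial (Fin d) ℝ, q.totalDegree ≤ r →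
      ∀ x ∈ simplexHull T, ∀ y ∈ simplexHull T,
      (polyFun q x - polyFun q y) ^ 2 * volume.real (simplexHull T) ≤
        C * cellDiam T ^ 2 * ∫ x in simplexHull T, ‖polyGrad q x‖ ^ 2 := by
  obtain ⟨C, hC, h⟩ := exists_polyFun_sq_le d r hr
  set K := ((r : ℝ) ^ r) ^ 2 * ((r : ℝ) + 1) ^ (d + 1) with hK
  have hK0 : 0 ≤ K := by positivity
  refine ⟨K * C, by positivity, fun T hT q hq x hx y hy => ?_⟩
  have hv := hT.volume_real_pos
  set I := ∫ x in simplexHull T, ‖polyGrad q x‖ ^ 2 with hI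
  have hI0 : 0 ≤ I := integral_nonneg fun x => by positivity
  -- Partial derivatives are polynomials of degree at most `r`, so the preceding estimates bound the
  -- gradient pointwise; the mean value inequality on the convex cell then gives the oscillation.
  have h1 : ∀ z ∈ simplexHull T, ‖polyGrad q z‖ ^ 2 * volume.real (simplexHull T) ≤ K * C * I := by
    intro z hz
    rw [hI, norm_polyGrad_sq, Finset.sum_mul]
    simp only [norm_polyGrad_sq]
    rw [integral_finsetSum _ fun j _ => integrableOn_hull T (by fun_prop), Finset.mul_sum]
    refine Finset.sum_le_sum fun j _ => ?_
    have hd := (totalDegree_pderiv_le q j).trans hq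
    calc _ ≤ K * (∑ α ∈ latIdx T r, polyFun (MvPolynomial.pderiv j q) (latPoint T r α) ^ 2) *
          volume.real (simplexHull T) :=
          mul_le_mul_of_nonneg_right (polyFun_sq_le_sum hT hr hd hz) hv.le
      _ = K * ((∑ α ∈ latIdx T r, polyFun (MvPolynomial.pderiv j q) (latPoint T r α) ^ 2) *
          volume.real (simplexHull T)) := by ring
      _ ≤ K * (C * ∫ x in simplexHull T, polyFun (MvPolynomial.pderiv j q) x ^ 2) :=
          mul_le_mul_of_nonneg_left (h T hT _ hd) hK0
      _ = _ := by ring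
  set B := K * C * I / volume.real (simplexHull T) with hB
  have hB0 : 0 ≤ B := by positivity
  have h2 : ∀ z ∈ simplexHull T, ‖(InnerProductSpace.toDual ℝ (Pt d)) (polyGrad q z)‖ ≤ √B := by
    intro z hz
    rw [LinearIsometryEquiv.norm_map]
    apply Real.le_sqrt_of_sq_le
    rw [hB, le_div_iff₀ hv]
    exact h1 z hz
  have h3 := (convex_simplexHull T).norm_image_sub_le_of_norm_hasFDerivWithin_le
    (fun z _ => (hasGradientAt_polyFun q z).hasFDerivAt.hasFDerivWithinAt) h2 hy hx
  have h4 : (polyFun q x - polyFun q y) ^ 2 ≤ B * cellDiam T ^ 2 := by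
    rw [← sq_abs, ← Real.norm_eq_abs]
    calc _ ≤ (√B * cellDiam T) ^ 2 := by
          refine pow_le_pow_left₀ (norm_nonneg _) (h3.trans ?_) 2
          rw [← dist_eq_norm]
          exact mul_le_mul_of_nonneg_left (dist_le_cellDiam T hx hy) (Real.sqrt_nonneg _)
      _ = _ := by rw [mul_pow, Real.sq_sqrt hB0]
  calc _ ≤ B * cellDiam T ^ 2 * volume.real (simplexHull T) :=
        mul_le_mul_of_nonneg_right h4 hv.le
    _ = _ := by rw [hB]; field_simp

end PullBack

/-! ### Conformity of the mesh and the structure of the domain -/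

open Topology Filter

namespace SimplicialMesh

variable {d : ℕ} (Mh : SimplicialMesh d) {S T : Finset (Pt d)} {x : Pt d}

lemma isCell (hT : T ∈ Mh.cells) : IsCell T := ⟨Mh.card_eq T hT, Mh.indep T hT⟩

/-- Barycentric coordinates agree on common points of cells. -/
lemma bary_eq_bary (hS : S ∈ Mh.cells) (hT : T ∈ Mh.cells) (hxS : x ∈ simplexHull S)
    (hxT : x ∈ simplexHull T) (p : Pt d) : bary S p x = bary T p x := by
  classical
  have h1 := Mh.conforming S hS T hT ⟨hxS, hxT⟩
  rw [← Finset.coe_inter, Finset.mem_convexHull'] at h1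
  obtain ⟨w, hw0, hw1, hwx⟩ := h1
  -- By conformity `x` is a convex combination of common vertices; its weights are the coordinates
  -- of `x` in every cell having these vertices.
  have key : ∀ R : Finset (Pt d), IsCell R → S ∩ T ⊆ R →
      bary R p x = if p ∈ S ∩ T then w p else 0 := by
    intro R hR hsub
    have hs : ∑ q ∈ R, (if q ∈ S ∩ T then w q else 0) = 1 := by
      rw [← hw1, ← Finset.sum_filter, Finset.filter_mem_eq_inter, Finset.inter_eq_right.2 hsub]
    have hx : ∑ q ∈ R, (if q ∈ S ∩ T then w q else 0) • q = x := by
      rw [← hwx]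
      simp only [ite_smul, zero_smul]
      rw [← Finset.sum_filter, Finset.filter_mem_eq_inter, Finset.inter_eq_right.2 hsub]
    by_cases hp : p ∈ R
    · rw [← hR.bary_combination hs hp, hx]
    · rw [IsCell.bary_of_notMem hp, if_neg fun h => hp (hsub h)]; rfl
  rw [key S (Mh.isCell hS) Finset.inter_subset_left,
    key T (Mh.isCell hT) Finset.inter_subset_right]

/-- A vertex of `S` outside `T` would have a positive coordinate at `x` in `S` but a zero one in
`T`. -/
lemma eq_of_mem_interior (hS : S ∈ Mh.cells) (hT : T ∈ Mh.cells)
    (hxS : x ∈ interior (simplexHull S)) (hxT : x ∈ simplexHull T) : S = T := by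
  refine Finset.eq_of_subset_of_card_le (fun p hp => ?_)
    ((Mh.card_eq T hT).trans (Mh.card_eq S hS).symm).le
  by_contra hpT
  have h1 := Mh.bary_eq_bary hS hT (interior_subset hxS) hxT p
  rw [IsCell.bary_of_notMem hpT] at h1
  rw [(Mh.isCell hS).interior_eq] at hxS
  exact (hxS p hp).ne' h1

/-- If the carrier of `x` contains the carrier of a point `l` of the open polyhedral domain, then `x`
lies in the domain as well. -/
lemma mem_openUnion_of_carrier {l : Pt d} (hl : l ∈ openUnion Mh.cells) (hS : S ∈ Mh.cells)
    (hlS : l ∈ simplexHull S) (hxS : x ∈ simplexHull S)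
    (h : ∀ p, 0 < bary S p l → 0 < bary S p x) : x ∈ openUnion Mh.cells := by
  have hcS := Mh.isCell hS
  -- Moving slightly from `l` towards `x` stays in the open domain and reaches a point `l'` with
  -- exactly the positive coordinates of `x`. A neighbourhood of `l'` can then be translated to `x`.
  obtain ⟨t, ht0, ht1, ht⟩ : ∃ t : ℝ, 0 < t ∧ t < 1 ∧
      AffineMap.lineMap l x t ∈ openUnion Mh.cells := by
    have h1 : Tendsto (fun t : ℝ => AffineMap.lineMap l x t) (𝓝[>] 0) (𝓝 l) := by
      have : Continuous (fun t : ℝ => AffineMap.lineMap l x t) := AffineMap.lineMap_continuous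
      have h2 := this.tendsto 0
      rw [AffineMap.lineMap_apply_zero] at h2
      exact h2.mono_left nhdsWithin_le_nhds
    have h2 : ∀ᶠ t : ℝ in 𝓝[>] 0, AffineMap.lineMap l x t ∈ openUnion Mh.cells :=
      h1.eventually_mem (isOpen_interior.mem_nhds hl)
    obtain ⟨t, ht, ht'⟩ := (h2.and (Ioo_mem_nhdsGT zero_lt_one)).exists
    exact ⟨t, ht'.1, ht'.2, ht⟩
  set l' := AffineMap.lineMap l x t with hl'
  have hl'S : l' ∈ simplexHull S :=
    (convex_simplexHull S).lineMap_mem hlS hxS ⟨ht0.le, ht1.le⟩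
  have hb : ∀ p, bary S p l' = (1 - t) * bary S p l + t * bary S p x := by
    intro p
    rw [hl', AffineMap.apply_lineMap, AffineMap.lineMap_apply_module]
    simp
  have hpos : ∀ p, 0 < bary S p l' ↔ 0 < bary S p x := by
    intro p
    have h0 := hcS.mem_hull.1 hlS p
    have h1 := hcS.mem_hull.1 hxS p
    have h3 : 0 < 1 - t := by linarith
    rw [hb]
    constructor
    · intro h2
      by_contra hcon
      have hx0 : bary S p x = 0 := le_antisymm (not_lt.1 hcon) h1
      have hl0 : bary S p l = 0 := by
        by_contra hne
        exact hcon (h p (lt_of_le_of_ne h0 (Ne.symm hne)))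
      rw [hx0, hl0] at h2
      simp at h2
    · intro h2
      have := mul_nonneg h3.le h0
      have := mul_pos ht0 h2
      linarith
  -- A cell containing `l'` contains all vertices of the common carrier, so it computes the same
  -- coordinates of `x` as `S` does.
  have hcomm : ∀ R ∈ Mh.cells, l' ∈ simplexHull R → ∀ p, bary R p x = bary S p x := by
    intro R hR hl'R p
    have hsupp : ∀ q ∈ S, bary S q x ≠ 0 → q ∈ R := by
      intro q _ hq
      by_contra hqR
      have h1 := (hpos q).2 (lt_of_le_of_ne (hcS.mem_hull.1 hxS q) (Ne.symm hq))
      rw [← Mh.bary_eq_bary hR hS hl'R hl'S, IsCell.bary_of_notMem hqR] at h1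
      exact lt_irrefl _ h1
    have hsum : ∀ {E : Type} [AddCommMonoid E] (f : Pt d → E),
        (∀ q, bary S q x = 0 → f q = 0) → ∑ q ∈ R, f q = ∑ q ∈ S, f q := by
      intro E _ f hf
      classical
      rw [← Finset.sum_subset (Finset.inter_subset_left : R ∩ S ⊆ R),
        ← Finset.sum_subset (Finset.inter_subset_right : R ∩ S ⊆ S)]
      · intro q hq hq'
        refine hf q ?_
        by_contra hne
        exact hq' (Finset.mem_inter.2 ⟨hsupp q hq hne, hq⟩)
      · intro q hq hq'
        refine hf q ?_
        rw [IsCell.bary_of_notMem fun h => hq' (Finset.mem_inter.2 ⟨hq, h⟩)]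
        rfl
    have h1 : ∑ q ∈ R, bary S q x = 1 := by
      rw [hsum _ fun q hq => hq, hcS.sum_bary]
    have h2 : ∑ q ∈ R, bary S q x • q = x := by
      rw [hsum _ fun q hq => by rw [hq, zero_smul], hcS.sum_bary_smul]
    by_cases hp : p ∈ R
    · conv_lhs => rw [← h2]
      exact (Mh.isCell hR).bary_combination (w := fun q => bary S q x) h1 hp
    · rw [IsCell.bary_of_notMem hp]
      by_contra hne
      have hpS : p ∈ S := by
        by_contra hpS
        rw [IsCell.bary_of_notMem hpS] at hne
        exact hne rfl
      exact hp (hsupp p hpS fun h => hne (by rw [h]; rfl))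
  have hev1 : ∀ᶠ y in 𝓝 x, ∀ R ∈ Mh.cells, ∀ p ∈ R, 0 < bary R p x → 0 < bary R p y := by
    rw [Filter.eventually_all_finset]
    intro R _
    rw [Filter.eventually_all_finset]
    intro p _
    by_cases hp : 0 < bary R p x
    · have hc : Continuous (bary R p) := AffineMap.continuous_of_finiteDimensional _
      filter_upwards [hc.continuousAt.eventually (lt_mem_nhds hp)] with y hy _ using hy
    · exact Eventually.of_forall fun y h => absurd h hp
  have hev2 : ∀ᶠ z in 𝓝 l', z ∈ ⋃ R ∈ Mh.cells, simplexHull R := by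
    filter_upwards [isOpen_interior.mem_nhds ht] with z hz using interior_subset hz
  have hev3 : ∀ᶠ z in 𝓝 l', ∀ R ∈ Mh.cells, l' ∉ simplexHull R → z ∉ simplexHull R := by
    rw [Filter.eventually_all_finset]
    intro R _
    by_cases hR : l' ∈ simplexHull R
    · exact Eventually.of_forall fun y h => absurd hR h
    · filter_upwards [(isClosed_simplexHull R).isOpen_compl.mem_nhds hR] with y hy _ using hy
  -- For `y` near `x`, the translate lies in a cell `R` containing `l'`. It remains to see that `y`
  -- itself lies in `R`: coordinates positive at `x` remain positive near `x`.
  have hshift : Tendsto (fun y => y - (x - l')) (𝓝 x) (𝓝 l') := by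
    have : Continuous fun y : Pt d => y - (x - l') := by fun_prop
    simpa using this.tendsto x
  rw [openUnion, mem_interior_iff_mem_nhds]
  filter_upwards [hev1, hshift.eventually (hev2.and hev3)] with y hy1 hy2
  obtain ⟨R, hR, hyR⟩ := mem_iUnion₂.1 hy2.1
  have hl'R : l' ∈ simplexHull R := by
    by_contra hcon
    exact hy2.2 R hR hcon hyR
  refine mem_iUnion₂.2 ⟨R, hR, ?_⟩
  rw [(Mh.isCell hR).mem_hull]
  intro p
  by_cases hpR : p ∈ R
  · by_cases hp : 0 < bary R p x
    · exact (hy1 R hR p hpR hp).le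
    · have hx0 : bary R p x = 0 := by
        refine le_antisymm (not_lt.1 hp) ?_
        rw [hcomm R hR hl'R]
        exact hcS.mem_hull.1 hxS p
      have hl0 : bary R p l' = 0 := by
        refine le_antisymm (not_lt.1 fun h0 => ?_) ((Mh.isCell hR).mem_hull.1 hl'R p)
        rw [Mh.bary_eq_bary hR hS hl'R hl'S, hpos, ← hcomm R hR hl'R] at h0
        exact hp h0
      -- A coordinate vanishing at `x` vanishes at `l'` as well, so translation by `x - l'` leaves
      -- it unchanged and its sign at `y` is that at the translate.
      have e1 := (bary R p).linearMap_vsub y (y - (x - l'))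
      have e2 := (bary R p).linearMap_vsub x l'
      simp only [vsub_eq_sub, sub_sub_cancel] at e1 e2
      rw [e1, hx0, hl0, sub_zero, sub_eq_zero] at e2
      rw [e2]
      exact (Mh.isCell hR).mem_hull.1 hyR p
  · rw [IsCell.bary_of_notMem hpR]; exact le_rfl

end SimplicialMesh

section OpenUnion

variable {d : ℕ} {C : Finset (Finset (Pt d))} {T : Finset (Pt d)}

lemma isClosed_iUnion_hull (C : Finset (Finset (Pt d))) : IsClosed (⋃ T ∈ C, simplexHull T) :=
  C.finite_toSet.isClosed_biUnion fun T _ => isClosed_simplexHull T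

lemma isOpen_openUnion (C : Finset (Finset (Pt d))) : IsOpen (openUnion C) := isOpen_interior

lemma interior_hull_subset_openUnion (hT : T ∈ C) : interior (simplexHull T) ⊆ openUnion C :=
  interior_mono (subset_biUnion_of_mem (u := fun T : Finset (Pt d) => simplexHull T) hT)

lemma openUnion_mono {C' : Finset (Finset (Pt d))} (h : C ⊆ C') : openUnion C ⊆ openUnion C' :=
  interior_mono (biUnion_subset_biUnion_left h)

lemma exists_cell_of_mem_openUnion {x : Pt d} (hx : x ∈ openUnion C) :
    ∃ T ∈ C, x ∈ simplexHull T := by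
  simpa using mem_iUnion₂.1 (interior_subset hx)

lemma closure_openUnion (hC : ∀ T ∈ C, IsCell T) :
    closure (openUnion C) = ⋃ T ∈ C, simplexHull T := by
  refine (closure_minimal interior_subset (isClosed_iUnion_hull C)).antisymm ?_
  refine iUnion₂_subset fun T hT => ?_
  rw [← (hC T hT).closure_interior]
  exact closure_mono (interior_hull_subset_openUnion hT)

end OpenUnion

/-! ### Lagrange nodal basis of the finite element space -/

namespace HkGenEO

variable {d : ℕ} (P : HkGenEO d) {T : Finset (Pt d)} {l x : Pt d}

lemma mem_cellNodes {x : Pt d} : x ∈ P.cellNodes T ↔ ∃ α ∈ latIdx T P.r, latPoint T P.r α = x := by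
  rw [cellNodes, Finset.mem_image]
  rfl

lemma mem_nodes : l ∈ P.nodes ↔ (∃ T ∈ P.mesh.cells, ∃ α ∈ latIdx T P.r, latPoint T P.r α = l) ∧
    l ∈ P.Om := by
  simp only [nodes, Finset.mem_filter, Finset.mem_biUnion, mem_cellNodes]

lemma exists_polyFun {v : Pt d → ℝ} (hv : v ∈ P.Vh) (hT : T ∈ P.mesh.cells) :
    ∃ q : MvPolynomial (Fin d) ℝ, q.totalDegree ≤ P.r ∧
      ∀ x ∈ simplexHull T, v x = polyFun q x := hv.2.2 T hT

lemma continuous_of_mem {v : Pt d → ℝ} (hv : v ∈ P.Vh) : Continuous v := hv.1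

lemma eq_zero_of_notMem {v : Pt d → ℝ} (hv : v ∈ P.Vh) (hx : x ∉ P.Om) : v x = 0 := hv.2.1 x hx

/-- Lagrange points outside `Ω` are not among `P.nodes`, but elements of `V^h` vanish there anyway,
so unisolvence applies. -/
lemma eq_zero_on_cell {v : Pt d → ℝ} (hr : P.r ≠ 0) (hv : v ∈ P.Vh) (hT : T ∈ P.mesh.cells)
    (h0 : ∀ m ∈ P.nodes, m ∈ simplexHull T → v m = 0) (hx : x ∈ simplexHull T) : v x = 0 := by
  obtain ⟨q, hq, hvq⟩ := P.exists_polyFun hv hT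
  have hc := P.mesh.isCell hT
  have : q = 0 := by
    refine eq_zero_of_latPoint hc hr hq fun α hα => ?_
    have hm := latPoint_mem_hull hc hr hα
    rw [← hvq _ hm]
    by_cases hO : latPoint T P.r α ∈ P.Om
    · exact h0 _ (P.mem_nodes.2 ⟨⟨T, hT, α, hα, rfl⟩, hO⟩) hm
    · exact P.eq_zero_of_notMem hv hO
  rw [hvq x hx, this]
  simp [polyFun]

lemma eq_zero_of_nodes {v : Pt d → ℝ} (hr : P.r ≠ 0) (hv : v ∈ P.Vh)
    (h0 : ∀ m ∈ P.nodes, v m = 0) : v = 0 := by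
  ext x
  by_cases hx : x ∈ P.Om
  · obtain ⟨T, hT, hxT⟩ := exists_cell_of_mem_openUnion hx
    exact P.eq_zero_on_cell hr hv hT (fun m hm _ => h0 m hm) hxT
  · exact P.eq_zero_of_notMem hv hx

open Classical in
/-- The barycentric hat functions of the mesh. -/
def hat (p x : Pt d) : ℝ :=
  if h : ∃ T ∈ P.mesh.cells, x ∈ simplexHull T then bary h.choose p x else 0

/-- Conformity makes the cell chosen in `hat` irrelevant. -/
lemma hat_eq (hT : T ∈ P.mesh.cells) (hx : x ∈ simplexHull T) (p : Pt d) :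
    P.hat p x = bary T p x := by
  have h : ∃ T ∈ P.mesh.cells, x ∈ simplexHull T := ⟨T, hT, hx⟩
  rw [hat, dif_pos h]
  exact P.mesh.bary_eq_bary h.choose_spec.1 hT h.choose_spec.2 hx p

open Classical in
/-- Existence of the Lagrange nodal basis functions. -/
lemma exists_nodalBasis (hr : P.r ≠ 0) (hl : l ∈ P.nodes) :
    ∃ φ ∈ P.Vh, ∀ m ∈ P.nodes, φ m = if m = l then 1 else 0 := by
  obtain ⟨⟨T, hT, α, hα, hαl⟩, hlO⟩ := P.mem_nodes.1 hl
  set Φ : Pt d → ℝ := fun x => lagrangeProd T P.r α fun p => P.hat p x with hΦ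
  have hΦS : ∀ S ∈ P.mesh.cells, ∀ x ∈ simplexHull S,
      Φ x = polyFun (lagrangePoly S T P.r α) x := by
    intro S hS x hx
    rw [polyFun_lagrangePoly, hΦ]
    simp only [P.hat_eq hS hx]
  -- The factor with `j = 0` is a multiple of the barycentric coordinate of `p`.
  have hcar : ∀ S ∈ P.mesh.cells, ∀ x ∈ simplexHull S, Φ x ≠ 0 → ∀ p, α p ≠ 0 →
      bary S p x ≠ 0 := by
    intro S hS x hx hne p hp h0
    apply hne
    refine Finset.prod_eq_zero ((mem_latIdx.1 hα).2 p hp)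
      (Finset.prod_eq_zero (Finset.mem_range.2 (Nat.pos_of_ne_zero hp)) ?_)
    simp [P.hat_eq hS hx, h0]
  have hsup : ∀ S ∈ P.mesh.cells, ∀ x ∈ simplexHull S, Φ x ≠ 0 → ∀ p, α p ≠ 0 → p ∈ S := by
    intro S hS x hx hne p hp
    by_contra hpS
    have := hcar S hS x hx hne p hp
    rw [IsCell.bary_of_notMem hpS] at this
    exact this rfl
  -- Node and product depend only on the vertices where `α` is nonzero, so `T` may be replaced by
  -- any cell containing these.
  have hidx : ∀ S ∈ P.mesh.cells, (∀ p, α p ≠ 0 → p ∈ S) →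
      α ∈ latIdx S P.r ∧ latPoint S P.r α = l ∧
        ∀ b, lagrangeProd T P.r α b = lagrangeProd S P.r α b := by
    intro S hS hs
    have e1 : ∀ (f : Pt d → ℕ), (∀ p, α p = 0 → f p = 0) → ∑ p ∈ S, f p = ∑ p ∈ T, f p := by
      intro f hf
      rw [← Finset.sum_subset (Finset.inter_subset_left : S ∩ T ⊆ S),
        ← Finset.sum_subset (Finset.inter_subset_right : S ∩ T ⊆ T)]
      · exact fun q hq hq' => hf q (by_contra fun hne => hq' (Finset.mem_inter.2 ⟨hs q hne, hq⟩))
      · exact fun q hq hq' => hf q (by_contra fun hne =>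
          hq' (Finset.mem_inter.2 ⟨hq, (mem_latIdx.1 hα).2 q hne⟩))
    have e2 : ∀ (f : Pt d → Pt d), (∀ p, α p = 0 → f p = 0) → ∑ p ∈ S, f p = ∑ p ∈ T, f p := by
      intro f hf
      rw [← Finset.sum_subset (Finset.inter_subset_left : S ∩ T ⊆ S),
        ← Finset.sum_subset (Finset.inter_subset_right : S ∩ T ⊆ T)]
      · exact fun q hq hq' => hf q (by_contra fun hne => hq' (Finset.mem_inter.2 ⟨hs q hne, hq⟩))
      · exact fun q hq hq' => hf q (by_contra fun hne =>
          hq' (Finset.mem_inter.2 ⟨hq, (mem_latIdx.1 hα).2 q hne⟩))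
    have e3 : ∀ (f : Pt d → ℝ), (∀ p, α p = 0 → f p = 1) → ∏ p ∈ S, f p = ∏ p ∈ T, f p := by
      intro f hf
      rw [← Finset.prod_subset (Finset.inter_subset_left : S ∩ T ⊆ S),
        ← Finset.prod_subset (Finset.inter_subset_right : S ∩ T ⊆ T)]
      · exact fun q hq hq' => hf q (by_contra fun hne => hq' (Finset.mem_inter.2 ⟨hs q hne, hq⟩))
      · exact fun q hq hq' => hf q (by_contra fun hne =>
          hq' (Finset.mem_inter.2 ⟨hq, (mem_latIdx.1 hα).2 q hne⟩))
    refine ⟨mem_latIdx.2 ⟨?_, hs⟩, ?_, fun b => ?_⟩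
    · rw [e1 α fun _ h => h, (mem_latIdx.1 hα).1]
    · rw [← hαl, latPoint, latPoint]
      exact e2 _ fun p hp => by simp [hp]
    · exact (e3 _ fun p hp => by simp [hp]).symm
  -- Where `Φ` is nonzero the carrier contains that of the node `l`, which lies in `Ω`. Hence
  -- cutting off outside `Ω` changes nothing on the cells.
  have hOm : ∀ S ∈ P.mesh.cells, ∀ x ∈ simplexHull S, Φ x ≠ 0 → x ∈ P.Om := by
    intro S hS x hx hne
    have hc := P.mesh.isCell hS
    obtain ⟨hαS, hlS, -⟩ := hidx S hS (hsup S hS x hx hne)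
    refine P.mesh.mem_openUnion_of_carrier hlO hS (hlS ▸ latPoint_mem_hull hc hr hαS) hx ?_
    intro p hp
    refine lt_of_le_of_ne (hc.mem_hull.1 hx p) (Ne.symm (hcar S hS x hx hne p fun h0 => ?_))
    rw [← hlS, bary_latPoint hc hr hαS, h0] at hp
    simp at hp
  set φ : Pt d → ℝ := P.Om.indicator Φ with hφ
  have hφS : ∀ S ∈ P.mesh.cells, ∀ x ∈ simplexHull S,
      φ x = polyFun (lagrangePoly S T P.r α) x := by
    intro S hS x hx
    rw [← hΦS S hS x hx, hφ]
    by_cases hxO : x ∈ P.Om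
    · rw [indicator_of_mem hxO]
    · rw [indicator_of_notMem hxO]
      by_contra hne
      exact hxO (hOm S hS x hx (Ne.symm hne))
  refine ⟨φ, ⟨?_, fun x hx => indicator_of_notMem hx _, fun S hS =>
    ⟨lagrangePoly S T P.r α, totalDegree_lagrangePoly_le S hα, hφS S hS⟩⟩, fun m hm => ?_⟩
  -- Continuity is glued from the finite closed cover formed by the cells and the complement of `Ω`.
  · let cov : Option P.mesh.cells → Set (Pt d) := fun o => o.elim (P.Om)ᶜ fun S => simplexHull S.1
    refine (locallyFinite_of_finite cov).continuous ?_ ?_ ?_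
    · refine eq_univ_of_forall fun x => mem_iUnion.2 ?_
      by_cases hx : x ∈ P.Om
      · obtain ⟨S, hS, hxS⟩ := exists_cell_of_mem_openUnion hx
        exact ⟨some ⟨S, hS⟩, hxS⟩
      · exact ⟨none, hx⟩
    · rintro (_ | S)
      · exact (isOpen_openUnion _).isClosed_compl
      · exact isClosed_simplexHull _
    · rintro (_ | S)
      · exact continuousOn_const.congr fun x hx => indicator_of_notMem hx _
      · exact (continuous_polyFun _).continuousOn.congr (hφS S.1 S.2)
  · obtain ⟨⟨S, hS, β, hβ, hβm⟩, hmO⟩ := P.mem_nodes.1 hm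
    split_ifs with hml
    · have hc := P.mesh.isCell hT
      rw [hml, ← hαl, hφS T hT _ (latPoint_mem_hull hc hr hα), polyFun_lagrangePoly]
      simp only [bary_latPoint hc hr hα]
      exact lagrangeProd_self hr α
    · have hc := P.mesh.isCell hS
      have hmS : m ∈ simplexHull S := hβm ▸ latPoint_mem_hull hc hr hβ
      by_contra hne
      have hΦm : Φ m ≠ 0 := by rwa [hΦS S hS m hmS, ← hφS S hS m hmS]
      obtain ⟨hαS, hlS, hprod⟩ := hidx S hS (hsup S hS m hmS hΦm)
      apply hne
      rw [hφS S hS m hmS, polyFun_lagrangePoly, hprod, ← hβm]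
      simp only [bary_latPoint hc hr hβ]
      refine lagrangeProd_of_ne hr hαS hβ ?_
      rintro rfl
      exact hml (hβm.symm.trans hlS)

lemma nodalBasis_mem (hr : P.r ≠ 0) (hl : l ∈ P.nodes) : P.nodalBasis l ∈ P.Vh := by
  have h := P.exists_nodalBasis hr hl
  rw [nodalBasis, dif_pos h]
  exact h.choose_spec.1

lemma nodalBasis_self (hr : P.r ≠ 0) (hl : l ∈ P.nodes) : P.nodalBasis l l = 1 := by
  have h := P.exists_nodalBasis hr hl
  rw [nodalBasis, dif_pos h, h.choose_spec.2 l hl, if_pos rfl]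

lemma nodalBasis_of_ne (hr : P.r ≠ 0) (hl : l ∈ P.nodes) {m : Pt d} (hm : m ∈ P.nodes)
    (hml : m ≠ l) : P.nodalBasis l m = 0 := by
  have h := P.exists_nodalBasis hr hl
  rw [nodalBasis, dif_pos h, h.choose_spec.2 m hm, if_neg hml]

/-- The nodal interpolant with nodal values `c` on a set `s` of nodes. -/
lemma sum_nodalBasis_apply (hr : P.r ≠ 0) {s : Finset (Pt d)} (hs : s ⊆ P.nodes) (c : Pt d → ℝ)
    {m : Pt d} (hm : m ∈ P.nodes) [Decidable (m ∈ s)] :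
    (∑ l ∈ s, c l • P.nodalBasis l) m = if m ∈ s then c m else 0 := by
  rw [Finset.sum_apply]
  split_ifs with hms
  · rw [Finset.sum_eq_single m]
    · simp [P.nodalBasis_self hr hm]
    · exact fun l hl hlm => by simp [P.nodalBasis_of_ne hr (hs hl) hm hlm.symm]
    · exact fun h => absurd hms h
  · refine Finset.sum_eq_zero fun l hl => ?_
    have : m ≠ l := by rintro rfl; exact hms hl
    simp [P.nodalBasis_of_ne hr (hs hl) hm this]

lemma sum_nodalBasis_mem (hr : P.r ≠ 0) {s : Finset (Pt d)} (hs : s ⊆ P.nodes) (c : Pt d → ℝ) :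
    ∑ l ∈ s, c l • P.nodalBasis l ∈ P.Vh :=
  Submodule.sum_mem _ fun _ hl => Submodule.smul_mem _ _ (P.nodalBasis_mem hr (hs hl))

lemma nodal_expansion (hr : P.r ≠ 0) {v : Pt d → ℝ} (hv : v ∈ P.Vh) :
    ∑ l ∈ P.nodes, v l • P.nodalBasis l = v := by
  classical
  rw [← sub_eq_zero]
  refine P.eq_zero_of_nodes hr (Submodule.sub_mem _
    (P.sum_nodalBasis_mem hr subset_rfl _) hv) fun m hm => ?_
  rw [Pi.sub_apply, P.sum_nodalBasis_apply hr subset_rfl _ hm, if_pos hm, sub_self]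

lemma nodalBasis_eq_zero_on_cell (hr : P.r ≠ 0) (hl : l ∈ P.nodes) (hT : T ∈ P.mesh.cells)
    (hlT : l ∉ simplexHull T) (hx : x ∈ simplexHull T) : P.nodalBasis l x = 0 :=
  P.eq_zero_on_cell hr (P.nodalBasis_mem hr hl) hT (fun _ hm hmT =>
    P.nodalBasis_of_ne hr hl hm (by rintro rfl; exact hlT hmT)) hx

/-! ### Interior degrees of freedom and their multiplicity -/

section Subdomain

variable {P} {i : Fin P.N}

lemma closure_Omc (hsub : P.sub i ⊆ P.mesh.cells) :
    closure (P.Omc i) = ⋃ T ∈ P.sub i, simplexHull T :=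
  closure_openUnion fun _ hT => P.mesh.isCell (hsub hT)

lemma mem_dof : l ∈ P.dof (P.Omc i) ↔ l ∈ P.nodes ∧
    tsupport (P.nodalBasis l) ⊆ closure (P.Omc i) := by
  classical
  rw [dof, Finset.mem_filter]

lemma dof_subset : P.dof (P.Omc i) ⊆ P.nodes := fun _ hl => (mem_dof.1 hl).1

/-- The basis function is 1 at `l`, hence nonzero somewhere in the interior of each cell containing
`l`; the support condition forces that cell into the subdomain. -/
lemma mem_sub_of_dof (hr : P.r ≠ 0) (hsub : P.sub i ⊆ P.mesh.cells) (hl : l ∈ P.dof (P.Omc i))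
    (hT : T ∈ P.mesh.cells) (hlT : l ∈ simplexHull T) : T ∈ P.sub i := by
  obtain ⟨hln, hts⟩ := mem_dof.1 hl
  rw [closure_Omc hsub] at hts
  have hc := P.continuous_of_mem (P.nodalBasis_mem hr hln)
  have hopen : IsOpen {x | P.nodalBasis l x ≠ 0} := isOpen_ne_fun hc continuous_const
  rw [← (P.mesh.isCell hT).closure_interior] at hlT
  obtain ⟨x, hx, hxT⟩ := mem_closure_iff.1 hlT _ hopen (by
    simp [P.nodalBasis_self hr hln])
  obtain ⟨S, hS, hxS⟩ := mem_iUnion₂.1 (hts (subset_closure hx))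
  rwa [P.mesh.eq_of_mem_interior hT (hsub hS) hxT hxS]

/-- The basis function vanishes on every cell that does not contain `l`. -/
lemma mem_dof_of_forall (hr : P.r ≠ 0) (hsub : P.sub i ⊆ P.mesh.cells) (hl : l ∈ P.nodes)
    (h : ∀ T ∈ P.mesh.cells, l ∈ simplexHull T → T ∈ P.sub i) : l ∈ P.dof (P.Omc i) := by
  refine mem_dof.2 ⟨hl, ?_⟩
  rw [closure_Omc hsub]
  refine closure_minimal (fun x hx => ?_) (isClosed_iUnion_hull _)
  have hxO : x ∈ P.Om := by
    by_contra hxO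
    exact hx (P.eq_zero_of_notMem (P.nodalBasis_mem hr hl) hxO)
  obtain ⟨T, hT, hxT⟩ := exists_cell_of_mem_openUnion hxO
  refine mem_iUnion₂.2 ⟨T, h T hT ?_, hxT⟩
  by_contra hlT
  exact hx (P.nodalBasis_eq_zero_on_cell hr hl hT hlT hxT)

/-- Near `l`, the domain `Ω` meets only cells containing `l`, and these all belong to the subdomain.
-/
lemma mem_Omc_of_dof (hr : P.r ≠ 0) (hsub : P.sub i ⊆ P.mesh.cells) (hl : l ∈ P.dof (P.Omc i)) :
    l ∈ P.Omc i := by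
  have hO := (P.mem_nodes.1 (dof_subset hl)).2
  have hev : ∀ᶠ z in 𝓝 l, ∀ R ∈ P.mesh.cells, l ∉ simplexHull R → z ∉ simplexHull R := by
    rw [Filter.eventually_all_finset]
    intro R _
    by_cases hR : l ∈ simplexHull R
    · exact Eventually.of_forall fun y h => absurd hR h
    · filter_upwards [(isClosed_simplexHull R).isOpen_compl.mem_nhds hR] with y hy _ using hy
  rw [Omc, openUnion, mem_interior_iff_mem_nhds]
  filter_upwards [hev, (isOpen_openUnion _).mem_nhds hO] with z hz hzO
  obtain ⟨T, hT, hzT⟩ := exists_cell_of_mem_openUnion hzO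
  refine mem_iUnion₂.2 ⟨T, mem_sub_of_dof hr hsub hl hT ?_, hzT⟩
  by_contra hlT
  exact hz T hT hlT hzT

/-- A point outside the interior of a set is a limit of points outside the set, so continuity
suffices. This is why extending `Ξ_i v` by zero stays in `V^h`. -/
lemma nodalBasis_eq_zero_of_notMem_Omc (hr : P.r ≠ 0) (hsub : P.sub i ⊆ P.mesh.cells)
    (hl : l ∈ P.dof (P.Omc i)) (hx : x ∉ P.Omc i) : P.nodalBasis l x = 0 := by
  obtain ⟨hln, hts⟩ := mem_dof.1 hl
  rw [closure_Omc hsub] at hts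
  have hc := P.continuous_of_mem (P.nodalBasis_mem hr hln)
  have hx' : x ∈ closure (⋃ T ∈ P.sub i, simplexHull T)ᶜ := by
    rw [closure_compl]; exact hx
  have hcl : IsClosed {x | P.nodalBasis l x = 0} := isClosed_eq hc continuous_const
  refine closure_minimal (fun y hy => ?_) hcl hx'
  by_contra hne
  exact hy (hts (subset_closure hne))

/-- The open sets `Ω_i` themselves cover `Ω`, so a node lies in some `Ω_i` together with a
neighbourhood; every cell at the node then belongs to that subdomain. -/
lemma exists_dof (hr : P.r ≠ 0) (hcov : P.IsCover) (hl : l ∈ P.nodes) :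
    ∃ i, l ∈ P.dof (P.Omc i) := by
  have hO := (P.mem_nodes.1 hl).2
  rw [hcov.2] at hO
  obtain ⟨i, hi⟩ := mem_iUnion.1 hO
  refine ⟨i, mem_dof_of_forall hr (hcov.1 i) hl fun T hT hlT => ?_⟩
  rw [← (P.mesh.isCell hT).closure_interior] at hlT
  obtain ⟨x, hx, hxT⟩ := mem_closure_iff.1 hlT _ (isOpen_openUnion _) hi
  obtain ⟨S, hS, hxS⟩ := exists_cell_of_mem_openUnion hx
  rwa [P.mesh.eq_of_mem_interior hT (hcov.1 i hS) hxT hxS]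

lemma one_le_mult (hl : l ∈ P.dof (P.Omc i)) : 1 ≤ P.mult l :=
  Finset.card_pos.2 ⟨i, Finset.mem_filter.2 ⟨Finset.mem_univ _, hl⟩⟩

/-- A single cell containing `l` belongs to every subdomain counted by `mult`. -/
lemma mult_le_overlapC (hr : P.r ≠ 0) (hsub : ∀ i, P.sub i ⊆ P.mesh.cells) (hl : l ∈ P.nodes) :
    P.mult l ≤ P.overlapC := by
  classical
  obtain ⟨⟨T, hT, α, hα, rfl⟩, -⟩ := P.mem_nodes.1 hl
  refine le_trans (Finset.card_le_card fun i hi => ?_)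
    (Finset.le_sup (f := fun T => (Finset.univ.filter fun i : Fin P.N => T ∈ P.sub i).card) hT)
  have hi' := (Finset.mem_filter.1 hi).2
  exact Finset.mem_filter.2 ⟨Finset.mem_univ _,
    mem_sub_of_dof hr (hsub i) hi' hT (latPoint_mem_hull (P.mesh.isCell hT) hr hα)⟩

lemma card_sub_le_overlapC (hT : T ∈ P.mesh.cells) [DecidablePred fun i => T ∈ P.sub i] :
    (Finset.univ.filter fun i : Fin P.N => T ∈ P.sub i).card ≤ P.overlapC := by
  classical
  refine le_trans (le_of_eq ?_) (Finset.le_sup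
    (f := fun T => (Finset.univ.filter fun i : Fin P.N => T ∈ P.sub i).card) hT)
  congr!

end Subdomain

end HkGenEO

/-! ### Splitting integrals into cells -/

section Decomposition

variable {d : ℕ} (Mh : SimplicialMesh d) {C : Finset (Finset (Pt d))}

/-- By conformity the intersection lies in the hull of the common vertices, of which there are at
most `d`. -/
lemma SimplicialMesh.volume_inter_eq_zero {S T : Finset (Pt d)} (hS : S ∈ Mh.cells)
    (hT : T ∈ Mh.cells) (hST : S ≠ T) : volume (simplexHull S ∩ simplexHull T) = 0 := by
  classical
  refine measure_mono_null (Mh.conforming S hS T hT) ?_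
  rw [← Finset.coe_inter]
  refine IsCell.volume_convexHull_eq_zero ?_
  have h1 : S ∩ T ⊂ S := by
    refine Finset.ssubset_iff_subset_ne.2 ⟨Finset.inter_subset_left, fun h => hST ?_⟩
    exact Finset.eq_of_subset_of_card_le (Finset.inter_eq_left.1 h)
      ((Mh.card_eq T hT).trans (Mh.card_eq S hS).symm).le
  have h2 := Finset.card_lt_card h1
  rw [Mh.card_eq S hS] at h2
  omega

lemma openUnion_ae_eq (C : Finset (Finset (Pt d))) :
    openUnion C =ᵐ[volume] (⋃ T ∈ C, simplexHull T : Set (Pt d)) := by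
  refine interior_ae_eq_of_null_frontier ?_
  refine measure_mono_null (t := ⋃ T ∈ C, frontier (simplexHull T)) ?_ ?_
  · intro x hx
    rw [(isClosed_iUnion_hull C).frontier_eq] at hx
    obtain ⟨T, hT, hxT⟩ := mem_iUnion₂.1 hx.1
    refine mem_iUnion₂.2 ⟨T, hT, subset_closure hxT, fun h => hx.2 ?_⟩
    exact interior_hull_subset_openUnion hT h
  · refine (measure_biUnion_null_iff C.countable_toSet).2 ?_
    exact fun T _ => (convex_simplexHull T).addHaar_frontier volume

lemma SimplicialMesh.restrict_openUnion (hC : C ⊆ Mh.cells) :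
    volume.restrict (openUnion C) = ∑ T ∈ C, volume.restrict (simplexHull T) := by
  classical
  rw [Measure.restrict_congr_set (openUnion_ae_eq C)]
  induction C using Finset.induction_on with
  | empty => simp
  | insert T C hT ih =>
    rw [Finset.sum_insert hT, Finset.set_biUnion_insert,
      ← ih ((Finset.subset_insert _ _).trans hC)]
    refine Measure.restrict_union₀ ?_ (isClosed_iUnion_hull C).measurableSet.nullMeasurableSet
    rw [AEDisjoint, inter_iUnion₂]
    refine (measure_biUnion_null_iff C.countable_toSet).2 ?_
    intro S hS
    refine Mh.volume_inter_eq_zero (hC (Finset.mem_insert_self _ _))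
      (hC (Finset.mem_insert_of_mem hS)) ?_
    rintro rfl
    exact hT hS

lemma restrict_hull_le {T : Finset (Pt d)} (hT : T ∈ C) :
    volume.restrict (simplexHull T) ≤ volume.restrict (openUnion C) := by
  rw [Measure.restrict_congr_set (openUnion_ae_eq C)]
  exact Measure.restrict_mono
    (subset_biUnion_of_mem (u := fun T : Finset (Pt d) => simplexHull T) hT) le_rfl

lemma ae_openUnion_iff (hC : C ⊆ Mh.cells) {p : Pt d → Prop} :
    (∀ᵐ x ∂(volume.restrict (openUnion C)), p x) ↔
      ∀ T ∈ C, ∀ᵐ x ∂(volume.restrict (simplexHull T)), p x := by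
  rw [Mh.restrict_openUnion hC, ae_finsetSum_measure_iff]

lemma volume_openUnion_lt_top (C : Finset (Finset (Pt d))) : volume (openUnion C) < ⊤ := by
  refine (measure_mono interior_subset).trans_lt ?_
  exact (C.finite_toSet.isCompact_biUnion fun T _ => isCompact_simplexHull T).measure_lt_top

end Decomposition

/-! ### Square integrable functions and the forms on them -/

/-- Functions with square integrable values and gradients which are differentiable almost
everywhere. -/
structure Nice {d : ℕ} (D : Set (Pt d)) (u : Pt d → ℝ) : Prop where
  diff : ∀ᵐ x ∂(volume.restrict D), DifferentiableAt ℝ u x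
  grad : MemLp (gradient u) 2 (volume.restrict D)
  mem : MemLp u 2 (volume.restrict D)

namespace Nice

variable {d : ℕ} {D D' : Set (Pt d)} {u v : Pt d → ℝ}

lemma gradient_add_ae (hu : Nice D u) (hv : Nice D v) :
    gradient (u + v) =ᵐ[volume.restrict D] gradient u + gradient v := by
  filter_upwards [hu.diff, hv.diff] with x hx hy
  rw [Pi.add_apply, gradient, fderiv_add hx hy, map_add]
  rfl

lemma gradient_smul_ae (hu : Nice D u) (c : ℝ) :
    gradient (c • u) =ᵐ[volume.restrict D] c • gradient u := by
  filter_upwards [hu.diff] with x hx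
  rw [Pi.smul_apply, gradient, fderiv_const_smul hx, map_smul]
  rfl

lemma add (hu : Nice D u) (hv : Nice D v) : Nice D (u + v) where
  diff := by filter_upwards [hu.diff, hv.diff] with x hx hy using hx.add hy
  grad := (memLp_congr_ae (hu.gradient_add_ae hv)).2 (hu.grad.add hv.grad)
  mem := hu.mem.add hv.mem

lemma smul (hu : Nice D u) (c : ℝ) : Nice D (c • u) where
  diff := by filter_upwards [hu.diff] with x hx using hx.const_smul c
  grad := (memLp_congr_ae (hu.gradient_smul_ae c)).2 (hu.grad.const_smul c)
  mem := hu.mem.const_smul c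

lemma mono (hu : Nice D u) (h : volume.restrict D' ≤ volume.restrict D) : Nice D' u where
  diff := ae_mono h hu.diff
  grad := hu.grad.mono_measure h
  mem := hu.mem.mono_measure h

lemma congr (hu : Nice D u) (hD : IsOpen D) (h : EqOn u v D) : Nice D v := by
  have he : ∀ x ∈ D, u =ᶠ[𝓝 x] v := fun x hx => by
    filter_upwards [hD.mem_nhds hx] with y hy using h hy
  have hae : ∀ᵐ x ∂(volume.restrict D), x ∈ D := ae_restrict_mem hD.measurableSet
  refine ⟨?_, (memLp_congr_ae ?_).1 hu.grad, (memLp_congr_ae ?_).1 hu.mem⟩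
  · filter_upwards [hae, hu.diff] with x hx hd using hd.congr_of_eventuallyEq (he x hx).symm
  · filter_upwards [hae] with x hx using (he x hx).gradient_eq
  · filter_upwards [hae] with x hx using h hx

lemma integrable_grad (hu : Nice D u) : Integrable (fun x => ‖gradient u x‖ ^ 2)
    (volume.restrict D) := (memLp_two_iff_integrable_sq_norm hu.grad.1).1 hu.grad

lemma integrable_sq (hu : Nice D u) : Integrable (fun x => u x ^ 2) (volume.restrict D) :=
  (memLp_two_iff_integrable_sq hu.mem.1).1 hu.mem

end Nice

lemma measurable_gradient {d : ℕ} (u : Pt d → ℝ) : Measurable (gradient u) :=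
  (InnerProductSpace.toDual ℝ (Pt d)).symm.continuous.measurable.comp (measurable_fderiv ℝ u)

namespace HkGenEO

variable {d : ℕ} {P : HkGenEO d} {T : Finset (Pt d)} {D : Set (Pt d)} {u v w : Pt d → ℝ}

lemma gradient_eq_polyGrad {q : MvPolynomial (Fin d) ℝ} (hq : ∀ x ∈ simplexHull T, v x = polyFun q x)
    {x : Pt d} (hx : x ∈ interior (simplexHull T)) :
    HasGradientAt v (polyGrad q x) x := by
  refine (hasGradientAt_polyFun q x).congr_of_eventuallyEq ?_
  filter_upwards [isOpen_interior.mem_nhds hx] with y hy using hq y (interior_subset hy)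

lemma nice_of_mem (hv : v ∈ P.Vh) : Nice P.Om v := by
  have hfin : IsFiniteMeasure (volume.restrict P.Om) :=
    isFiniteMeasure_restrict.2 (volume_openUnion_lt_top _).ne
  have h1 : ∀ T ∈ P.mesh.cells, ∃ B : ℝ, ∀ᵐ x ∂(volume.restrict (simplexHull T)),
      DifferentiableAt ℝ v x ∧ ‖gradient v x‖ ≤ B ∧ ‖v x‖ ≤ B := by
    intro T hT
    obtain ⟨q, -, hvq⟩ := P.exists_polyFun hv hT
    obtain ⟨B, hB⟩ := (isCompact_simplexHull T).exists_bound_of_continuousOn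
      (continuous_polyGrad q).continuousOn
    obtain ⟨B', hB'⟩ := (isCompact_simplexHull T).exists_bound_of_continuousOn
      (continuous_polyFun q).continuousOn
    refine ⟨max B B', ?_⟩
    filter_upwards [ae_mem_interior_simplexHull T] with x hx
    have hg := gradient_eq_polyGrad hvq hx
    refine ⟨hg.differentiableAt, ?_, ?_⟩
    · rw [hg.gradient]; exact (hB x (interior_subset hx)).trans (le_max_left _ _)
    · rw [hvq x (interior_subset hx)]
      exact (hB' x (interior_subset hx)).trans (le_max_right _ _)
  choose! B hB using h1
  have h2 : ∀ᵐ x ∂(volume.restrict P.Om), DifferentiableAt ℝ v x ∧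
      ‖gradient v x‖ ≤ P.mesh.cells.sup' P.mesh.nonempty B ∧
      ‖v x‖ ≤ P.mesh.cells.sup' P.mesh.nonempty B := by
    refine (ae_openUnion_iff P.mesh subset_rfl).2 fun T hT => ?_
    filter_upwards [hB T hT] with x hx
    have := Finset.le_sup' B hT
    exact ⟨hx.1, hx.2.1.trans this, hx.2.2.trans this⟩
  refine ⟨h2.mono fun x hx => hx.1, ?_, ?_⟩
  · exact MemLp.of_bound (measurable_gradient v).aestronglyMeasurable _ (h2.mono fun x hx => hx.2.1)
  · exact MemLp.of_bound (P.continuous_of_mem hv).aestronglyMeasurable _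
      (h2.mono fun x hx => hx.2.2)

/-- The quadratic form of a symmetric positive semidefinite bounded matrix bounds the bilinear one. -/
lemma abs_mulVec_dotProduct_le {A : Matrix (Fin d) (Fin d) ℝ} {a : ℝ} (hA : A.IsSymm)
    (hb : ∀ ξ : Fin d → ℝ, ξ ⬝ᵥ ξ ≤ Matrix.mulVec A ξ ⬝ᵥ ξ ∧ Matrix.mulVec A ξ ⬝ᵥ ξ ≤ a * (ξ ⬝ᵥ ξ))
    (ξ η : Fin d → ℝ) :
    |Matrix.mulVec A ξ ⬝ᵥ η| ≤ a * (ξ ⬝ᵥ ξ) + a * (η ⬝ᵥ η) := by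
  have hs : Matrix.mulVec A η ⬝ᵥ ξ = Matrix.mulVec A ξ ⬝ᵥ η := by
    rw [dotProduct_comm, Matrix.dotProduct_mulVec, ← Matrix.mulVec_transpose, hA.eq]
  have hpos : ∀ ζ : Fin d → ℝ, 0 ≤ ζ ⬝ᵥ ζ := fun ζ => by
    simpa using dotProduct_star_self_nonneg ζ
  -- Nonnegativity at `ξ + η` and `ξ - η` bounds the mixed term from both sides.
  have h1 := (hpos _).trans (hb (ξ + η)).1
  have h2 := (hpos _).trans (hb (ξ - η)).1
  rw [Matrix.mulVec_add, add_dotProduct, dotProduct_add, dotProduct_add, hs] at h1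
  rw [Matrix.mulVec_sub, sub_dotProduct, dotProduct_sub, dotProduct_sub, hs] at h2
  have := (hb ξ).2
  have := (hb η).2
  have := (hpos ξ).trans (hb ξ).1
  have := (hpos η).trans (hb η).1
  rw [abs_le]
  constructor <;> linarith

lemma dotProduct_self_eq (ξ : Pt d) : (fun j => ξ j) ⬝ᵥ (fun j => ξ j) = ‖ξ‖ ^ 2 := by
  rw [EuclideanSpace.norm_sq_eq]
  simp [dotProduct, sq]

section Forms

variable {amax nmin : ℝ} (hP : P.CoeffBounds amax nmin)
  (hD : volume.restrict D ≤ volume.restrict P.Om)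

include hP hD

lemma integrable_aForm (hu : Nice D u) (hv : Nice D v) :
    Integrable (fun x => Matrix.mulVec (P.A x) (fun j => gradient u x j) ⬝ᵥ
      (fun j => gradient v x j)) (volume.restrict D) := by
  have hg : Integrable (fun x => amax * ‖gradient u x‖ ^ 2 + amax * ‖gradient v x‖ ^ 2)
      (volume.restrict D) :=
    (hu.integrable_grad.const_mul amax).add (hv.integrable_grad.const_mul amax)
  refine hg.mono' ?_ ?_
  · simp only [dotProduct, Matrix.mulVec]
    refine AEMeasurable.aestronglyMeasurable ?_
    have hcoord : ∀ (w : Pt d → ℝ) (j : Fin d), Measurable fun x => gradient w x j := fun w j =>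
      (EuclideanSpace.proj j : Pt d →L[ℝ] ℝ).continuous.measurable.comp (measurable_gradient w)
    refine Finset.aemeasurable_fun_sum _ fun i _ => AEMeasurable.mul ?_ (hcoord v i).aemeasurable
    refine Finset.aemeasurable_fun_sum _ fun j _ => AEMeasurable.mul ?_ (hcoord u j).aemeasurable
    exact (hP.meas_A i j).mono_measure hD
  · filter_upwards [ae_mono hD hP.symm, ae_mono hD hP.bounds_A] with x hs hb
    rw [Real.norm_eq_abs, ← dotProduct_self_eq, ← dotProduct_self_eq]
    exact abs_mulVec_dotProduct_le hs hb _ _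

lemma integrable_nForm (hu : Nice D u) (hv : Nice D v) :
    Integrable (fun x => P.n x * u x * v x) (volume.restrict D) := by
  have hi : Integrable (fun x => P.n x * (u x * v x)) (volume.restrict D) := by
    refine (hu.mem.integrable_mul hv.mem).bdd_mul (c := 1) ?_ ?_
    · exact (hP.meas_n.mono_measure hD).aestronglyMeasurable
    · filter_upwards [ae_mono hD hP.bounds_n] with x hx
      rw [Real.norm_eq_abs, abs_le]
      have := hP.nmin_pos
      constructor <;> linarith [hx.1, hx.2]
  exact hi.congr (ae_of_all _ fun x => by ring)

lemma aForm_comm : P.aForm D u v = P.aForm D v u := by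
  refine integral_congr_ae ?_
  filter_upwards [ae_mono hD hP.symm] with x hs
  rw [dotProduct_comm, Matrix.dotProduct_mulVec, ← Matrix.mulVec_transpose, hs.eq]

lemma aForm_add_left (hu : Nice D u) (hv : Nice D v) (hw : Nice D w) :
    P.aForm D (u + v) w = P.aForm D u w + P.aForm D v w := by
  rw [aForm, aForm, aForm, ← integral_add (integrable_aForm hP hD hu hw)
    (integrable_aForm hP hD hv hw)]
  refine integral_congr_ae ?_
  filter_upwards [hu.gradient_add_ae hv] with x hx
  rw [← add_dotProduct, ← Matrix.mulVec_add, hx]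
  rfl

lemma nForm_add_left (hu : Nice D u) (hv : Nice D v) (hw : Nice D w) :
    P.nForm D (u + v) w = P.nForm D u w + P.nForm D v w := by
  rw [nForm, nForm, nForm, ← integral_add (integrable_nForm hP hD hu hw)
    (integrable_nForm hP hD hv hw)]
  congr 1
  ext x
  simp only [Pi.add_apply]
  ring

lemma gradSq_le_aForm (hu : Nice D u) : gradSq D u ≤ P.aForm D u u := by
  refine integral_mono_ae hu.integrable_grad (integrable_aForm hP hD hu hu) ?_
  filter_upwards [ae_mono hD hP.bounds_A] with x hb
  rw [← dotProduct_self_eq]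
  exact (hb _).1

lemma aForm_le_gradSq (hu : Nice D u) : P.aForm D u u ≤ amax * gradSq D u := by
  rw [gradSq, ← integral_const_mul]
  refine integral_mono_ae (integrable_aForm hP hD hu hu) (hu.integrable_grad.const_mul _) ?_
  filter_upwards [ae_mono hD hP.bounds_A] with x hb
  rw [← dotProduct_self_eq]
  exact (hb _).2

lemma le_nForm (hu : Nice D u) : nmin * l2Sq D u ≤ P.nForm D u u := by
  rw [l2Sq, ← integral_const_mul]
  refine integral_mono_ae (hu.integrable_sq.const_mul _) (integrable_nForm hP hD hu hu) ?_
  filter_upwards [ae_mono hD hP.bounds_n] with x hx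
  rw [mul_assoc, ← sq]
  exact mul_le_mul_of_nonneg_right hx.1 (sq_nonneg _)

lemma nForm_le (hu : Nice D u) : P.nForm D u u ≤ l2Sq D u := by
  refine integral_mono_ae (integrable_nForm hP hD hu hu) hu.integrable_sq ?_
  filter_upwards [ae_mono hD hP.bounds_n] with x hx
  rw [mul_assoc, ← sq]
  exact mul_le_of_le_one_left (sq_nonneg _) hx.2

end Forms

lemma aForm_smul_left (hu : Nice D u) (c : ℝ) :
    P.aForm D (c • u) v = c * P.aForm D u v := by
  rw [aForm, aForm, ← integral_const_mul]
  refine integral_congr_ae ?_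
  filter_upwards [hu.gradient_smul_ae c] with x hx
  rw [← smul_eq_mul, ← smul_dotProduct, ← Matrix.mulVec_smul, hx]
  rfl

lemma nForm_smul_left (c : ℝ) : P.nForm D (c • u) v = c * P.nForm D u v := by
  rw [nForm, nForm, ← integral_const_mul]
  congr 1
  ext x
  simp only [Pi.smul_apply, smul_eq_mul]
  ring

lemma nForm_comm : P.nForm D u v = P.nForm D v u := by
  rw [nForm, nForm]
  congr 1
  ext x
  ring

lemma l2Sq_nonneg : 0 ≤ l2Sq D u := integral_nonneg fun _ => sq_nonneg _

lemma gradSq_nonneg : 0 ≤ gradSq D u := integral_nonneg fun _ => by positivity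

section Congr

lemma gradient_eqOn (hD : IsOpen D) (h : EqOn u v D) : EqOn (gradient u) (gradient v) D :=
  fun x hx => Filter.EventuallyEq.gradient_eq (by
    filter_upwards [hD.mem_nhds hx] with y hy using h hy)

lemma aForm_congr (hD : IsOpen D) {u' v' : Pt d → ℝ} (hu : EqOn u u' D) (hv : EqOn v v' D) :
    P.aForm D u v = P.aForm D u' v' := by
  refine setIntegral_congr_fun hD.measurableSet fun x hx => ?_
  simp only [gradient_eqOn hD hu hx, gradient_eqOn hD hv hx]

lemma nForm_congr (hD : IsOpen D) {u' v' : Pt d → ℝ} (hu : EqOn u u' D) (hv : EqOn v v' D) :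
    P.nForm D u v = P.nForm D u' v' := by
  refine setIntegral_congr_fun hD.measurableSet fun x hx => ?_
  simp only [hu hx, hv hx]

lemma energyForm_congr (hD : IsOpen D) {u' v' : Pt d → ℝ} (hu : EqOn u u' D) (hv : EqOn v v' D) :
    P.energyForm D u v = P.energyForm D u' v' := by
  rw [energyForm, energyForm, aForm_congr hD hu hv, nForm_congr hD hu hv]

lemma bForm_congr (hD : IsOpen D) {u' v' : Pt d → ℝ} (hu : EqOn u u' D) (hv : EqOn v v' D) :
    P.bForm D u v = P.bForm D u' v' := by
  rw [bForm, bForm, aForm_congr hD hu hv, nForm_congr hD hu hv]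

lemma l2Sq_congr (hD : IsOpen D) (hu : EqOn u v D) : l2Sq D u = l2Sq D v :=
  setIntegral_congr_fun hD.measurableSet fun x hx => by simp only [hu hx]

end Congr

section Sums

variable {C : Finset (Finset (Pt d))} (hC : C ⊆ P.mesh.cells)

include hC

lemma setIntegral_openUnion {f : Pt d → ℝ} (hf : IntegrableOn f (openUnion C)) :
    ∫ x in openUnion C, f x = ∑ T ∈ C, ∫ x in simplexHull T, f x := by
  rw [P.mesh.restrict_openUnion hC, integral_finsetSum_measure]
  exact fun T hT => Integrable.mono_measure hf (restrict_hull_le hT)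

lemma l2Sq_openUnion (hu : Nice (openUnion C) u) :
    l2Sq (openUnion C) u = ∑ T ∈ C, l2Sq (simplexHull T) u :=
  setIntegral_openUnion hC hu.integrable_sq

lemma gradSq_openUnion (hu : Nice (openUnion C) u) :
    gradSq (openUnion C) u = ∑ T ∈ C, gradSq (simplexHull T) u :=
  setIntegral_openUnion hC hu.integrable_grad

lemma energyForm_openUnion {amax nmin : ℝ} (hP : P.CoeffBounds amax nmin)
    (hu : Nice (openUnion C) u) (hv : Nice (openUnion C) v) :
    P.energyForm (openUnion C) u v = ∑ T ∈ C, P.energyForm (simplexHull T) u v := by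
  have hD : volume.restrict (openUnion C) ≤ volume.restrict P.Om :=
    Measure.restrict_mono (openUnion_mono hC) le_rfl
  simp only [energyForm]
  rw [Finset.sum_add_distrib, ← Finset.mul_sum, aForm, nForm,
    setIntegral_openUnion hC (integrable_aForm hP hD hu hv),
    setIntegral_openUnion hC (integrable_nForm hP hD hu hv)]
  rfl

end Sums

end HkGenEO

/-! ### Extension by zero and the partition of unity -/

section ZeroExt

variable {d : ℕ} {D : Set (Pt d)} {x : Pt d}

lemma zeroExt_of_mem (u : D → ℝ) (hx : x ∈ D) : zeroExt u x = u ⟨x, hx⟩ :=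
  Subtype.val_injective.extend_apply u 0 (⟨x, hx⟩ : D)

lemma zeroExt_of_notMem (u : D → ℝ) (hx : x ∉ D) : zeroExt u x = 0 :=
  Function.extend_apply' u (0 : Pt d → ℝ) x fun ⟨y, hy⟩ => hx (hy ▸ y.2)

lemma eqOn_zeroExt_restrictTo (v : Pt d → ℝ) : EqOn v (zeroExt (restrictTo D v)) D :=
  fun _ hx => (zeroExt_of_mem (restrictTo D v) hx).symm

lemma zeroExt_restrictTo_of_zero {v : Pt d → ℝ} (hv : ∀ x ∉ D, v x = 0) :
    zeroExt (restrictTo D v) = v := by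
  ext x
  by_cases hx : x ∈ D
  · exact zeroExt_of_mem _ hx
  · rw [zeroExt_of_notMem _ hx, hv x hx]

lemma zeroExt_add (u v : D → ℝ) : zeroExt (u + v) = zeroExt u + zeroExt v := by
  ext x
  by_cases hx : x ∈ D
  · simp only [Pi.add_apply, zeroExt_of_mem _ hx]
  · simp only [Pi.add_apply, zeroExt_of_notMem _ hx, add_zero]

lemma zeroExt_smul (c : ℝ) (u : D → ℝ) : zeroExt (c • u) = c • zeroExt u := by
  ext x
  by_cases hx : x ∈ D
  · simp only [Pi.smul_apply, zeroExt_of_mem _ hx]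
  · simp only [Pi.smul_apply, zeroExt_of_notMem _ hx, smul_zero]

end ZeroExt

namespace HkGenEO

section XiExt

variable {d : ℕ} (P : HkGenEO d) (i : Fin P.N) {T : Finset (Pt d)}

/-- The extension by zero of `Ξ_i u`. -/
def xiExt (u : Pt d → ℝ) : Pt d → ℝ :=
  ∑ l ∈ P.dof (P.Omc i), ((1 / (P.mult l : ℝ)) * u l) • P.nodalBasis l

lemma Xi_add (u v : P.Omc i → ℝ) : P.Xi i (u + v) = P.Xi i u + P.Xi i v := by
  simp only [Xi, zeroExt_add, Pi.add_apply, mul_add, add_smul, Finset.sum_add_distrib]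

lemma Xi_smul (c : ℝ) (u : P.Omc i → ℝ) : P.Xi i (c • u) = c • P.Xi i u := by
  simp only [Xi, zeroExt_smul, Pi.smul_apply, Finset.smul_sum, smul_smul, smul_eq_mul]
  exact Finset.sum_congr rfl fun l _ => by congr 1; ring

variable {P i}

/-- Interior nodes lie in the open set `Ω_i`, so `zeroExt` reads the true nodal values there. -/
lemma Xi_restrictTo (hr : P.r ≠ 0) (hsub : P.sub i ⊆ P.mesh.cells) (u : Pt d → ℝ) :
    P.Xi i (restrictTo (P.Omc i) u) = restrictTo (P.Omc i) (P.xiExt i u) := by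
  rw [Xi, xiExt, map_sum]
  refine Finset.sum_congr rfl fun l hl => ?_
  rw [map_smul, ← eqOn_zeroExt_restrictTo u (mem_Omc_of_dof hr hsub hl)]

lemma xiExt_mem (hr : P.r ≠ 0) (u : Pt d → ℝ) : P.xiExt i u ∈ P.Vh :=
  P.sum_nodalBasis_mem hr dof_subset _

lemma xiExt_eq_zero (hr : P.r ≠ 0) (hsub : P.sub i ⊆ P.mesh.cells) (u : Pt d → ℝ) {x : Pt d}
    (hx : x ∉ P.Omc i) : P.xiExt i u x = 0 := by
  rw [xiExt, Finset.sum_apply]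
  exact Finset.sum_eq_zero fun l hl => by
    simp [nodalBasis_eq_zero_of_notMem_Omc hr hsub hl hx]

lemma zeroExt_Xi_restrictTo (hr : P.r ≠ 0) (hsub : P.sub i ⊆ P.mesh.cells) (u : Pt d → ℝ) :
    zeroExt (P.Xi i (restrictTo (P.Omc i) u)) = P.xiExt i u := by
  rw [Xi_restrictTo hr hsub, zeroExt_restrictTo_of_zero fun x hx => xiExt_eq_zero hr hsub u hx]

open Classical in
lemma xiExt_node (hr : P.r ≠ 0) (u : Pt d → ℝ) {m : Pt d} (hm : m ∈ P.nodes) :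
    P.xiExt i u m = if m ∈ P.dof (P.Omc i) then (1 / (P.mult m : ℝ)) * u m else 0 :=
  P.sum_nodalBasis_apply hr dof_subset (fun l => (1 / (P.mult l : ℝ)) * u l) hm

/-- The operators `Ξ_i` form a partition of unity. -/
lemma sum_xiExt (hr : P.r ≠ 0) (hcov : P.IsCover) {u : Pt d → ℝ} (hu : u ∈ P.Vh) :
    ∑ i, P.xiExt i u = u := by
  classical
  rw [← sub_eq_zero]
  refine P.eq_zero_of_nodes hr (Submodule.sub_mem _
    (Submodule.sum_mem _ fun i _ => xiExt_mem hr u) hu) fun m hm => ?_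
  rw [Pi.sub_apply, Finset.sum_apply, Finset.sum_congr rfl fun i _ => xiExt_node hr u hm,
    ← Finset.sum_filter, Finset.sum_const, nsmul_eq_mul]
  -- Exactly `mult m` summands contribute `u m / mult m`; the cover ensures that this number is not
  -- zero.
  obtain ⟨i, hi⟩ := exists_dof hr hcov hm
  have h1 : (P.mult m : ℝ) ≠ 0 := by exact_mod_cast Nat.one_le_iff_ne_zero.1 (one_le_mult hi)
  have h2 : (Finset.univ.filter fun i : Fin P.N => m ∈ P.dof (P.Omc i)).card = P.mult m := by
    rw [mult]
  rw [h2]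
  field_simp
  simp

/-- `Ξ_i u` vanishes if the interior nodal values of `u` do. -/
lemma xiExt_eq_zero_iff (hr : P.r ≠ 0) (u : Pt d → ℝ) :
    P.xiExt i u = 0 ↔ ∀ l ∈ P.dof (P.Omc i), u l = 0 := by
  classical
  constructor
  · intro h l hl
    have h1 := xiExt_node (i := i) hr u (dof_subset hl)
    rw [h, if_pos hl, Pi.zero_apply] at h1
    have h2 : (P.mult l : ℝ) ≠ 0 := by exact_mod_cast Nat.one_le_iff_ne_zero.1 (one_le_mult hl)
    simpa [h2] using h1.symm
  · intro h
    exact Finset.sum_eq_zero fun l hl => by rw [h l hl, mul_zero, zero_smul]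

end XiExt

/-! ### Cell estimates for finite element functions -/

section Local

variable {d : ℕ} {P : HkGenEO d} {T : Finset (Pt d)}

lemma l2Sq_hull_eq {v : Pt d → ℝ} {q : MvPolynomial (Fin d) ℝ}
    (h : ∀ x ∈ simplexHull T, v x = polyFun q x) :
    l2Sq (simplexHull T) v = ∫ x in simplexHull T, polyFun q x ^ 2 :=
  setIntegral_congr_fun (measurableSet_simplexHull T) fun x hx => by simp only [h x hx]

lemma gradSq_hull_eq {v : Pt d → ℝ} {q : MvPolynomial (Fin d) ℝ}
    (h : ∀ x ∈ simplexHull T, v x = polyFun q x) :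
    gradSq (simplexHull T) v = ∫ x in simplexHull T, ‖polyGrad q x‖ ^ 2 := by
  refine integral_congr_ae ?_
  filter_upwards [ae_mem_interior_simplexHull T] with x hx
  rw [(gradient_eq_polyGrad h hx).gradient]

/-- Finite element functions which are dominated at the nodes of a cell are dominated in `L²`. -/
lemma exists_l2Sq_le (d r : ℕ) (hr : r ≠ 0) : ∃ C : ℝ, 1 ≤ C ∧ ∀ P : HkGenEO d, P.r = r →
    ∀ T ∈ P.mesh.cells, ∀ w ∈ P.Vh, ∀ u ∈ P.Vh, ∀ t : ℝ, 0 ≤ t →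
      (∀ m ∈ P.nodes, m ∈ simplexHull T → |w m| ≤ t * |u m|) →
      l2Sq (simplexHull T) w ≤ C * t ^ 2 * l2Sq (simplexHull T) u := by
  obtain ⟨C, hC, h⟩ := exists_nodal_domination d r hr
  refine ⟨C, hC, fun P hPr T hT w hw u hu t ht hdom => ?_⟩
  subst hPr
  obtain ⟨p, hp, hwp⟩ := P.exists_polyFun hw hT
  obtain ⟨q, hq, huq⟩ := P.exists_polyFun hu hT
  rw [l2Sq_hull_eq hwp, l2Sq_hull_eq huq]
  refine h T (P.mesh.isCell hT) p q hp hq t ht fun α hα => ?_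
  have hm := latPoint_mem_hull (P.mesh.isCell hT) hr hα
  rw [← hwp _ hm, ← huq _ hm]
  -- The domination is assumed at degrees of freedom only; at Lagrange points outside `Ω` both
  -- functions vanish.
  by_cases hO : latPoint T P.r α ∈ P.Om
  · exact hdom _ (P.mem_nodes.2 ⟨⟨T, hT, α, hα, rfl⟩, hO⟩) hm
  · rw [P.eq_zero_of_notMem hw hO, P.eq_zero_of_notMem hu hO]
    simp

lemma exists_oscillation_Vh_le (d r : ℕ) (hr : r ≠ 0) : ∃ C : ℝ, 0 ≤ C ∧
    ∀ P : HkGenEO d, P.r = r → ∀ T ∈ P.mesh.cells, ∀ v ∈ P.Vh,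
      ∀ x ∈ simplexHull T, ∀ y ∈ simplexHull T,
      (v x - v y) ^ 2 * volume.real (simplexHull T) ≤
        C * cellDiam T ^ 2 * gradSq (simplexHull T) v := by
  obtain ⟨C, hC, h⟩ := exists_oscillation_le d r hr
  refine ⟨C, hC, fun P hPr T hT v hv x hx y hy => ?_⟩
  subst hPr
  obtain ⟨q, hq, hvq⟩ := P.exists_polyFun hv hT
  rw [gradSq_hull_eq hvq, hvq x hx, hvq y hy]
  exact h T (P.mesh.isCell hT) q hq x hx y hy

end Local

end HkGenEO

/-! ### Poincaré inequality along chains of cells -/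

section Chain

variable {d : ℕ}

/-- A function is bounded along a chain of cells by its oscillations if it vanishes at the end. -/
lemma abs_le_sum_oscillation (f : Pt d → ℝ) : ∀ (n : ℕ) (c : ℕ → Finset (Pt d)) (s : ℕ → ℝ),
    (∀ j ≤ n, ∀ x ∈ simplexHull (c j), ∀ y ∈ simplexHull (c j), |f x - f y| ≤ s j) →
    (∀ j < n, (simplexHull (c j) ∩ simplexHull (c (j + 1))).Nonempty) →
    (∃ l ∈ simplexHull (c n), f l = 0) → ∀ x ∈ simplexHull (c 0),
      |f x| ≤ ∑ j ∈ Finset.range (n + 1), s j := by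
  intro n
  induction n with
  | zero =>
    rintro c s hs - ⟨l, hl, hfl⟩ x hx
    have := hs 0 le_rfl x hx l hl
    rw [hfl, sub_zero] at this
    simpa using this
  | succ n ih =>
    rintro c s hs hc ⟨l, hl, hfl⟩ x hx
    obtain ⟨y, hy0, hy1⟩ := hc 0 (Nat.succ_pos n)
    have h1 := ih (fun j => c (j + 1)) (fun j => s (j + 1)) (fun j hj => hs (j + 1) (by omega))
      (fun j hj => hc (j + 1) (by omega)) ⟨l, hl, hfl⟩ y hy1
    have h2 := hs 0 (Nat.zero_le _) x hx y hy0
    rw [Finset.sum_range_succ']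
    have h3 : |f x| ≤ |f x - f y| + |f y| := by
      have := abs_add_le (f x - f y) (f y)
      simpa using this
    linarith

end Chain

namespace HkGenEO

variable {d : ℕ}

lemma cellDiam_le_size {P : HkGenEO d} {T : Finset (Pt d)} (hT : T ∈ P.mesh.cells) :
    cellDiam T ≤ P.mesh.size := Finset.le_sup' cellDiam hT

lemma size_pos (P : HkGenEO d) (hd : d ≠ 0) : 0 < P.mesh.size := by
  obtain ⟨T, hT⟩ := P.mesh.nonempty
  exact ((P.mesh.isCell hT).cellDiam_pos hd).trans_le (cellDiam_le_size hT)

/-- The total volume of a set of cells which lie in a ball. -/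
lemma sum_volume_le {P : HkGenEO d} {C : Finset (Finset (Pt d))} (hC : C ⊆ P.mesh.cells)
    {z : Pt d} {R : ℝ} (hR : 0 ≤ R) (h : ∀ T ∈ C, simplexHull T ⊆ Metric.closedBall z R) :
    ∑ T ∈ C, volume.real (simplexHull T) ≤ R ^ d * volume.real (Metric.ball (0 : Pt d) 1) := by
  have h1 : ∑ T ∈ C, volume.real (simplexHull T) = volume.real (openUnion C) := by
    have h2 := congrArg (fun μ : Measure (Pt d) => μ univ) (P.mesh.restrict_openUnion hC)
    simp only [Measure.restrict_apply_univ, Measure.finsetSum_apply] at h2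
    rw [measureReal_def, h2, ENNReal.toReal_sum fun T _ => (volume_simplexHull_lt_top T).ne]
    rfl
  have h3 : openUnion C ⊆ Metric.closedBall z R := by
    intro x hx
    obtain ⟨T, hT, hxT⟩ := exists_cell_of_mem_openUnion hx
    exact h T hT hxT
  rw [h1]
  refine (measureReal_mono h3 Metric.isBounded_closedBall.measure_lt_top.ne).trans (le_of_eq ?_)
  rw [measureReal_def, measureReal_def, Measure.addHaar_closedBall volume z hR]
  simp only [finrank_euclideanSpace, Fintype.card_fin, ENNReal.toReal_mul]
  rw [ENNReal.toReal_ofReal (by positivity)]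

/-- Poincaré inequality for finite element functions that vanish at the interior nodes of a
subdomain. -/
lemma exists_poincare (d r M : ℕ) (hd : d ≠ 0) (hr : r ≠ 0) {CSR : ℝ} (hCSR : 0 < CSR) :
    ∃ C : ℝ, 0 < C ∧ ∀ P : HkGenEO d, P.r = r → P.ShapeRegular CSR →
      (∀ i, P.sub i ⊆ P.mesh.cells) → P.InteriorReach M → ∀ i, ∀ u ∈ P.Vh,
      (∀ l ∈ P.dof (P.Omc i), u l = 0) →
      l2Sq (P.Omc i) u ≤ C * P.mesh.size ^ 2 * gradSq (P.Omc i) u := by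
  obtain ⟨C, hC, hosc⟩ := exists_oscillation_Vh_le d r hr
  -- Bound for the ratio of diameters of cells sharing an edge; being at least 1, its powers
  -- increase.
  set κ := max 1 (1 / CSR) with hκ
  have hκ1 : 1 ≤ κ := le_max_left _ _
  have hκ0 : 0 < κ := zero_lt_one.trans_le hκ1
  -- Volume of a ball of radius `(M + 1) κ^M` times the diameter of a cell, divided by the lower
  -- bound of `volume_ge` for that cell.
  set Q := (((M : ℝ) + 1) * κ ^ M * (4 / CSR)) ^ d with hQ
  have hQ0 : 0 < Q := by positivity
  -- One factor `M + 1` comes from Cauchy–Schwarz along a chain, the other from the sum over chain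
  -- positions; `C + 1` replaces `C` for positivity.
  refine ⟨((M : ℝ) + 1) ^ 2 * (C + 1) * Q, by positivity,
    fun P hPr hSR hsub hreach i u hu hzero => ?_⟩
  choose! c hc0 hcsub hcedge hcend using hreach i
  have hnice : Nice (P.Omc i) u :=
    (nice_of_mem hu).mono (Measure.restrict_mono (openUnion_mono (hsub i)) le_rfl)
  set h := P.mesh.size with hh
  have hvol : ∀ T ∈ P.sub i, 0 < volume.real (simplexHull T) := fun T hT =>
    (P.mesh.isCell (hsub i hT)).volume_real_pos
  have hmeet : ∀ T ∈ P.sub i, ∀ j < M,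
      (simplexHull (c T j) ∩ simplexHull (c T (j + 1))).Nonempty := by
    intro T hT j hj
    obtain ⟨x, y, -, hx, hx', -⟩ := hcedge T hT j hj
    exact ⟨x, subset_simplexHull _ hx, subset_simplexHull _ hx'⟩
  -- diameters along a chain
  have hstep : ∀ T ∈ P.sub i, ∀ j < M, cellDiam (c T j) ≤ κ * cellDiam (c T (j + 1)) := by
    intro T hT j hj
    obtain ⟨x, y, hxy, hx, hx', hy, hy'⟩ := hcedge T hT j hj
    have hcell := hsub i (hcsub T hT j hj.le)
    -- The common edge is bounded below by the inscribed ball of one cell and above by the diameter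
    -- of the other.
    have h1 := (hSR _ hcell).trans ((P.mesh.isCell hcell).cellInDiam_le_dist hxy hx hy)
    have h2 := dist_le_cellDiam (c T (j + 1)) (subset_simplexHull _ hx') (subset_simplexHull _ hy')
    have h3 : cellDiam (c T j) ≤ 1 / CSR * cellDiam (c T (j + 1)) := by
      rw [div_mul_eq_mul_div, one_mul, le_div_iff₀ hCSR, mul_comm]
      exact h1.trans h2
    exact h3.trans (mul_le_mul_of_nonneg_right (le_max_right _ _) (cellDiam_nonneg _))
  have hdiam : ∀ T ∈ P.sub i, ∀ n j, j + n ≤ M →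
      cellDiam (c T j) ≤ κ ^ n * cellDiam (c T (j + n)) := by
    intro T hT n
    induction n with
    | zero => intro j _; simp
    | succ n ih =>
      intro j hj
      refine (ih j (by omega)).trans ?_
      rw [pow_succ, mul_assoc]
      exact mul_le_mul_of_nonneg_left (hstep T hT (j + n) (by omega)) (by positivity)
  have hdist : ∀ T ∈ P.sub i, ∀ j ≤ M, ∀ x ∈ simplexHull T, ∀ y ∈ simplexHull (c T j),
      dist x y ≤ ((M : ℝ) + 1) * κ ^ M * cellDiam (c T j) := by
    intro T hT j hj x hx y hy
    -- The chain estimate applied to the distance from `y`, whose oscillation on a cell is at most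
    -- the diameter.
    have h1 := abs_le_sum_oscillation (fun z => dist z y) j (c T) (fun j => cellDiam (c T j))
      (fun j' _ z hz z' hz' => (abs_dist_sub_le z z' y).trans (dist_le_cellDiam _ hz hz'))
      (fun j' hj' => hmeet T hT j' (by omega)) ⟨y, hy, dist_self y⟩ x (by rwa [hc0 T hT])
    rw [abs_of_nonneg dist_nonneg] at h1
    refine h1.trans ?_
    have h2 : ∀ j' ∈ Finset.range (j + 1), cellDiam (c T j') ≤ κ ^ M * cellDiam (c T j) := by
      intro j' hj'
      have hj'' : j' ≤ j := Nat.lt_succ_iff.1 (Finset.mem_range.1 hj')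
      have h3 := hdiam T hT (j - j') j' (by omega)
      rw [Nat.add_sub_cancel' hj''] at h3
      refine h3.trans (mul_le_mul_of_nonneg_right ?_ (cellDiam_nonneg _))
      exact pow_le_pow_right₀ hκ1 (by omega)
    refine (Finset.sum_le_card_nsmul _ _ _ h2).trans ?_
    rw [Finset.card_range, nsmul_eq_mul, mul_assoc]
    refine mul_le_mul_of_nonneg_right ?_ (mul_nonneg (by positivity) (cellDiam_nonneg _))
    have : (j : ℝ) ≤ M := by exact_mod_cast hj
    push_cast
    linarith
  -- bound on one cell
  set g : Finset (Pt d) → ℝ := fun S => gradSq (simplexHull S) u / volume.real (simplexHull S)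
    with hg
  have hg0 : ∀ S, 0 ≤ g S := fun S => div_nonneg gradSq_nonneg measureReal_nonneg
  have hcell : ∀ T ∈ P.sub i, l2Sq (simplexHull T) u ≤
      ((M : ℝ) + 1) * C * h ^ 2 *
        ∑ j ∈ Finset.range (M + 1), volume.real (simplexHull T) * g (c T j) := by
    intro T hT
    -- The chain ends at a cell containing a zero of `u`, so `u` is bounded by the sum of `M + 1`
    -- oscillations, which is squared by Cauchy–Schwarz.
    have hpt : ∀ x ∈ simplexHull T, u x ^ 2 ≤
        ((M : ℝ) + 1) * ∑ j ∈ Finset.range (M + 1), C * h ^ 2 * g (c T j) := by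
      intro x hx
      have h1 := abs_le_sum_oscillation u M (c T) (fun j => √(C * h ^ 2 * g (c T j)))
        (fun j hj y hy z hz => by
          refine Real.le_sqrt_of_sq_le ?_
          rw [sq_abs]
          have hm := hcsub T hT j hj
          have h2 := hosc P hPr _ (hsub i hm) u hu y hy z hz
          rw [hg, mul_div_assoc', le_div_iff₀ (hvol _ hm)]
          refine h2.trans (mul_le_mul_of_nonneg_right (mul_le_mul_of_nonneg_left ?_ hC)
            gradSq_nonneg)
          exact pow_le_pow_left₀ (cellDiam_nonneg _) (cellDiam_le_size (hsub i hm)) 2)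
        (hmeet T hT)
        (by
          obtain ⟨l, hl, hlM⟩ := hcend T hT
          exact ⟨l, hlM, hzero l hl⟩) x (by rwa [hc0 T hT])
      rw [← sq_abs]
      refine (pow_le_pow_left₀ (abs_nonneg _) h1 2).trans ?_
      refine sq_sum_le_card_mul_sum_sq.trans (le_of_eq ?_)
      rw [Finset.card_range]
      push_cast
      congr 1
      refine Finset.sum_congr rfl fun j _ => Real.sq_sqrt ?_
      exact mul_nonneg (by positivity) (hg0 _)
    have hint : IntegrableOn (fun x => u x ^ 2) (simplexHull T) :=
      integrableOn_hull T ((P.continuous_of_mem hu).pow 2)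
    calc l2Sq (simplexHull T) u ≤ ∫ x in simplexHull T,
          ((M : ℝ) + 1) * ∑ j ∈ Finset.range (M + 1), C * h ^ 2 * g (c T j) :=
          setIntegral_mono_on hint (integrableOn_hull T continuous_const)
            (measurableSet_simplexHull T) hpt
      _ = _ := by
          rw [setIntegral_const, smul_eq_mul, Finset.mul_sum, Finset.mul_sum, Finset.mul_sum]
          exact Finset.sum_congr rfl fun j _ => by ring
  -- summation, by the volume bound on the cells that reach a given one
  have hfib : ∀ j ∈ Finset.range (M + 1),
      ∑ T ∈ P.sub i, volume.real (simplexHull T) * g (c T j) ≤ Q * gradSq (P.Omc i) u := by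
    intro j hj
    have hjM : j ≤ M := Nat.lt_succ_iff.1 (Finset.mem_range.1 hj)
    classical
    rw [Omc, gradSq_openUnion (hsub i) hnice, Finset.mul_sum,
      ← Finset.sum_fiberwise_of_maps_to (fun T hT => hcsub T hT j hjM)]
    refine Finset.sum_le_sum fun S hS => ?_
    have hSc := P.mesh.isCell (hsub i hS)
    have h1 : ∑ T ∈ P.sub i with c T j = S, volume.real (simplexHull T) * g (c T j) =
        (∑ T ∈ P.sub i with c T j = S, volume.real (simplexHull T)) * g S := by
      rw [Finset.sum_mul]
      exact Finset.sum_congr rfl fun T hT => by rw [(Finset.mem_filter.1 hT).2]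
    obtain ⟨z, hz⟩ := hSc.nonempty
    -- All cells whose chain is at `S` in position `j` lie in one ball around a vertex of `S`. Their
    -- volumes are added rather than the cells counted, as the weights are exactly these volumes.
    have h2 : ∑ T ∈ P.sub i with c T j = S, volume.real (simplexHull T) ≤
        (((M : ℝ) + 1) * κ ^ M * cellDiam S) ^ d * volume.real (Metric.ball (0 : Pt d) 1) := by
      refine sum_volume_le ((Finset.filter_subset _ _).trans (hsub i)) (z := z)
        (mul_nonneg (by positivity) (cellDiam_nonneg _)) fun T hT x hx => ?_
      obtain ⟨hT, hTS⟩ := Finset.mem_filter.1 hT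
      have := hdist T hT j hjM x hx z (by rw [hTS]; exact subset_simplexHull _ hz)
      rwa [hTS] at this
    have h3 := hSc.volume_ge hd hCSR (hSR S (hsub i hS))
    have h4 : ∑ T ∈ P.sub i with c T j = S, volume.real (simplexHull T) ≤
        Q * volume.real (simplexHull S) := by
      refine h2.trans (le_trans (le_of_eq ?_) (mul_le_mul_of_nonneg_left h3 hQ0.le))
      rw [hQ, ← mul_assoc, ← mul_pow]
      congr 2
      field_simp
    rw [h1]
    calc _ ≤ Q * volume.real (simplexHull S) * g S := mul_le_mul_of_nonneg_right h4 (hg0 S)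
      _ = _ := by
          have := (hvol S hS).ne'
          rw [hg]; field_simp
  have hG0 : 0 ≤ gradSq (P.Omc i) u := gradSq_nonneg
  calc l2Sq (P.Omc i) u = ∑ T ∈ P.sub i, l2Sq (simplexHull T) u := by
        rw [Omc, l2Sq_openUnion (hsub i) hnice]
    _ ≤ ∑ T ∈ P.sub i, ((M : ℝ) + 1) * C * h ^ 2 *
        ∑ j ∈ Finset.range (M + 1), volume.real (simplexHull T) * g (c T j) :=
        Finset.sum_le_sum hcell
    _ = ((M : ℝ) + 1) * C * h ^ 2 * ∑ j ∈ Finset.range (M + 1),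
          ∑ T ∈ P.sub i, volume.real (simplexHull T) * g (c T j) := by
        rw [← Finset.mul_sum, Finset.sum_comm]
    _ ≤ ((M : ℝ) + 1) * C * h ^ 2 * ((M + 1) * (Q * gradSq (P.Omc i) u)) := by
        refine mul_le_mul_of_nonneg_left ?_ (by positivity)
        refine (Finset.sum_le_card_nsmul _ _ _ hfib).trans (le_of_eq ?_)
        rw [Finset.card_range, nsmul_eq_mul]; push_cast; rfl
    _ = ((M : ℝ) + 1) ^ 2 * C * Q * h ^ 2 * gradSq (P.Omc i) u := by ring
    _ ≤ _ := by
        refine mul_le_mul_of_nonneg_right (mul_le_mul_of_nonneg_right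
          (mul_le_mul_of_nonneg_right ?_ hQ0.le) (by positivity)) hG0
        exact mul_le_mul_of_nonneg_left (by linarith) (by positivity)

end HkGenEO

/-! ### Generalised eigenvalue problem with an indefinite form -/

section Spectral

variable {V : Type*} [AddCommGroup V] [Module ℝ V]

/-- Cauchy–Schwarz for a sum of vectors and a positive semidefinite form. -/
lemma form_sum_le (B : V →ₗ[ℝ] V →ₗ[ℝ] ℝ) (hs : ∀ x y, B x y = B y x) (hn : ∀ x, 0 ≤ B x x)
    {ι : Type*} (s : Finset ι) (g : ι → V) :
    B (∑ i ∈ s, g i) (∑ i ∈ s, g i) ≤ s.card * ∑ i ∈ s, B (g i) (g i) := by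
  have h1 : ∀ x y, B x y ≤ (B x x + B y y) / 2 := by
    intro x y
    have := hn (x - y)
    simp only [map_sub, LinearMap.sub_apply] at this
    linarith [hs x y]
  calc B (∑ i ∈ s, g i) (∑ i ∈ s, g i) = ∑ i ∈ s, ∑ j ∈ s, B (g i) (g j) := by
        rw [map_sum B, LinearMap.sum_apply]
        exact Finset.sum_congr rfl fun i _ => map_sum _ _ _
    _ ≤ ∑ i ∈ s, ∑ j ∈ s, (B (g i) (g i) + B (g j) (g j)) / 2 :=
        Finset.sum_le_sum fun i _ => Finset.sum_le_sum fun j _ => h1 _ _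
    _ = _ := by
        simp only [add_div, Finset.sum_add_distrib, Finset.sum_const, nsmul_eq_mul,
          ← Finset.mul_sum, ← Finset.sum_div]
        ring

/-- Lower bound for the indefinite form `a - κ n` at a vector `q + z` which is orthogonal to its
component `z`, in a direction where the form is coercive. -/
lemma neg_form_le (a n : V →ₗ[ℝ] V →ₗ[ℝ] ℝ) (has : ∀ x y, a x y = a y x)
    (hns : ∀ x y, n x y = n y x) (ha : ∀ x, 0 ≤ a x x) (hn : ∀ x, 0 ≤ n x x) {κ : ℝ} (hκ : 0 ≤ κ)
    (q z : V) (hort : a (q + z) z - κ * n (q + z) z = 0) (hz : κ * n z z ≤ a z z / 2) :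
    -(a (q + z) (q + z) - κ * n (q + z) (q + z)) ≤ 4 * (a q q + κ * n q q) := by
  -- Write E for a + κn and b for a − κn. Orthogonality gives −b(q+z, q+z) = b(z, z) − b(q, q) and
  -- b(z, z) = −b(q, z). The hypothesis on `z` means E(z) ≤ 3 b(z, z); Young's inequality with
  -- weight 3 then yields b(z, z) ≤ 3 E(q), and −b(q, q) costs one more E(q).
  have h0 := hort
  have h1 := ha ((3 : ℝ) • q + z)
  have h2 := mul_nonneg hκ (hn ((-3 : ℝ) • q + z))
  simp only [map_add, map_smul, LinearMap.add_apply, LinearMap.smul_apply, smul_eq_mul]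
    at h1 h2 h0 ⊢
  have h3 := has z q
  have h4 := hns z q
  have h5 := ha q
  have h6 := mul_nonneg hκ (hn q)
  rw [h3] at h1 ⊢
  rw [h4] at h2 ⊢
  linarith

variable {K : ℕ} {lam : Fin K → ℝ} {p : Fin K → V} (b c : V →ₗ[ℝ] V →ₗ[ℝ] ℝ)

section

variable (hcs : ∀ x y, c x y = c y x) (horth : ∀ j j', c (p j) (p j') = if j = j' then 1 else 0)

include hcs horth

lemma form_orthonormal_expansion {z : V} (hz : ∀ w, c z w = 0) (α : Fin K → ℝ) :
    c (z + ∑ j, α j • p j) (z + ∑ j, α j • p j) = ∑ j, α j ^ 2 := by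
  have h0 : ∀ w, c w z = 0 := fun w => by rw [hcs, hz]
  simp only [map_add, LinearMap.add_apply, hz, h0, zero_add, map_sum, map_smul,
    LinearMap.sum_apply, LinearMap.smul_apply, horth, smul_eq_mul, mul_zero,
    Finset.sum_const_zero]
  refine Finset.sum_congr rfl fun j _ => ?_
  simp [sq]

variable (hbs : ∀ x y, b x y = b y x) (heig : ∀ j v, b (p j) v = lam j * c (p j) v)

include hbs heig

/-- The eigenvalue equation transfers `c`-orthogonality to `b`: both the terms between eigenvectors
and those with the kernel component vanish. -/
lemma form_eigen_expansion {z : V} (hz : ∀ w, c z w = 0) (α : Fin K → ℝ) :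
    b (z + ∑ j, α j • p j) (z + ∑ j, α j • p j) = b z z + ∑ j, lam j * α j ^ 2 := by
  have h0 : ∀ j, b (p j) z = 0 := fun j => by rw [heig, hcs, hz, mul_zero]
  have h1 : ∀ j, b z (p j) = 0 := fun j => by rw [hbs, h0]
  simp only [map_add, LinearMap.add_apply, h0, h1, zero_add, add_zero, map_sum, map_smul,
    LinearMap.sum_apply, LinearMap.smul_apply, heig, horth, smul_eq_mul, mul_zero,
    Finset.sum_const_zero]
  congr 1
  refine Finset.sum_congr rfl fun j _ => ?_
  simp [sq]
  ring

end

variable [FiniteDimensional ℝ V]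

/-- The eigenvectors span a complement of the kernel of `c`. -/
lemma sub_sum_mem_ker
    (horth : ∀ j j', c (p j) (p j') = if j = j' then 1 else 0)
    (hnum : K + Module.finrank ℝ (LinearMap.ker c) = Module.finrank ℝ V) (v w : V) :
    c (v - ∑ j, c v (p j) • p j) w = 0 := by
  let L : V →ₗ[ℝ] (Fin K → ℝ) := LinearMap.pi fun j => c.flip (p j)
  have hL : ∀ v j, L v j = c v (p j) := fun v j => rfl
  have hsurj : Function.Surjective L := by
    intro α
    refine ⟨∑ j, α j • p j, ?_⟩
    ext j
    rw [hL, map_sum, LinearMap.sum_apply]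
    simp [horth]
  -- The coefficient map `L` is onto by orthonormality, so `hnum` gives its kernel the dimension of
  -- `ker c`; the inclusion is therefore an equality.
  have h1 : LinearMap.ker c ≤ LinearMap.ker L := by
    intro z hz
    rw [LinearMap.mem_ker] at hz ⊢
    ext j
    rw [hL, hz]
    rfl
  have h2 : Module.finrank ℝ (LinearMap.ker L) + K = Module.finrank ℝ V := by
    have := L.finrank_range_add_finrank_ker
    rw [LinearMap.range_eq_top.2 hsurj, finrank_top, Module.finrank_fin_fun] at this
    omega
  have h3 : LinearMap.ker c = LinearMap.ker L :=
    Submodule.eq_of_le_of_finrank_eq h1 (by omega)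
  have h4 : v - ∑ j, c v (p j) • p j ∈ LinearMap.ker c := by
    rw [h3, LinearMap.mem_ker]
    ext j
    rw [hL, map_sub, map_sum, LinearMap.sub_apply, LinearMap.sum_apply]
    simp [horth]
  rw [LinearMap.mem_ker.1 h4]
  rfl

/-- Properties of the projection error for the generalised eigenvalue problem. -/
lemma projection_error (hcs : ∀ x y, c x y = c y x) (hbs : ∀ x y, b x y = b y x)
    (horth : ∀ j j', c (p j) (p j') = if j = j' then 1 else 0)
    (heig : ∀ j v, b (p j) v = lam j * c (p j) v) (hmono : Monotone lam)
    (hnum : K + Module.finrank ℝ (LinearMap.ker c) = Module.finrank ℝ V)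
    (hker : ∀ z, (∀ w, c z w = 0) → 0 ≤ b z z)
    {X : ℝ} (hX0 : 0 ≤ X) (hX : ∀ j, -lam j ≤ X)
    {m : ℕ} (hm : m < K) (hpos : 0 < lam ⟨m, hm⟩) (v w : V)
    (hw : w = v - ∑ j : Fin K with j.val < m, c v (p j) • p j) :
    0 ≤ b w w ∧ b w w ≤ b v v + X * c v v ∧ lam ⟨m, hm⟩ * c w w ≤ b w w := by
  set z := v - ∑ j, c v (p j) • p j with hz
  have hz0 : ∀ w, c z w = 0 := sub_sum_mem_ker c horth hnum v
  have hv : v = z + ∑ j, c v (p j) • p j := by rw [hz]; abel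
  -- Coefficients of the projection error; its kernel component `z` is that of `v`.
  set β : Fin K → ℝ := fun j => if j.val < m then 0 else c v (p j) with hβ
  have hwz : w = z + ∑ j, β j • p j := by
    rw [hw, hz]
    have : ∑ j, c v (p j) • p j =
        ∑ j : Fin K with j.val < m, c v (p j) • p j + ∑ j, β j • p j := by
      rw [Finset.sum_filter, ← Finset.sum_add_distrib]
      refine Finset.sum_congr rfl fun j _ => ?_
      by_cases hj : j.val < m <;> simp [hβ, hj]
    rw [this]; abel
  have bv := form_eigen_expansion b c hcs horth hbs heig hz0 fun j => c v (p j)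
  have cv := form_orthonormal_expansion c hcs horth hz0 fun j => c v (p j)
  have bw := form_eigen_expansion b c hcs horth hbs heig hz0 β
  have cw := form_orthonormal_expansion c hcs horth hz0 β
  rw [← hv] at bv cv
  rw [← hwz] at bw cw
  have hbz := hker z hz0
  have hlow : ∀ j, lam ⟨m, hm⟩ * β j ^ 2 ≤ lam j * β j ^ 2 := by
    intro j
    by_cases hj : j.val < m
    · simp [hβ, hj]
    · exact mul_le_mul_of_nonneg_right (hmono (Fin.le_def.2 (not_lt.1 hj))) (sq_nonneg _)
  have h3 : lam ⟨m, hm⟩ * c w w ≤ b w w := by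
    rw [bw, cw, Finset.mul_sum]
    have := Finset.sum_le_sum fun j (_ : j ∈ Finset.univ) => hlow j
    linarith
  refine ⟨?_, ?_, h3⟩
  · refine le_trans (mul_nonneg hpos.le ?_) h3
    rw [cw]
    exact Finset.sum_nonneg fun j _ => sq_nonneg _
  · rw [bw, bv, cv, Finset.mul_sum, add_assoc, ← Finset.sum_add_distrib]
    gcongr with j
    by_cases hj : j.val < m
    -- A removed index loses the term `lam j` times a square, possibly negative; the bound `X` pays
    -- for it.
    · simp only [hβ, hj, if_true]
      have := mul_le_mul_of_nonneg_right (hX j) (sq_nonneg (c v (p j)))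
      linarith
    · simp only [hβ, hj, if_false]
      have := mul_nonneg hX0 (sq_nonneg (c v (p j)))
      linarith

end Spectral

/-! ### The concrete forms as bilinear maps -/

/-- The space of functions with square integrable values and gradients. -/
def niceSpace {d : ℕ} (D : Set (Pt d)) : Submodule ℝ (Pt d → ℝ) where
  carrier := {u | Nice D u}
  zero_mem' := ⟨ae_of_all _ fun x => differentiableAt_const (0 : ℝ), by
    have : gradient (0 : Pt d → ℝ) = 0 := gradient_fun_const' (F := Pt d) (0 : ℝ)
    rw [this]; exact MemLp.zero, MemLp.zero⟩
  add_mem' := fun hu hv => hu.add hv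
  smul_mem' := fun c _ hu => hu.smul c

namespace HkGenEO

variable {d : ℕ} {P : HkGenEO d} {D : Set (Pt d)} {amax nmin : ℝ}

lemma exists_aForm_linear (hP : P.CoeffBounds amax nmin)
    (hD : volume.restrict D ≤ volume.restrict P.Om) :
    ∃ B : niceSpace D →ₗ[ℝ] niceSpace D →ₗ[ℝ] ℝ, ∀ u v, B u v = P.aForm D u v :=
  ⟨LinearMap.mk₂ ℝ (fun u v => P.aForm D u v)
    (fun u v w => aForm_add_left hP hD u.2 v.2 w.2)
    (fun c u v => aForm_smul_left u.2 c)
    (fun u v w => by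
      rw [aForm_comm hP hD, aForm_comm hP hD (u := u), aForm_comm hP hD (u := u)]
      exact aForm_add_left hP hD v.2 w.2 u.2)
    (fun c u v => by
      rw [aForm_comm hP hD, aForm_comm hP hD (u := u)]
      exact aForm_smul_left v.2 c), fun _ _ => rfl⟩

lemma exists_nForm_linear (hP : P.CoeffBounds amax nmin)
    (hD : volume.restrict D ≤ volume.restrict P.Om) :
    ∃ B : niceSpace D →ₗ[ℝ] niceSpace D →ₗ[ℝ] ℝ, ∀ u v, B u v = P.nForm D u v :=
  ⟨LinearMap.mk₂ ℝ (fun u v => P.nForm D u v)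
    (fun u v w => nForm_add_left hP hD u.2 v.2 w.2)
    (fun c u v => nForm_smul_left c)
    (fun u v w => by
      rw [nForm_comm, nForm_comm (u := (u : Pt d → ℝ)), nForm_comm (u := (u : Pt d → ℝ))]
      exact nForm_add_left hP hD v.2 w.2 u.2)
    (fun c u v => by
      rw [nForm_comm, nForm_comm (u := (u : Pt d → ℝ))]
      exact nForm_smul_left c), fun _ _ => rfl⟩

lemma exists_energyForm_linear (hP : P.CoeffBounds amax nmin)
    (hD : volume.restrict D ≤ volume.restrict P.Om) :
    ∃ B : niceSpace D →ₗ[ℝ] niceSpace D →ₗ[ℝ] ℝ, ∀ u v, B u v = P.energyForm D u v := by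
  obtain ⟨a, ha⟩ := exists_aForm_linear hP hD
  obtain ⟨n, hn⟩ := exists_nForm_linear hP hD
  refine ⟨a + P.k ^ 2 • n, fun u v => ?_⟩
  rw [LinearMap.add_apply, LinearMap.add_apply, LinearMap.smul_apply, LinearMap.smul_apply, ha, hn]
  rfl

lemma exists_bForm_linear (hP : P.CoeffBounds amax nmin)
    (hD : volume.restrict D ≤ volume.restrict P.Om) :
    ∃ B : niceSpace D →ₗ[ℝ] niceSpace D →ₗ[ℝ] ℝ, ∀ u v, B u v = P.bForm D u v := by
  obtain ⟨a, ha⟩ := exists_aForm_linear hP hD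
  obtain ⟨n, hn⟩ := exists_nForm_linear hP hD
  refine ⟨a - P.k ^ 2 • n, fun u v => ?_⟩
  rw [LinearMap.sub_apply, LinearMap.sub_apply, LinearMap.smul_apply, LinearMap.smul_apply, ha, hn]
  rfl

section Basic

variable {u v : Pt d → ℝ} (hP : P.CoeffBounds amax nmin)
  (hD : volume.restrict D ≤ volume.restrict P.Om)

include hP hD

lemma energyForm_comm : P.energyForm D u v = P.energyForm D v u := by
  rw [energyForm, energyForm, aForm_comm hP hD, nForm_comm]

lemma bForm_comm : P.bForm D u v = P.bForm D v u := by
  rw [bForm, bForm, aForm_comm hP hD, nForm_comm]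

lemma aForm_nonneg (hu : Nice D u) : 0 ≤ P.aForm D u u :=
  gradSq_nonneg.trans (gradSq_le_aForm hP hD hu)

lemma nForm_nonneg (hu : Nice D u) : 0 ≤ P.nForm D u u :=
  (mul_nonneg hP.nmin_pos.le l2Sq_nonneg).trans (le_nForm hP hD hu)

lemma energyForm_nonneg (hu : Nice D u) : 0 ≤ P.energyForm D u u :=
  add_nonneg (aForm_nonneg hP hD hu) (mul_nonneg (sq_nonneg _) (nForm_nonneg hP hD hu))

lemma bForm_le_energyForm (hu : Nice D u) : P.bForm D u u ≤ P.energyForm D u u := by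
  have := mul_nonneg (sq_nonneg P.k) (nForm_nonneg hP hD hu)
  rw [bForm, energyForm]
  linarith

lemma k_sq_l2Sq_le (hu : Nice D u) : P.k ^ 2 * l2Sq D u ≤ nmin⁻¹ * P.energyForm D u u := by
  have h1 := mul_le_mul_of_nonneg_left (le_nForm hP hD hu) (sq_nonneg P.k)
  have h2 := aForm_nonneg hP hD hu
  have h3 := hP.nmin_pos
  rw [inv_mul_eq_div, le_div_iff₀ h3, energyForm]
  linarith

lemma energyNorm_sq (hu : Nice D u) : P.energyNorm D u ^ 2 = P.energyForm D u u :=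
  Real.sq_sqrt (energyForm_nonneg hP hD hu)

end Basic

/-- `Ω` has positive measure, so both almost-everywhere bounds hold together at some point; the test
vector there is constant 1. -/
lemma coeff_le (hP : P.CoeffBounds amax nmin) (hd : d ≠ 0) : 1 ≤ amax ∧ nmin ≤ 1 := by
  have hne : (ae (volume.restrict P.Om)).NeBot := by
    rw [ae_neBot, Ne, Measure.restrict_eq_zero]
    obtain ⟨T, hT⟩ := P.mesh.nonempty
    have h1 := (P.mesh.isCell hT).interior_nonempty
    exact (isOpen_openUnion _).measure_ne_zero volume
      (h1.mono (interior_hull_subset_openUnion hT))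
  obtain ⟨x, hA, hn⟩ := (hP.bounds_A.and hP.bounds_n).exists
  refine ⟨?_, hn.1.trans hn.2⟩
  have h := hA fun _ => 1
  have h2 := h.1.trans h.2
  have h3 : (fun _ : Fin d => (1 : ℝ)) ⬝ᵥ (fun _ => 1) = d := by simp [dotProduct]
  rw [h3] at h2
  have h4 : (0 : ℝ) < d := by exact_mod_cast Nat.pos_of_ne_zero hd
  nlinarith

lemma restrict_Omc_le {i : Fin P.N} (hsub : P.sub i ⊆ P.mesh.cells) :
    volume.restrict (P.Omc i) ≤ volume.restrict P.Om :=
  Measure.restrict_mono (openUnion_mono hsub) le_rfl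

lemma nice_Omc {i : Fin P.N} (hsub : P.sub i ⊆ P.mesh.cells) {u : Pt d → ℝ} (hu : u ∈ P.Vh) :
    Nice (P.Omc i) u := (nice_of_mem hu).mono (restrict_Omc_le hsub)

lemma finiteDimensional_Vh (hr : P.r ≠ 0) : FiniteDimensional ℝ P.Vh := by
  have hle : P.Vh ≤ Submodule.span ℝ (P.nodalBasis '' P.nodes) := by
    intro v hv
    rw [← P.nodal_expansion hr hv]
    exact Submodule.sum_mem _ fun l hl =>
      Submodule.smul_mem _ _ (Submodule.subset_span (mem_image_of_mem _ hl))
  have : FiniteDimensional ℝ (Submodule.span ℝ (P.nodalBasis '' P.nodes)) :=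
    FiniteDimensional.span_of_finite ℝ (P.nodes.finite_toSet.image _)
  exact Submodule.finiteDimensional_of_le hle

lemma finiteDimensional_Vt (hr : P.r ≠ 0) (i : Fin P.N) : FiniteDimensional ℝ (P.Vt i) := by
  have := finiteDimensional_Vh hr
  rw [Vt]
  infer_instance

end HkGenEO

/-! ### Local estimates: stability, coercivity, eigenvalue bounds -/

namespace HkGenEO

variable {d : ℕ} {P : HkGenEO d} {amax nmin Cinv : ℝ} {i : Fin P.N}

lemma gradSq_hull_le (hinv : P.InverseEstimate Cinv) {T : Finset (Pt d)} (hT : T ∈ P.mesh.cells)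
    {w : Pt d → ℝ} (hw : w ∈ P.Vh) :
    gradSq (simplexHull T) w ≤ Cinv ^ 2 * (P.k ^ 2 * l2Sq (simplexHull T) w) := by
  have h1 := pow_le_pow_left₀ (Real.sqrt_nonneg _) (hinv.2 T hT w hw) 2
  rw [Real.sq_sqrt gradSq_nonneg, mul_pow, Real.sq_sqrt l2Sq_nonneg] at h1
  linarith

lemma gradSq_Omc_le (hsub : P.sub i ⊆ P.mesh.cells) (hinv : P.InverseEstimate Cinv)
    {w : Pt d → ℝ} (hw : w ∈ P.Vh) :
    gradSq (P.Omc i) w ≤ Cinv ^ 2 * (P.k ^ 2 * l2Sq (P.Omc i) w) := by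
  have hn := nice_Omc hsub hw
  rw [Omc, gradSq_openUnion hsub hn, l2Sq_openUnion hsub hn, Finset.mul_sum, Finset.mul_sum]
  exact Finset.sum_le_sum fun T hT => gradSq_hull_le hinv (hsub hT) hw

/-- On the finite element space the energy is bounded by the `L²` norm. -/
lemma energyForm_le_l2Sq (hP : P.CoeffBounds amax nmin) (hamax : 0 ≤ amax)
    (hsub : P.sub i ⊆ P.mesh.cells)
    (hinv : P.InverseEstimate Cinv) {w : Pt d → ℝ} (hw : w ∈ P.Vh) :
    P.energyForm (P.Omc i) w w ≤ (amax * Cinv ^ 2 + 1) * (P.k ^ 2 * l2Sq (P.Omc i) w) := by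
  have hn := nice_Omc hsub hw
  have h1 := aForm_le_gradSq hP (restrict_Omc_le hsub) hn
  have h2 := mul_le_mul_of_nonneg_left (gradSq_Omc_le hsub hinv hw) hamax
  have h3 := mul_le_mul_of_nonneg_left (nForm_le hP (restrict_Omc_le hsub) hn) (sq_nonneg P.k)
  rw [energyForm]
  linarith

lemma l2Sq_Omc_le_of_hull (hsub : P.sub i ⊆ P.mesh.cells) {c : ℝ} {w u : Pt d → ℝ} (hw : w ∈ P.Vh)
    (hu : u ∈ P.Vh) (h : ∀ T ∈ P.sub i, l2Sq (simplexHull T) w ≤ c * l2Sq (simplexHull T) u) :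
    l2Sq (P.Omc i) w ≤ c * l2Sq (P.Omc i) u := by
  rw [Omc, l2Sq_openUnion hsub (nice_Omc hsub hw), l2Sq_openUnion hsub (nice_Omc hsub hu),
    Finset.mul_sum]
  exact Finset.sum_le_sum h

/-- The nodal interpolation which keeps only the interior nodal values of a subdomain. -/
def dofPart (P : HkGenEO d) (i : Fin P.N) (u : Pt d → ℝ) : Pt d → ℝ :=
  ∑ l ∈ P.dof (P.Omc i), u l • P.nodalBasis l

lemma dofPart_mem (hr : P.r ≠ 0) (u : Pt d → ℝ) : P.dofPart i u ∈ P.Vh :=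
  P.sum_nodalBasis_mem hr dof_subset _

open Classical in
lemma dofPart_node (hr : P.r ≠ 0) (u : Pt d → ℝ) {m : Pt d} (hm : m ∈ P.nodes) :
    P.dofPart i u m = if m ∈ P.dof (P.Omc i) then u m else 0 :=
  P.sum_nodalBasis_apply hr dof_subset u hm

lemma sub_dofPart_dof (hr : P.r ≠ 0) (u : Pt d → ℝ) {l : Pt d} (hl : l ∈ P.dof (P.Omc i)) :
    (u - P.dofPart i u) l = 0 := by
  classical
  rw [Pi.sub_apply, dofPart_node hr u (dof_subset hl), if_pos hl, sub_self]

section NodalBounds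

variable {CN : ℝ} (hr : P.r ≠ 0)
  (hCN : ∀ T ∈ P.mesh.cells, ∀ w ∈ P.Vh, ∀ u ∈ P.Vh, ∀ t : ℝ, 0 ≤ t →
      (∀ m ∈ P.nodes, m ∈ simplexHull T → |w m| ≤ t * |u m|) →
      l2Sq (simplexHull T) w ≤ CN * t ^ 2 * l2Sq (simplexHull T) u)
  (hsub : ∀ i, P.sub i ⊆ P.mesh.cells)

include hr hCN hsub

/-- The nodal weights `1 / mult` are at most 1: nodal domination with `t = 1`. -/
lemma l2Sq_xiExt_le {u : Pt d → ℝ} (hu : u ∈ P.Vh) :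
    l2Sq (P.Omc i) (P.xiExt i u) ≤ CN * l2Sq (P.Omc i) u := by
  classical
  refine l2Sq_Omc_le_of_hull (hsub i) (xiExt_mem hr u) hu fun T hT => ?_
  have := hCN T (hsub i hT) _ (xiExt_mem (i := i) hr u) u hu 1 zero_le_one fun m hm _ => by
    rw [xiExt_node hr u hm, one_mul]
    split_ifs with hmd
    · have h1 : (1 : ℝ) ≤ P.mult m := by exact_mod_cast one_le_mult hmd
      rw [abs_mul, abs_of_nonneg (by positivity)]
      refine mul_le_of_le_one_left (abs_nonneg _) ?_
      rw [div_le_one (by linarith)]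
      exact h1
    · rw [abs_zero]; exact abs_nonneg _
  simpa using this

/-- Undoing the weights costs at most `mult ≤ Λ_c` at each node: nodal domination with `t = Λ_c`. -/
lemma l2Sq_dofPart_le {u : Pt d → ℝ} :
    l2Sq (P.Omc i) (P.dofPart i u) ≤
      CN * (P.overlapC : ℝ) ^ 2 * l2Sq (P.Omc i) (P.xiExt i u) := by
  classical
  refine l2Sq_Omc_le_of_hull (hsub i) (dofPart_mem hr u) (xiExt_mem hr u) fun T hT => ?_
  refine hCN T (hsub i hT) _ (dofPart_mem hr u) _ (xiExt_mem hr u) _ (Nat.cast_nonneg _)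
    fun m hm _ => ?_
  rw [xiExt_node hr u hm, dofPart_node hr u hm]
  split_ifs with hmd
  · have h1 : (0 : ℝ) < P.mult m := by exact_mod_cast one_le_mult hmd
    have h2 : (P.mult m : ℝ) ≤ P.overlapC := by exact_mod_cast mult_le_overlapC hr hsub hm
    rw [abs_mul, abs_of_nonneg (a := 1 / (P.mult m : ℝ)) (by positivity), ← mul_assoc]
    refine le_mul_of_one_le_left (abs_nonneg _) ?_
    rw [mul_one_div, one_le_div h1]
    exact h2
  · simp

end NodalBounds

section Restriction

variable (P i) in
lemma exists_restrictTo {v : P.Omc i → ℝ} (hv : v ∈ P.Vt i) :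
    ∃ u ∈ P.Vh, restrictTo (P.Omc i) u = v := hv

lemma bi_restrictTo (u v : Pt d → ℝ) :
    P.bi i (restrictTo (P.Omc i) u) (restrictTo (P.Omc i) v) = P.bForm (P.Omc i) u v :=
  (bForm_congr (isOpen_openUnion _) (eqOn_zeroExt_restrictTo u) (eqOn_zeroExt_restrictTo v)).symm

lemma ci_restrictTo (hr : P.r ≠ 0) (hsub : P.sub i ⊆ P.mesh.cells) (u v : Pt d → ℝ) :
    P.ci i (restrictTo (P.Omc i) u) (restrictTo (P.Omc i) v) =
      P.energyForm (P.Omc i) (P.xiExt i u) (P.xiExt i v) := by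
  rw [ci, zeroExt_Xi_restrictTo hr hsub, zeroExt_Xi_restrictTo hr hsub]

lemma energyForm_zeroExt_restrictTo (u : Pt d → ℝ) :
    P.energyForm (P.Omc i) (zeroExt (restrictTo (P.Omc i) u))
      (zeroExt (restrictTo (P.Omc i) u)) = P.energyForm (P.Omc i) u u :=
  (energyForm_congr (isOpen_openUnion _) (eqOn_zeroExt_restrictTo u)
    (eqOn_zeroExt_restrictTo u)).symm

lemma nice_zeroExt (hsub : P.sub i ⊆ P.mesh.cells) {v : P.Omc i → ℝ} (hv : v ∈ P.Vt i) :
    Nice (P.Omc i) (zeroExt v) := by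
  obtain ⟨u, hu, rfl⟩ := P.exists_restrictTo i hv
  exact (nice_Omc hsub hu).congr (isOpen_openUnion _) (eqOn_zeroExt_restrictTo u)

lemma nice_zeroExt_Xi (hr : P.r ≠ 0) (hsub : P.sub i ⊆ P.mesh.cells) {v : P.Omc i → ℝ}
    (hv : v ∈ P.Vt i) : Nice (P.Omc i) (zeroExt (P.Xi i v)) := by
  obtain ⟨u, hu, rfl⟩ := P.exists_restrictTo i hv
  rw [zeroExt_Xi_restrictTo hr hsub]
  exact nice_Omc hsub (xiExt_mem hr u)

lemma exists_bi_linear (hP : P.CoeffBounds amax nmin) (hsub : P.sub i ⊆ P.mesh.cells) :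
    ∃ b : P.Vt i →ₗ[ℝ] P.Vt i →ₗ[ℝ] ℝ, ∀ u v, b u v = P.bi i u v := by
  obtain ⟨B, hB⟩ := exists_bForm_linear hP (restrict_Omc_le hsub)
  let ζ : P.Vt i →ₗ[ℝ] niceSpace (P.Omc i) :=
    { toFun := fun v => ⟨zeroExt v.1, nice_zeroExt hsub v.2⟩
      map_add' := fun u v => Subtype.ext (zeroExt_add u.1 v.1)
      map_smul' := fun c v => Subtype.ext (zeroExt_smul c v.1) }
  exact ⟨B.compl₁₂ ζ ζ, fun u v => hB _ _⟩

lemma exists_ci_linear (hr : P.r ≠ 0) (hP : P.CoeffBounds amax nmin)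
    (hsub : P.sub i ⊆ P.mesh.cells) :
    ∃ c : P.Vt i →ₗ[ℝ] P.Vt i →ₗ[ℝ] ℝ, ∀ u v, c u v = P.ci i u v := by
  obtain ⟨B, hB⟩ := exists_energyForm_linear hP (restrict_Omc_le hsub)
  let ζ : P.Vt i →ₗ[ℝ] niceSpace (P.Omc i) :=
    { toFun := fun v => ⟨zeroExt (P.Xi i v.1), nice_zeroExt_Xi hr hsub v.2⟩
      map_add' := fun u v => Subtype.ext (by
        change zeroExt (P.Xi i (u.1 + v.1)) = _
        rw [Xi_add, zeroExt_add]; rfl)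
      map_smul' := fun c v => Subtype.ext (by
        change zeroExt (P.Xi i (c • v.1)) = _
        rw [Xi_smul, zeroExt_smul]; rfl) }
  exact ⟨B.compl₁₂ ζ ζ, fun u v => hB _ _⟩

/-- `Set.finrank` refers to the span, but the set is already the image of a submodule of `Ṽ_i`. -/
lemma finrank_kerC (c : P.Vt i →ₗ[ℝ] P.Vt i →ₗ[ℝ] ℝ) (hc : ∀ u v, c u v = P.ci i u v) :
    Set.finrank ℝ (P.kerC i) = Module.finrank ℝ (LinearMap.ker c) := by
  have h : P.kerC i = ((LinearMap.ker c).map (P.Vt i).subtype : Set (P.Omc i → ℝ)) := by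
    ext v
    constructor
    · rintro ⟨hv, hv'⟩
      refine ⟨⟨v, hv⟩, ?_, rfl⟩
      ext w
      rw [hc]
      exact hv' w w.2
    · rintro ⟨w, hw, rfl⟩
      refine ⟨w.2, fun w' hw' => ?_⟩
      have := hc w ⟨w', hw'⟩
      rw [LinearMap.mem_ker.1 hw] at this
      exact this.symm
  rw [Set.finrank, h, Submodule.span_eq, Submodule.finrank_map_subtype_eq]

end Restriction

lemma eqOn_zero_of_l2Sq {D : Set (Pt d)} (hD : IsOpen D) {w : Pt d → ℝ} (hw : Continuous w)
    (hn : Nice D w) (h0 : l2Sq D w = 0) : EqOn w 0 D := by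
  have h1 := (setIntegral_eq_zero_iff_of_nonneg_ae (ae_of_all _ fun x => sq_nonneg _)
    hn.integrable_sq).1 h0
  have h3 := Measure.eqOn_open_of_ae_eq h1 hD (hw.pow 2).continuousOn continuousOn_const
  intro x hx
  simpa using h3 hx

/-- Elements of `ker c_i` vanish at the interior nodes. -/
lemma exists_of_mem_kerC (hr : P.r ≠ 0) (hk : 0 < P.k) (hP : P.CoeffBounds amax nmin)
    (hsub : P.sub i ⊆ P.mesh.cells) {v : P.Omc i → ℝ} (hv : v ∈ P.kerC i) :
    ∃ u ∈ P.Vh, restrictTo (P.Omc i) u = v ∧ ∀ l ∈ P.dof (P.Omc i), u l = 0 := by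
  obtain ⟨u, hu, rfl⟩ := P.exists_restrictTo i hv.1
  refine ⟨u, hu, rfl, ?_⟩
  rw [← xiExt_eq_zero_iff hr]
  -- Testing the kernel condition with `v` itself gives `Ξ_i v` zero energy, and `k > 0`, `nmin > 0`
  -- make its `L²` norm zero.
  have h0 := hv.2 _ hv.1
  rw [ci_restrictTo hr hsub] at h0
  have hx := xiExt_mem (i := i) hr u
  have h1 := k_sq_l2Sq_le hP (restrict_Omc_le hsub) (nice_Omc hsub hx)
  rw [h0, mul_zero] at h1
  have h2 : l2Sq (P.Omc i) (P.xiExt i u) = 0 := by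
    have : (0 : ℝ) < P.k ^ 2 := by positivity
    exact le_antisymm (nonpos_of_mul_nonpos_right h1 this) l2Sq_nonneg
  have h3 := eqOn_zero_of_l2Sq (isOpen_openUnion _) (P.continuous_of_mem hx) (nice_Omc hsub hx) h2
  ext x
  by_cases hxD : x ∈ P.Omc i
  · exact h3 hxD
  · exact xiExt_eq_zero hr hsub u hxD

section Coercivity

variable {CP : ℝ} (hCP : 0 < CP)
  (hpoin : ∀ i, ∀ u ∈ P.Vh, (∀ l ∈ P.dof (P.Omc i), u l = 0) →
      l2Sq (P.Omc i) u ≤ CP * P.mesh.size ^ 2 * gradSq (P.Omc i) u)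
  (hkh : (P.k * P.mesh.size) ^ 2 ≤ 1 / (2 * CP)) (hP : P.CoeffBounds amax nmin)
  (hsub : ∀ i, P.sub i ⊆ P.mesh.cells)

include hCP hpoin hkh hP hsub

/-- The Poincaré inequality bounds the mass term by `CP (kh)²` times the gradient term, and `hkh`
makes that factor at most 1/2. -/
lemma nForm_le_aForm {z : Pt d → ℝ} (hz : z ∈ P.Vh) (h0 : ∀ l ∈ P.dof (P.Omc i), z l = 0) :
    P.k ^ 2 * P.nForm (P.Omc i) z z ≤ P.aForm (P.Omc i) z z / 2 := by
  have hn := nice_Omc (hsub i) hz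
  have h1 := mul_le_mul_of_nonneg_left (nForm_le hP (restrict_Omc_le (hsub i)) hn) (sq_nonneg P.k)
  have h2 := mul_le_mul_of_nonneg_left (hpoin i z hz h0) (sq_nonneg P.k)
  have h3 := gradSq_le_aForm hP (restrict_Omc_le (hsub i)) hn
  have h4 := mul_le_mul_of_nonneg_right (mul_le_mul_of_nonneg_left hkh hCP.le)
    (gradSq_nonneg (D := P.Omc i) (u := z))
  have h5 : CP * (1 / (2 * CP)) = 1 / 2 := by field_simp
  rw [h5] at h4
  have h6 : P.k ^ 2 * (CP * P.mesh.size ^ 2 * gradSq (P.Omc i) z) =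
      CP * (P.k * P.mesh.size) ^ 2 * gradSq (P.Omc i) z := by ring
  linarith

/-- Half of the gradient term survives the subtraction; applying Poincaré to it gives the constant
`1 / (2 CP)`. -/
lemma coercive_kerC (hd : d ≠ 0) (hr : P.r ≠ 0) (hk : 0 < P.k) {v : P.Omc i → ℝ}
    (hv : v ∈ P.kerC i) :
    1 / (2 * CP) * (P.mesh.size ^ 2)⁻¹ * l2Sq (P.Omc i) (zeroExt v) ≤ P.bi i v v := by
  obtain ⟨z, hz, rfl, h0⟩ := exists_of_mem_kerC hr hk hP (hsub i) hv
  rw [bi_restrictTo, ← l2Sq_congr (D := P.Omc i) (isOpen_openUnion _) (eqOn_zeroExt_restrictTo z)]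
  have h1 := nForm_le_aForm hCP hpoin hkh hP hsub hz h0
  have h2 := hpoin i z hz h0
  have h3 := gradSq_le_aForm hP (restrict_Omc_le (hsub i)) (nice_Omc (hsub i) hz)
  have hs := P.size_pos hd
  have h4 : 1 / (2 * CP) * (P.mesh.size ^ 2)⁻¹ * l2Sq (P.Omc i) z ≤ gradSq (P.Omc i) z / 2 := by
    have : 0 ≤ 1 / (2 * CP) * (P.mesh.size ^ 2)⁻¹ := by positivity
    refine (mul_le_mul_of_nonneg_left h2 this).trans (le_of_eq ?_)
    field_simp
  rw [bForm]
  linarith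

lemma bi_nonneg_kerC (hd : d ≠ 0) (hr : P.r ≠ 0) (hk : 0 < P.k) {v : P.Omc i → ℝ}
    (hv : v ∈ P.kerC i) : 0 ≤ P.bi i v v := by
  refine le_trans ?_ (coercive_kerC hCP hpoin hkh hP hsub hd hr hk hv)
  have := l2Sq_nonneg (D := P.Omc i) (u := zeroExt v)
  positivity

/-- Lower bound for the eigenvalues. -/
lemma neg_eigenvalue_le (hr : P.r ≠ 0) (hinv : P.InverseEstimate Cinv) (hamax : 0 ≤ amax) {CN : ℝ}
    (hCN0 : 0 ≤ CN)
    (hCN : ∀ T ∈ P.mesh.cells, ∀ w ∈ P.Vh, ∀ u ∈ P.Vh, ∀ t : ℝ, 0 ≤ t →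
      (∀ m ∈ P.nodes, m ∈ simplexHull T → |w m| ≤ t * |u m|) →
      l2Sq (simplexHull T) w ≤ CN * t ^ 2 * l2Sq (simplexHull T) u)
    {lam : ℝ} {p : P.Omc i → ℝ} (hp : p ∈ P.Vt i) (hpp : P.ci i p p = 1)
    (heig : ∀ v ∈ P.Vt i, P.bi i p v = lam * P.ci i p v) :
    -lam ≤ 4 * ((amax * Cinv ^ 2 + 1) * (CN * (P.overlapC : ℝ) ^ 2 * nmin⁻¹)) := by
  obtain ⟨u, hu, rfl⟩ := P.exists_restrictTo i hp
  have hD := restrict_Omc_le (hsub i)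
  obtain ⟨a, ha⟩ := exists_aForm_linear hP hD
  obtain ⟨n, hn⟩ := exists_nForm_linear hP hD
  have hqV := dofPart_mem (i := i) hr u
  have hzV : u - P.dofPart i u ∈ P.Vh := Submodule.sub_mem _ hu hqV
  have hz0 : ∀ l ∈ P.dof (P.Omc i), (u - P.dofPart i u) l = 0 := fun l hl => sub_dofPart_dof hr u hl
  let q : niceSpace (P.Omc i) := ⟨P.dofPart i u, nice_Omc (hsub i) hqV⟩
  let z : niceSpace (P.Omc i) := ⟨u - P.dofPart i u, nice_Omc (hsub i) hzV⟩
  have hqz : ((q + z : niceSpace (P.Omc i)) : Pt d → ℝ) = u := by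
    change P.dofPart i u + (u - P.dofPart i u) = u
    abel
  -- The interior nodal values of `z` vanish, so `Ξ_i z = 0` and the eigenvalue equation tested with
  -- `z` has right-hand side zero.
  have hort : a (q + z) z - P.k ^ 2 * n (q + z) z = 0 := by
    have h1 := heig _ (Submodule.mem_map_of_mem hzV)
    rw [bi_restrictTo, ci_restrictTo hr (hsub i), (xiExt_eq_zero_iff hr _).2 hz0] at h1
    have h2 : P.energyForm (P.Omc i) (P.xiExt i u) 0 = 0 := by
      rw [energyForm_comm hP hD]
      have := aForm_smul_left (P := P) (u := (0 : Pt d → ℝ)) (v := P.xiExt i u)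
        (niceSpace (P.Omc i)).zero_mem 0
      have h3 := nForm_smul_left (P := P) (D := P.Omc i) (u := (0 : Pt d → ℝ))
        (v := P.xiExt i u) 0
      rw [zero_smul, zero_mul] at this h3
      rw [energyForm, this, h3]
      ring
    rw [h2, mul_zero] at h1
    rw [ha, hn, hqz]
    exact h1
  have key := neg_form_le a n (fun x y => by rw [ha, ha, aForm_comm hP hD])
    (fun x y => by rw [hn, hn, nForm_comm])
    (fun x => by rw [ha]; exact aForm_nonneg hP hD x.2)
    (fun x => by rw [hn]; exact nForm_nonneg hP hD x.2) (sq_nonneg P.k) q z hort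
    (by rw [ha, hn]; exact nForm_le_aForm hCP hpoin hkh hP hsub hzV hz0)
  rw [ha, hn, ha, hn, hqz] at key
  have hlam : lam = P.bForm (P.Omc i) u u := by
    have := heig _ hp
    rw [hpp, mul_one, bi_restrictTo] at this
    exact this.symm
  rw [ci_restrictTo hr (hsub i)] at hpp
  have e1 := energyForm_le_l2Sq hP hamax (hsub i) hinv hqV
  have e2 := l2Sq_dofPart_le (i := i) hr hCN hsub (u := u)
  have e3 := k_sq_l2Sq_le hP hD (nice_Omc (hsub i) (xiExt_mem (i := i) hr u))
  rw [hpp, mul_one] at e3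
  rw [hlam]
  -- Energy of `q`, then its `L²` norm (inverse estimate), then that of `Ξ_i p` (nodal domination),
  -- then `c_i(p, p) = 1`.
  refine key.trans (mul_le_mul_of_nonneg_left (e1.trans ?_) (by norm_num))
  refine mul_le_mul_of_nonneg_left ?_ (by positivity)
  calc P.k ^ 2 * l2Sq (P.Omc i) (P.dofPart i u)
      ≤ P.k ^ 2 * (CN * (P.overlapC : ℝ) ^ 2 * l2Sq (P.Omc i) (P.xiExt i u)) :=
        mul_le_mul_of_nonneg_left e2 (sq_nonneg _)
    _ = CN * (P.overlapC : ℝ) ^ 2 * (P.k ^ 2 * l2Sq (P.Omc i) (P.xiExt i u)) := by ring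
    _ ≤ _ := mul_le_mul_of_nonneg_left e3 (by positivity)

end Coercivity

/-- `Ξ_i` is stable in the energy norm on the finite element space. -/
lemma ci_le (hr : P.r ≠ 0) (hinv : P.InverseEstimate Cinv) (hP : P.CoeffBounds amax nmin)
    (hamax : 0 ≤ amax) (hsub : ∀ i, P.sub i ⊆ P.mesh.cells) {CN : ℝ} (hCN0 : 0 ≤ CN)
    (hCN : ∀ T ∈ P.mesh.cells, ∀ w ∈ P.Vh, ∀ u ∈ P.Vh, ∀ t : ℝ, 0 ≤ t →
      (∀ m ∈ P.nodes, m ∈ simplexHull T → |w m| ≤ t * |u m|) →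
      l2Sq (simplexHull T) w ≤ CN * t ^ 2 * l2Sq (simplexHull T) u)
    {u : Pt d → ℝ} (hu : u ∈ P.Vh) :
    P.energyForm (P.Omc i) (P.xiExt i u) (P.xiExt i u) ≤
      (amax * Cinv ^ 2 + 1) * (CN * nmin⁻¹) * P.energyForm (P.Omc i) u u := by
  have e1 := energyForm_le_l2Sq (i := i) hP hamax (hsub i) hinv (xiExt_mem (i := i) hr u)
  have e2 := l2Sq_xiExt_le (i := i) hr hCN hsub hu
  have e3 := k_sq_l2Sq_le hP (restrict_Omc_le (hsub i)) (nice_Omc (hsub i) hu)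
  rw [mul_assoc]
  refine e1.trans (mul_le_mul_of_nonneg_left ?_ (by positivity))
  calc P.k ^ 2 * l2Sq (P.Omc i) (P.xiExt i u)
      ≤ P.k ^ 2 * (CN * l2Sq (P.Omc i) u) := mul_le_mul_of_nonneg_left e2 (sq_nonneg _)
    _ = CN * (P.k ^ 2 * l2Sq (P.Omc i) u) := by ring
    _ ≤ CN * (nmin⁻¹ * P.energyForm (P.Omc i) u u) := mul_le_mul_of_nonneg_left e3 hCN0
    _ = _ := by ring

lemma one_le_overlapC (hcov : P.IsCover) : 1 ≤ P.overlapC := by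
  classical
  obtain ⟨T, hT⟩ := P.mesh.nonempty
  obtain ⟨x, hx⟩ := (P.mesh.isCell hT).interior_nonempty
  have hxO : x ∈ P.Om := interior_hull_subset_openUnion hT hx
  rw [hcov.2] at hxO
  obtain ⟨i, hi⟩ := mem_iUnion.1 hxO
  obtain ⟨S, hS, -⟩ := exists_cell_of_mem_openUnion hi
  refine le_trans ?_ (card_sub_le_overlapC (hcov.1 i hS))
  exact Finset.card_pos.2 ⟨i, Finset.mem_filter.2 ⟨Finset.mem_univ _, hS⟩⟩

/-- Functions supported in the subdomains can be compared pointwise only inside a cell, since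
neighbouring cells share its boundary. -/
lemma energyForm_interior (T : Finset (Pt d)) (u v : Pt d → ℝ) :
    P.energyForm (simplexHull T) u v = P.energyForm (interior (simplexHull T)) u v := by
  have : (interior (simplexHull T) : Set (Pt d)) =ᵐ[volume] simplexHull T :=
    interior_ae_eq_of_null_frontier ((convex_simplexHull T).addHaar_frontier volume)
  rw [energyForm, energyForm, aForm, aForm, nForm, nForm, Measure.restrict_congr_set this]

/-! ### Finite overlap -/

section Global

variable (hP : P.CoeffBounds amax nmin) (hsub : ∀ i, P.sub i ⊆ P.mesh.cells)

include hP hsub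

/-- Finite overlap: local energies add up to at most `Λ_c` times the global one. -/
lemma sum_energyForm_le {u : Pt d → ℝ} (hu : u ∈ P.Vh) :
    ∑ i, P.energyForm (P.Omc i) u u ≤ P.overlapC * P.energyForm P.Om u u := by
  classical
  have hn := nice_of_mem hu
  have h1 : ∀ i, P.energyForm (P.Omc i) u u =
      ∑ T ∈ P.mesh.cells, if T ∈ P.sub i then P.energyForm (simplexHull T) u u else 0 := by
    intro i
    rw [Omc, energyForm_openUnion (hsub i) hP (nice_Omc (hsub i) hu) (nice_Omc (hsub i) hu),
      ← Finset.sum_filter, Finset.filter_mem_eq_inter, Finset.inter_eq_right.2 (hsub i)]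
  rw [Finset.sum_congr rfl fun i _ => h1 i, Finset.sum_comm, Om,
    energyForm_openUnion subset_rfl hP hn hn, Finset.mul_sum]
  refine Finset.sum_le_sum fun T hT => ?_
  rw [← Finset.sum_filter, Finset.sum_const, nsmul_eq_mul]
  refine mul_le_mul_of_nonneg_right ?_
    (energyForm_nonneg hP (restrict_hull_le hT) (hn.mono (restrict_hull_le hT)))
  exact_mod_cast card_sub_le_overlapC hT

/-- Finite overlap: the energy of a sum of functions supported in the subdomains. -/
lemma energyForm_sum_le {g : Fin P.N → Pt d → ℝ} (hg : ∀ i, g i ∈ P.Vh)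
    (h0 : ∀ i, ∀ x ∉ P.Omc i, g i x = 0) :
    P.energyForm P.Om (∑ i, g i) (∑ i, g i) ≤
      P.overlapC * ∑ i, P.energyForm (P.Omc i) (g i) (g i) := by
  classical
  have hsum : ∑ i, g i ∈ P.Vh := Submodule.sum_mem _ fun i _ => hg i
  have hn := nice_of_mem hsum
  have h1 : ∀ i, P.energyForm (P.Omc i) (g i) (g i) =
      ∑ T ∈ P.mesh.cells, if T ∈ P.sub i then P.energyForm (simplexHull T) (g i) (g i) else 0 := by
    intro i
    rw [Omc, energyForm_openUnion (hsub i) hP (nice_Omc (hsub i) (hg i))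
      (nice_Omc (hsub i) (hg i)),
      ← Finset.sum_filter, Finset.filter_mem_eq_inter, Finset.inter_eq_right.2 (hsub i)]
  rw [Finset.sum_congr rfl fun i _ => h1 i, Finset.sum_comm, Om,
    energyForm_openUnion subset_rfl hP hn hn, Finset.mul_sum]
  refine Finset.sum_le_sum fun T hT => ?_
  rw [← Finset.sum_filter]
  set I := Finset.univ.filter fun i : Fin P.N => T ∈ P.sub i with hI
  have hD : volume.restrict (simplexHull T) ≤ volume.restrict P.Om := restrict_hull_le hT
  obtain ⟨B, hB⟩ := exists_energyForm_linear hP hD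
  let G : Fin P.N → niceSpace (simplexHull T) := fun i => ⟨g i, (nice_of_mem (hg i)).mono hD⟩
  have hGsum : ((∑ i ∈ I, G i : niceSpace (simplexHull T)) : Pt d → ℝ) = ∑ i ∈ I, g i := by
    rw [Submodule.coe_sum]
  -- Inside `T` only the functions whose subdomain contains `T` survive, so Cauchy–Schwarz costs at
  -- most the factor Λ_c.
  have heq : EqOn (∑ i, g i) (∑ i ∈ I, g i) (interior (simplexHull T)) := by
    intro x hx
    rw [Finset.sum_apply, Finset.sum_apply, hI, Finset.sum_filter]
    refine Finset.sum_congr rfl fun i _ => ?_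
    split_ifs with hTi
    · rfl
    · refine h0 i x fun hxi => hTi ?_
      obtain ⟨S, hS, hxS⟩ := exists_cell_of_mem_openUnion hxi
      rwa [P.mesh.eq_of_mem_interior hT (hsub i hS) hx hxS]
  rw [energyForm_interior, energyForm_congr isOpen_interior heq heq,
    ← energyForm_interior, ← hGsum, ← hB]
  have hnn : ∀ x, 0 ≤ B x x := fun x => by rw [hB]; exact energyForm_nonneg hP hD x.2
  refine (form_sum_le B (fun x y => by rw [hB, hB, energyForm_comm hP hD]) hnn I G).trans ?_
  have h2 : (I.card : ℝ) ≤ P.overlapC := by exact_mod_cast card_sub_le_overlapC hT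
  refine (mul_le_mul_of_nonneg_right h2 (Finset.sum_nonneg fun i _ => hnn _)).trans (le_of_eq ?_)
  congr 1
  exact Finset.sum_congr rfl fun i _ => hB _ _

end Global

variable (P i) in
/-- The map `v ↦ E_i Ξ_i v`. -/
def xiLin : (P.Omc i → ℝ) →ₗ[ℝ] (Pt d → ℝ) where
  toFun v := zeroExt (P.Xi i v)
  map_add' u v := by rw [Xi_add, zeroExt_add]
  map_smul' c v := by rw [Xi_smul, zeroExt_smul]; rfl

lemma z0_mem {K : Fin P.N → ℕ} (p : ∀ i, Fin (K i) → P.Omc i → ℝ) (m : Fin P.N → ℕ)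
    (v : Pt d → ℝ) : P.z0 p m v ∈ P.V0 p m := by
  refine Submodule.sum_mem _ fun i _ => ?_
  change P.xiLin i (P.proj i (p i) (m i) _) ∈ _
  rw [proj, map_sum]
  refine Submodule.sum_mem _ fun j hj => ?_
  rw [map_smul]
  exact Submodule.smul_mem _ _ (Submodule.subset_span ⟨i, j, (Finset.mem_filter.1 hj).2, rfl⟩)

end HkGenEO

/-! ### The approximation theorem -/

open HkGenEO in
theorem lemma3p9 (d r M : ℕ) (hd : d = 2 ∨ d = 3) (hr : 1 ≤ r) (CSR : ℝ) (hCSR : 0 < CSR) :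
    ∃ C₁ : ℝ, 0 < C₁ ∧ ∃ C₂ : ℝ, 0 < C₂ ∧
      ∀ (P : HkGenEO d) (amax nmin Cinv : ℝ),
        P.r = r → 0 < P.k → P.CoeffBounds amax nmin → P.ShapeRegular CSR →
        P.InverseEstimate Cinv → P.IsCover → P.InteriorReach M →
        (P.k * P.mesh.size) ^ 2 ≤ C₁ →
        -- the property by which `C₁` is chosen: coercivity of `b_i` on `ker c_i`
        (∀ i, ∀ v ∈ P.kerC i,
          C₁ * (P.mesh.size ^ 2)⁻¹ * l2Sq (P.Omc i) (zeroExt v) ≤ P.bi i v v) ∧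
        ∀ (K : Fin P.N → ℕ) (lam : ∀ i, Fin (K i) → ℝ) (p : ∀ i, Fin (K i) → P.Omc i → ℝ)
          (m : Fin P.N → ℕ) (hm : ∀ i, m i < K i),
          (∀ i, P.IsEigensystem i (lam i) (p i)) →
          (∀ i, 1 ≤ m i) → (∀ i, 0 < lam i ⟨m i, hm i⟩) →
          -- the property by which `C₂` is chosen: stability of the local projection errors
          (∀ i, ∀ v ∈ P.Vt i,
            0 ≤ P.bi i (v - P.proj i (p i) (m i) v) (v - P.proj i (p i) (m i) v) ∧
            P.bi i (v - P.proj i (p i) (m i) v) (v - P.proj i (p i) (m i) v) ≤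
              C₂ ^ 2 * amax * nmin⁻¹ * P.Cstar amax nmin Cinv *
                P.energyNorm (P.Omc i) (zeroExt v) ^ 2) ∧
          -- the global approximation property
          ∀ v ∈ P.Vh,
            P.z0 p m v ∈ P.V0 p m ∧
            (⨅ z : P.V0 p m, P.energyNorm P.Om (v - z) ^ 2) ≤
              P.energyNorm P.Om (v - P.z0 p m v) ^ 2 ∧
            P.energyNorm P.Om (v - P.z0 p m v) ^ 2 ≤
              C₂ ^ 2 * (P.overlapC : ℝ) ^ 2 * amax * nmin⁻¹ * P.Cstar amax nmin Cinv *
                P.Theta lam m hm * P.energyNorm P.Om v ^ 2 := by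
  have hd0 : d ≠ 0 := by omega
  have hr0 : r ≠ 0 := by omega
  obtain ⟨CP, hCP, hpoin⟩ := exists_poincare d r M hd0 hr0 hCSR
  obtain ⟨CN, hCN1, hCN⟩ := exists_l2Sq_le d r hr0
  have hCN0 : 0 ≤ CN := zero_le_one.trans hCN1
  -- `C₁` makes the mass term at most half the gradient term on `ker c_i`. The 9 in `C₂ ^ 2` leaves
  -- room for the sum `1 + 4 W` below.
  refine ⟨1 / (2 * CP), by positivity, 3 * CN, by positivity, ?_⟩
  intro P amax nmin Cinv hPr hk hP hSR hinv hcov hreach hkh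
  have hrP : P.r ≠ 0 := hPr ▸ hr0
  have hsub := hcov.1
  have hpoinP := hpoin P hPr hSR hsub hreach
  have hCNP := hCN P hPr
  obtain ⟨hamax1, hnmin1⟩ := coeff_le hP hd0
  have hamax0 : 0 ≤ amax := zero_le_one.trans hamax1
  have hnmin := hP.nmin_pos
  refine ⟨fun i v hv => coercive_kerC hCP hpoinP hkh hP hsub hd0 hrP hk hv, ?_⟩
  intro K lam p m hm hsys _ hpos
  have hΛ : (1 : ℝ) ≤ P.overlapC := by exact_mod_cast one_le_overlapC hcov
  set G := amax * Cinv ^ 2 + 1 with hG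
  set X := 4 * (G * (CN * (P.overlapC : ℝ) ^ 2 * nmin⁻¹)) with hX
  have hG1 : 1 ≤ G := by rw [hG]; nlinarith [sq_nonneg Cinv]
  have hninv : 1 ≤ nmin⁻¹ := (one_le_inv₀ hnmin).2 hnmin1
  have hX0 : 0 ≤ X := by positivity
  set Y := (3 * CN) ^ 2 * amax * nmin⁻¹ * P.Cstar amax nmin Cinv with hY
  have hconst : 1 + X * (G * (CN * nmin⁻¹)) ≤ Y := by
    have hC1 : 1 ≤ Cinv ^ 2 := one_le_pow₀ hinv.1
    set L := (P.overlapC : ℝ) ^ 2 with hL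
    have hL1 : 1 ≤ L := one_le_pow₀ hΛ
    -- All factors of `W` are at least 1, so `1 + 4 W ≤ 9 W`; the passage to `Cstar` uses `G ≤ G +
    -- 1` and `1 ≤ amax * Cinv ^ 2`.
    set W := CN ^ 2 * G ^ 2 * L * nmin⁻¹ ^ 2 with hW
    have hW1 : 1 ≤ W := by
      have h1 : 1 ≤ CN ^ 2 := one_le_pow₀ hCN1
      have h2 : 1 ≤ G ^ 2 := one_le_pow₀ hG1
      have h3 : 1 ≤ nmin⁻¹ ^ 2 := one_le_pow₀ hninv
      exact one_le_mul_of_one_le_of_one_le (one_le_mul_of_one_le_of_one_le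
        (one_le_mul_of_one_le_of_one_le h1 h2) hL1) h3
    have h4 : X * (G * (CN * nmin⁻¹)) = 4 * W := by rw [hX, hW]; ring
    have h5 : Y = 9 * (CN ^ 2 * (G + 1) ^ 2 * L * nmin⁻¹ ^ 2) * (amax * Cinv ^ 2) := by
      rw [hY, Cstar, hG]; ring
    have h6 : W ≤ CN ^ 2 * (G + 1) ^ 2 * L * nmin⁻¹ ^ 2 := by
      rw [hW]; gcongr; linarith
    have h7 : 1 ≤ amax * Cinv ^ 2 := one_le_mul_of_one_le_of_one_le hamax1 hC1
    rw [h4, h5]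
    have h8 : 9 * W ≤ 9 * (CN ^ 2 * (G + 1) ^ 2 * L * nmin⁻¹ ^ 2) * (amax * Cinv ^ 2) := by
      refine le_trans ?_ (le_mul_of_one_le_right (by linarith) h7)
      linarith
    linarith
  have hY0 : 0 ≤ Y := by
    have : 0 ≤ X * (G * (CN * nmin⁻¹)) := by positivity
    linarith
  -- the local estimate
  have hloc : ∀ i, ∀ u ∈ P.Vh, ∀ w, w = restrictTo (P.Omc i) u -
        P.proj i (p i) (m i) (restrictTo (P.Omc i) u) →
      w ∈ P.Vt i ∧ 0 ≤ P.bi i w w ∧ P.bi i w w ≤ Y * P.energyForm (P.Omc i) u u ∧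
        lam i ⟨m i, hm i⟩ * P.ci i w w ≤ P.bi i w w := by
    intro i u hu w hw
    have hsy := hsys i
    have hD := restrict_Omc_le (hsub i)
    have := finiteDimensional_Vt (i := i) hrP
    obtain ⟨b, hb⟩ := exists_bi_linear hP (hsub i)
    obtain ⟨c, hc⟩ := exists_ci_linear hrP hP (hsub i)
    let p' : Fin (K i) → P.Vt i := fun j => ⟨p i j, hsy.mem j⟩
    have hu' : restrictTo (P.Omc i) u ∈ P.Vt i := Submodule.mem_map_of_mem hu
    let v' : P.Vt i := ⟨restrictTo (P.Omc i) u, hu'⟩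
    let w' : P.Vt i := v' - ∑ j : Fin (K i) with j.val < m i, c v' (p' j) • p' j
    have hw' : (w' : P.Omc i → ℝ) = w := by
      rw [hw, proj]
      simp only [w', Submodule.coe_sub, Submodule.coe_sum, Submodule.coe_smul, hc]
      rfl
    have key := projection_error b c (p := p') (lam := lam i)
      (fun x y => by rw [hc, hc]; exact energyForm_comm hP hD)
      (fun x y => by rw [hb, hb]; exact bForm_comm hP hD)
      (fun j j' => by rw [hc]; exact hsy.orthonormal j j')
      (fun j v => by rw [hb, hc]; exact hsy.eigen j v v.2) hsy.mono
      (by rw [← finrank_kerC c hc]; exact hsy.number)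
      (fun z hz => by
        rw [hb]
        refine bi_nonneg_kerC hCP hpoinP hkh hP hsub hd0 hrP hk ⟨z.2, fun w hw => ?_⟩
        have := hz ⟨w, hw⟩
        rwa [hc] at this)
      hX0
      (fun j => neg_eigenvalue_le hCP hpoinP hkh hP hsub hrP hinv hamax0 hCN0 hCNP (hsy.mem j)
        (by rw [hsy.orthonormal, if_pos rfl]) (hsy.eigen j))
      (hm i) (hpos i) v' w' rfl
    simp only [hb, hc, hw'] at key
    refine ⟨hw' ▸ w'.2, key.1, key.2.1.trans ?_, key.2.2⟩
    have e1 := bForm_le_energyForm hP hD (nice_Omc (hsub i) hu)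
    have e2 := ci_le (i := i) hrP hinv hP hamax0 hsub hCN0 hCNP hu
    have hE := energyForm_nonneg hP hD (nice_Omc (hsub i) hu)
    rw [show ((v' : P.Omc i → ℝ)) = restrictTo (P.Omc i) u from rfl, bi_restrictTo,
      ci_restrictTo hrP (hsub i)]
    calc _ ≤ P.energyForm (P.Omc i) u u +
          X * (G * (CN * nmin⁻¹) * P.energyForm (P.Omc i) u u) :=
          add_le_add e1 (mul_le_mul_of_nonneg_left e2 hX0)
      _ = (1 + X * (G * (CN * nmin⁻¹))) * P.energyForm (P.Omc i) u u := by ring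
      _ ≤ _ := mul_le_mul_of_nonneg_right hconst hE
  refine ⟨fun i v hv => ?_, fun v hv => ⟨z0_mem p m v, ?_, ?_⟩⟩
  · obtain ⟨u, hu, rfl⟩ := P.exists_restrictTo i hv
    obtain ⟨-, h1, h2, -⟩ := hloc i u hu _ rfl
    refine ⟨h1, ?_⟩
    rwa [energyNorm_sq hP (restrict_Omc_le (hsub i)) (nice_zeroExt (hsub i) hv),
      energyForm_zeroExt_restrictTo]
  · exact ciInf_le ⟨0, by rintro _ ⟨z, rfl⟩; exact sq_nonneg _⟩
      (⟨P.z0 p m v, z0_mem p m v⟩ : P.V0 p m)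
  · set w : ∀ i, P.Omc i → ℝ := fun i => restrictTo (P.Omc i) v -
      P.proj i (p i) (m i) (restrictTo (P.Omc i) v) with hw
    have hwV : ∀ i, w i ∈ P.Vt i := fun i => (hloc i v hv _ rfl).1
    -- The projection error is again the restriction of some element of `V^h`, so the lemmas on
    -- `xiExt` apply to it.
    choose y hy hyw using fun i => P.exists_restrictTo i (hwV i)
    have hg : ∀ i, zeroExt (P.Xi i (w i)) = P.xiExt i (y i) := fun i => by
      rw [← hyw i, zeroExt_Xi_restrictTo hrP (hsub i)]
    have hsum : v - P.z0 p m v = ∑ i, P.xiExt i (y i) := by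
      -- Partition of unity applied to `v`, then linearity of `E_i Ξ_i` in each summand.
      conv_lhs => rw [← sum_xiExt hrP hcov hv, z0, ← Finset.sum_sub_distrib]
      refine Finset.sum_congr rfl fun i _ => ?_
      rw [← hg, sum_xiExt hrP hcov hv, ← zeroExt_Xi_restrictTo hrP (hsub i)]
      exact ((P.xiLin i).map_sub _ _).symm
    have hci : ∀ i, P.energyForm (P.Omc i) (P.xiExt i (y i)) (P.xiExt i (y i)) =
        P.ci i (w i) (w i) := fun i => by rw [ci, hg]
    have hvn := nice_of_mem hv
    have hvz : v - P.z0 p m v ∈ P.Vh := by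
      rw [hsum]; exact Submodule.sum_mem _ fun i _ => xiExt_mem hrP _
    rw [energyNorm_sq hP le_rfl hvn, energyNorm_sq hP le_rfl (nice_of_mem hvz), hsum]
    refine (energyForm_sum_le hP hsub (fun i => xiExt_mem hrP _)
      fun i x hx => xiExt_eq_zero hrP (hsub i) _ hx).trans ?_
    -- With at least one subdomain the infimum in `Theta` is an attained minimum, hence positive.
    have hN : Nonempty (Fin P.N) := by
      obtain ⟨T, hT⟩ := P.mesh.nonempty
      obtain ⟨x, hx⟩ := (P.mesh.isCell hT).interior_nonempty
      have hxO : x ∈ P.Om := interior_hull_subset_openUnion hT hx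
      rw [hcov.2] at hxO
      exact ⟨(mem_iUnion.1 hxO).choose⟩
    set μ := ⨅ i, lam i ⟨m i, hm i⟩ with hμ
    have hμ0 : 0 < μ := by
      obtain ⟨i, hi⟩ := exists_eq_ciInf_of_finite (f := fun i => lam i ⟨m i, hm i⟩)
      rw [hμ, ← hi]
      exact hpos i
    have hΘ : P.Theta lam m hm = 1 / μ := rfl
    have hterm : ∀ i, P.energyForm (P.Omc i) (P.xiExt i (y i)) (P.xiExt i (y i)) ≤
        Y * P.Theta lam m hm * P.energyForm (P.Omc i) v v := by
      intro i
      obtain ⟨-, -, h2, h3⟩ := hloc i v hv _ rfl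
      have hc0 : 0 ≤ P.ci i (w i) (w i) := by
        rw [← hci]
        exact energyForm_nonneg hP (restrict_Omc_le (hsub i)) (nice_Omc (hsub i) (xiExt_mem hrP _))
      have h4 : μ * P.ci i (w i) (w i) ≤ Y * P.energyForm (P.Omc i) v v :=
        (mul_le_mul_of_nonneg_right (ciInf_le (Set.finite_range _).bddBelow i) hc0).trans
          (h3.trans h2)
      rw [hci, hΘ, mul_one_div, div_mul_eq_mul_div, le_div_iff₀ hμ0]
      linarith
    have hYΘ : 0 ≤ Y * P.Theta lam m hm := by rw [hΘ]; positivity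
    -- The first Λ_c stems from the sum of the supported functions; the second arises when the local
    -- energies of `v` are added up.
    calc _ ≤ (P.overlapC : ℝ) * ∑ i, Y * P.Theta lam m hm * P.energyForm (P.Omc i) v v :=
          mul_le_mul_of_nonneg_left (Finset.sum_le_sum fun i _ => hterm i) (Nat.cast_nonneg _)
      _ ≤ (P.overlapC : ℝ) * (Y * P.Theta lam m hm * (P.overlapC * P.energyForm P.Om v v)) := by
          rw [← Finset.mul_sum]
          exact mul_le_mul_of_nonneg_left (mul_le_mul_of_nonneg_left
            (sum_energyForm_le hP hsub hv) hYΘ) (Nat.cast_nonneg _)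
      _ = _ := by rw [hY]; ring

end
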